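/- **Setup.** For a commutative ring $R$ let $R\text{-Cat}$ be the 2-category of $R$-linear categories (categories enriched in $R$-modules), $R$-linear functors and natural transformations. Its tensor product $C\otimes_R D$ has as objects pairs $(X,Y)$ and as morphisms $\mathrm{Hom}_C(X,X')\otimes_R\mathrm{Hom}_D(Y,Y')$; the unit $I$ has one object with endomorphism ring $R$. For $n=0,1,2,\infty$ let $\mathsf E_n(R\text{-Cat})$ be the 2-category of $E_n$-algebras in $R\text{-Cat}$, that is, of pointed ($n=0$), monoidal ($n=1$), braided monoidal ($n=2$), symmetric monoidal ($n=\infty$) $R$-linear categories, with functors that preserve the structure up to specified coherent isomorphism, and with pointed, respectively monoidal, natural transformations. More generally, an $E_n$-algebra in a symmetric monoidal 2-category consists of a 0-cell $X$ with a 1-cell $I\to X$ ($n=0$), and in addition a multiplication $X\otimes X\to X$ with invertible associator and unitor 2-cells satisfying the pentagon and triangle laws ($n\ge 1$), a braiding 2-cell satisfying the two hexagon laws ($n\ge 2$), which is a symmetry for $n=\infty$; 1-cells preserve this structure up to specified coherent invertible 2-cells and 2-cells are compatible with these. For a ring homomorphism $R\to k$ the base change $k\otimes_R C$ has the same objects as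 $C$ and morphisms $k\otimes_R\mathrm{Hom}_C(X,Y)$. Let $R=\mathbb C[\varepsilon]/\varepsilon^2$ (respectively $R=\mathbb C[[\hbar]]$), with the augmentation $R\to\mathbb C$ that sends $\varepsilon$ (respectively $\hbar$) to $0$. The 2-category $\mathsf{aP}_n\text{-Cat}$ (respectively $\mathsf{BD}_n\text{-Cat}$) is the following explicit homotopy pullback. * 0-cells: triples $(C,S,\psi)$ of an $E_n$-algebra $C$ in $R\text{-Cat}$, a symmetric monoidal $\mathbb C$-linear category $S$, and an $E_n$-functor $\psi\colon\mathbb C\otimes_R C\to S$ that is an equivalence. * 1-cells $(C,S,\psi)\to(C',S',\psi')$: triples $(F,G,\varphi)$ of an $E_n$-functor $F\colon C\to C'$, a symmetric monoidal functor $G\colon S\to S'$ and an invertible $E_n$-natural transformation $\varphi\colon\psi'\circ(\mathbb C\otimes_R F)\Rightarrow G\circ\psi$. * 2-cells $(F,G,\varphi)\Rightarrow(F',G',\varphi')$: pairs of an $E_n$-natural transformation $\alpha\colon F\Rightarrow F'$ and a monoidal natural transformation $\beta\colon G\Rightarrow G'$ with $\beta_{\psi}\circ\varphi=\varphi'\circ\psi'(\mathbb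 C\otimes_R\alpha)$. The 2-categories $\mathsf{aP}_0\text{-Cat}$ and $\mathsf{BD}_0\text{-Cat}$ are symmetric monoidal under the componentwise tensor product $$(C,S,\psi)\otimes(C',S',\psi')=\bigl(C\otimes_R C',\ S\otimes_{\mathbb C}S',\ \mathbb C\otimes_R(C\otimes_R C')\cong(\mathbb C\otimes_R C)\otimes_{\mathbb C}(\mathbb C\otimes_R C')\xrightarrow{\ \psi\otimes\psi'\ }S\otimes_{\mathbb C}S'\bigr),$$ with unit $(I,I,\mathbb C\otimes_R I\cong I)$ and componentwise structural 1-cells, whose compatibility 2-cells are identities. **Theorem.** For $n=0,1,2,\infty$ there are equivalences of 2-categories (biequivalences) $$\mathsf E_n(\mathsf{aP}_0\text{-Cat})\simeq\mathsf{aP}_n\text{-Cat},\qquad \mathsf E_n(\mathsf{BD}_0\text{-Cat})\simeq\mathsf{BD}_n\text{-Cat}.$$ -/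

import Mathlib

universe w v v' u u'

noncomputable section

open CategoryTheory Bicategory
open scoped TensorProduct

namespace CatDQ

attribute [-instance] catToReflQuiver

/-! ### Displayed bicategories and their total bicategories -/

/-- Extra structure on the cells of a bicategory `B` (a displayed bicategory over `B` whose
2-cells are a property). -/
structure Disp (B : Type u) [Bicategory.{w, v} B] where
  Ob : B → Type u'
  Mor : ∀ {a b : B}, Ob a → Ob b → (a ⟶ b) → Type v'
  Two : ∀ {a b : B} {x : Ob a} {y : Ob b} {f g : a ⟶ b}, Mor x y f → Mor x y g → (f ⟶ g) → Prop
  id : ∀ {a : B} (x : Ob a), Mor x x (𝟙 a)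
  comp : ∀ {a b c : B} {x : Ob a} {y : Ob b} {z : Ob c} {f : a ⟶ b} {g : b ⟶ c},
    Mor x y f → Mor y z g → Mor x z (f ≫ g)
  two_id : ∀ {a b : B} {x : Ob a} {y : Ob b} {f : a ⟶ b} (p : Mor x y f), Two p p (𝟙 f)
  two_comp : ∀ {a b : B} {x : Ob a} {y : Ob b} {f g h : a ⟶ b} {p : Mor x y f} {q : Mor x y g}
    {r : Mor x y h} {s : f ⟶ g} {t : g ⟶ h}, Two p q s → Two q r t → Two p r (s ≫ t)
  two_inv : ∀ {a b : B} {x : Ob a} {y : Ob b} {f g : a ⟶ b} {p : Mor x y f} {q : Mor x y g}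
    (e : f ≅ g), Two p q e.hom → Two q p e.inv
  two_whiskerLeft : ∀ {a b c : B} {x : Ob a} {y : Ob b} {z : Ob c} {f : a ⟶ b} {g h : b ⟶ c}
    (p : Mor x y f) {q : Mor y z g} {r : Mor y z h} {t : g ⟶ h}, Two q r t →
    Two (comp p q) (comp p r) (f ◁ t)
  two_whiskerRight : ∀ {a b c : B} {x : Ob a} {y : Ob b} {z : Ob c} {f g : a ⟶ b} {h : b ⟶ c}
    {p : Mor x y f} {q : Mor x y g} {t : f ⟶ g} (r : Mor y z h), Two p q t →
    Two (comp p r) (comp q r) (t ▷ h)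
  two_associator : ∀ {a b c d : B} {x : Ob a} {y : Ob b} {z : Ob c} {t : Ob d} {f : a ⟶ b}
    {g : b ⟶ c} {h : c ⟶ d} (p : Mor x y f) (q : Mor y z g) (r : Mor z t h),
    Two (comp (comp p q) r) (comp p (comp q r)) (α_ f g h).hom
  two_leftUnitor : ∀ {a b : B} {x : Ob a} {y : Ob b} {f : a ⟶ b} (p : Mor x y f),
    Two (comp (id x) p) p (λ_ f).hom
  two_rightUnitor : ∀ {a b : B} {x : Ob a} {y : Ob b} {f : a ⟶ b} (p : Mor x y f),
    Two (comp p (id y)) p (ρ_ f).hom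

/-- 0-cells of `B` with structure. -/
structure TotalBicat {B : Type u} [Bicategory.{w, v} B] (D : Disp.{w, v, v', u, u'} B) where
  base : B
  str : D.Ob base

namespace TotalBicat

variable {B : Type u} [Bicategory.{w, v} B] {D : Disp.{w, v, v', u, u'} B}

/-- 1-cells of `B` with structure. -/
structure Hom (X Y : TotalBicat D) where
  base : X.base ⟶ Y.base
  str : D.Mor X.str Y.str base

/-- 2-cells of `B` compatible with the structure. -/
@[ext]
structure Hom₂ {X Y : TotalBicat D} (f g : Hom X Y) where
  base : f.base ⟶ g.base
  prop : D.Two f.str g.str base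

instance (X Y : TotalBicat D) : Category (Hom X Y) where
  Hom f g := Hom₂ f g
  id f := ⟨𝟙 f.base, D.two_id _⟩
  comp s t := ⟨s.base ≫ t.base, D.two_comp s.prop t.prop⟩
  id_comp _ := Hom₂.ext (Category.id_comp _)
  comp_id _ := Hom₂.ext (Category.comp_id _)
  assoc _ _ _ := Hom₂.ext (Category.assoc _ _ _)

instance : CategoryStruct (TotalBicat D) where
  Hom X Y := Hom X Y
  id X := ⟨𝟙 X.base, D.id X.str⟩
  comp f g := ⟨f.base ≫ g.base, D.comp f.str g.str⟩

instance (X Y : TotalBicat D) : Category (X ⟶ Y) := inferInstanceAs (Category (Hom X Y))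

@[simp] theorem id_base (X : TotalBicat D) : (𝟙 X : X ⟶ X).base = 𝟙 X.base := rfl
@[simp] theorem comp_base {X Y Z : TotalBicat D} (f : X ⟶ Y) (g : Y ⟶ Z) :
    (f ≫ g).base = f.base ≫ g.base := rfl
@[simp] theorem id₂_base {X Y : TotalBicat D} (f : X ⟶ Y) : (𝟙 f : f ⟶ f).base = 𝟙 f.base := rfl
@[simp] theorem comp₂_base {X Y : TotalBicat D} {f g h : X ⟶ Y} (s : f ⟶ g) (t : g ⟶ h) :
    (s ≫ t).base = s.base ≫ t.base := rfl

@[ext] theorem hom₂_ext {X Y : TotalBicat D} {f g : X ⟶ Y} {s t : f ⟶ g} (h : s.base = t.base) :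
    s = t := Hom₂.ext h

/-- An invertible 2-cell of `B` that respects the structure is invertible as such. -/
def isoMk {X Y : TotalBicat D} {f g : X ⟶ Y} (e : f.base ≅ g.base) (h : D.Two f.str g.str e.hom) :
    f ≅ g where
  hom := ⟨e.hom, h⟩
  inv := ⟨e.inv, D.two_inv e h⟩
  hom_inv_id := hom₂_ext e.hom_inv_id
  inv_hom_id := hom₂_ext e.inv_hom_id

/-- The underlying invertible 2-cell of `B`. -/
def isoBase {X Y : TotalBicat D} {f g : X ⟶ Y} (e : f ≅ g) : f.base ≅ g.base where
  hom := e.hom.base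
  inv := e.inv.base
  hom_inv_id := congrArg Hom₂.base e.hom_inv_id
  inv_hom_id := congrArg Hom₂.base e.inv_hom_id

instance : Bicategory (TotalBicat D) where
  homCategory := inferInstance
  whiskerLeft f _ _ t := ⟨f.base ◁ t.base, D.two_whiskerLeft f.str t.prop⟩
  whiskerRight t h := ⟨t.base ▷ h.base, D.two_whiskerRight h.str t.prop⟩
  associator f g h := isoMk (α_ f.base g.base h.base) (D.two_associator f.str g.str h.str)
  leftUnitor f := isoMk (λ_ f.base) (D.two_leftUnitor f.str)
  rightUnitor f := isoMk (ρ_ f.base) (D.two_rightUnitor f.str)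
  whiskerLeft_id _ _ := hom₂_ext (Bicategory.whiskerLeft_id _ _)
  whiskerLeft_comp _ _ _ _ _ _ := hom₂_ext (Bicategory.whiskerLeft_comp _ _ _)
  id_whiskerLeft _ := hom₂_ext (Bicategory.id_whiskerLeft _)
  comp_whiskerLeft _ _ _ _ _ := hom₂_ext (Bicategory.comp_whiskerLeft _ _ _)
  id_whiskerRight _ _ := hom₂_ext (Bicategory.id_whiskerRight _ _)
  comp_whiskerRight _ _ _ := hom₂_ext (Bicategory.comp_whiskerRight _ _ _)
  whiskerRight_id _ := hom₂_ext (Bicategory.whiskerRight_id _)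
  whiskerRight_comp _ _ _ := hom₂_ext (Bicategory.whiskerRight_comp _ _ _)
  whisker_assoc _ _ _ _ _ := hom₂_ext (Bicategory.whisker_assoc _ _ _)
  whisker_exchange _ _ := hom₂_ext (Bicategory.whisker_exchange _ _)
  pentagon _ _ _ _ := hom₂_ext (Bicategory.pentagon _ _ _ _)
  triangle _ _ := hom₂_ext (Bicategory.triangle _ _)

@[simp] theorem whiskerLeft_base {X Y Z : TotalBicat D} (f : X ⟶ Y) {g h : Y ⟶ Z} (t : g ⟶ h) :
    (f ◁ t).base = f.base ◁ t.base := rfl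
@[simp] theorem whiskerRight_base {X Y Z : TotalBicat D} {f g : X ⟶ Y} (t : f ⟶ g) (h : Y ⟶ Z) :
    (t ▷ h).base = t.base ▷ h.base := rfl
@[simp] theorem associator_hom_base {X Y Z W : TotalBicat D} (f : X ⟶ Y) (g : Y ⟶ Z) (h : Z ⟶ W) :
    (α_ f g h).hom.base = (α_ f.base g.base h.base).hom := rfl
@[simp] theorem associator_inv_base {X Y Z W : TotalBicat D} (f : X ⟶ Y) (g : Y ⟶ Z) (h : Z ⟶ W) :
    (α_ f g h).inv.base = (α_ f.base g.base h.base).inv := rfl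
@[simp] theorem leftUnitor_hom_base {X Y : TotalBicat D} (f : X ⟶ Y) :
    (λ_ f).hom.base = (λ_ f.base).hom := rfl
@[simp] theorem leftUnitor_inv_base {X Y : TotalBicat D} (f : X ⟶ Y) :
    (λ_ f).inv.base = (λ_ f.base).inv := rfl
@[simp] theorem rightUnitor_hom_base {X Y : TotalBicat D} (f : X ⟶ Y) :
    (ρ_ f).hom.base = (ρ_ f.base).hom := rfl
@[simp] theorem rightUnitor_inv_base {X Y : TotalBicat D} (f : X ⟶ Y) :
    (ρ_ f).inv.base = (ρ_ f.base).inv := rfl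
@[simp] theorem isoMk_hom_base {X Y : TotalBicat D} {f g : X ⟶ Y} (e : f.base ≅ g.base)
    (h : D.Two f.str g.str e.hom) : (isoMk e h).hom.base = e.hom := rfl
@[simp] theorem isoMk_inv_base {X Y : TotalBicat D} {f g : X ⟶ Y} (e : f.base ≅ g.base)
    (h : D.Two f.str g.str e.hom) : (isoMk e h).inv.base = e.inv := rfl

end TotalBicat

/-! ### The bicategory of linear categories -/

/-- An `R`-linear category (a category enriched in `R`-modules). -/
structure LinCat (R : Type) [CommRing R] where
  carrier : Type u
  [category : Category.{v} carrier]
  [preadditive : Preadditive carrier]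
  [linear : Linear R carrier]

namespace LinCat

variable {R : Type} [CommRing R]

instance : CoeSort (LinCat.{v, u} R) (Type u) := ⟨carrier⟩

attribute [instance] category preadditive linear

/-- `R`-linear functors. -/
structure Fun (C D : LinCat.{v, u} R) where
  functor : C ⥤ D
  [additive : functor.Additive]
  [isLinear : functor.Linear R]

attribute [instance] Fun.additive Fun.isLinear

/-- Natural transformations of `R`-linear functors. -/
@[ext]
structure Nat₂ {C D : LinCat.{v, u} R} (F G : Fun C D) where
  nat : F.functor ⟶ G.functor

instance (C D : LinCat.{v, u} R) : Category (Fun C D) where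
  Hom F G := Nat₂ F G
  id F := ⟨𝟙 F.functor⟩
  comp s t := ⟨s.nat ≫ t.nat⟩
  id_comp _ := Nat₂.ext (Category.id_comp _)
  comp_id _ := Nat₂.ext (Category.comp_id _)
  assoc _ _ _ := Nat₂.ext (Category.assoc _ _ _)

instance : CategoryStruct (LinCat.{v, u} R) where
  Hom C D := Fun C D
  id C := ⟨𝟭 C⟩
  comp F G := ⟨F.functor ⋙ G.functor⟩

instance (C D : LinCat.{v, u} R) : Category (C ⟶ D) := inferInstanceAs (Category (Fun C D))

variable {C D E : LinCat.{v, u} R}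

/-- The action of a linear functor on objects. -/
def obj (F : C ⟶ D) (X : C) : D := F.functor.obj X

/-- The action of a linear functor on morphisms. -/
def map (F : C ⟶ D) {X Y : C} (f : X ⟶ Y) : obj F X ⟶ obj F Y := F.functor.map f

/-- The component of a natural transformation. -/
def app {F G : C ⟶ D} (t : F ⟶ G) (X : C) : obj F X ⟶ obj G X := t.nat.app X

@[simp] theorem id_obj (X : C) : obj (𝟙 C) X = X := rfl
@[simp] theorem comp_obj (F : C ⟶ D) (G : D ⟶ E) (X : C) : obj (F ≫ G) X = obj G (obj F X) := rfl
@[simp] theorem id_map {X Y : C} (f : X ⟶ Y) : map (𝟙 C) f = f := rfl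
@[simp] theorem comp_map (F : C ⟶ D) (G : D ⟶ E) {X Y : C} (f : X ⟶ Y) :
    map (F ≫ G) f = map G (map F f) := rfl
@[simp] theorem map_id (F : C ⟶ D) (X : C) : map F (𝟙 X) = 𝟙 (obj F X) := F.functor.map_id X
@[simp] theorem map_comp (F : C ⟶ D) {X Y Z : C} (f : X ⟶ Y) (g : Y ⟶ Z) :
    map F (f ≫ g) = map F f ≫ map F g := F.functor.map_comp f g
@[simp] theorem map_add (F : C ⟶ D) {X Y : C} (f g : X ⟶ Y) :
    map F (f + g) = map F f + map F g := F.functor.map_add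
@[simp] theorem map_smul (F : C ⟶ D) {X Y : C} (r : R) (f : X ⟶ Y) :
    map F (r • f) = r • map F f := F.functor.map_smul r f
@[simp] theorem id_app (F : C ⟶ D) (X : C) : app (𝟙 F) X = 𝟙 (obj F X) := rfl
@[simp] theorem comp_app {F G H : C ⟶ D} (s : F ⟶ G) (t : G ⟶ H) (X : C) :
    app (s ≫ t) X = app s X ≫ app t X := rfl
theorem naturality {F G : C ⟶ D} (t : F ⟶ G) {X Y : C} (f : X ⟶ Y) :
    map F f ≫ app t Y = app t X ≫ map G f := t.nat.naturality f
@[ext] theorem hom₂_ext {F G : C ⟶ D} {s t : F ⟶ G} (h : ∀ X, app s X = app t X) : s = t :=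
  Nat₂.ext (NatTrans.ext (funext h))

/-- Construct a linear functor. -/
def mk' (o : C → D) (m : ∀ X Y : C, (X ⟶ Y) →ₗ[R] (o X ⟶ o Y)) (hi : ∀ X, m X X (𝟙 X) = 𝟙 (o X))
    (hc : ∀ (X Y Z : C) (f : X ⟶ Y) (g : Y ⟶ Z), m X Z (f ≫ g) = m X Y f ≫ m Y Z g) : C ⟶ D :=
  letI F : C ⥤ D := { obj := o, map := fun f => m _ _ f, map_id := hi, map_comp := hc _ _ _ }
  haveI : F.Additive := ⟨(m _ _).map_add _ _⟩
  haveI : F.Linear R := ⟨fun _ _ => (m _ _).map_smul _ _⟩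
  ⟨F⟩

/-- The linear map underlying the action of a linear functor on morphisms. -/
def lmap (F : C ⟶ D) (X Y : C) : (X ⟶ Y) →ₗ[R] (obj F X ⟶ obj F Y) where
  toFun f := map F f
  map_add' := map_add F
  map_smul' := map_smul F

@[simp] theorem lmap_apply (F : C ⟶ D) {X Y : C} (f : X ⟶ Y) : lmap F X Y f = map F f := rfl

/-- Construct an invertible 2-cell from its components. -/
def isoMk {F G : C ⟶ D} (e : ∀ X, obj F X ≅ obj G X)
    (h : ∀ {X Y : C} (f : X ⟶ Y), map F f ≫ (e Y).hom = (e X).hom ≫ map G f) : F ≅ G :=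
  letI i : F.functor ≅ G.functor := NatIso.ofComponents e h
  { hom := ⟨i.hom⟩
    inv := ⟨i.inv⟩
    hom_inv_id := Nat₂.ext i.hom_inv_id
    inv_hom_id := Nat₂.ext i.inv_hom_id }

@[simp] theorem isoMk_hom_app {F G : C ⟶ D} (e : ∀ X, obj F X ≅ obj G X)
    (h : ∀ {X Y : C} (f : X ⟶ Y), map F f ≫ (e Y).hom = (e X).hom ≫ map G f) (X : C) :
    app (isoMk e h).hom X = (e X).hom := rfl
@[simp] theorem isoMk_inv_app {F G : C ⟶ D} (e : ∀ X, obj F X ≅ obj G X)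
    (h : ∀ {X Y : C} (f : X ⟶ Y), map F f ≫ (e Y).hom = (e X).hom ≫ map G f) (X : C) :
    app (isoMk e h).inv X = (e X).inv := rfl

/-- The component of an invertible 2-cell. -/
def appIso {F G : C ⟶ D} (e : F ≅ G) (X : C) : obj F X ≅ obj G X where
  hom := app e.hom X
  inv := app e.inv X
  hom_inv_id := by rw [← comp_app, e.hom_inv_id, id_app]
  inv_hom_id := by rw [← comp_app, e.inv_hom_id, id_app]

@[simp] theorem appIso_hom {F G : C ⟶ D} (e : F ≅ G) (X : C) : (appIso e X).hom = app e.hom X := rfl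
@[simp] theorem appIso_inv {F G : C ⟶ D} (e : F ≅ G) (X : C) : (appIso e X).inv = app e.inv X := rfl
@[simp] theorem hom_inv_app {F G : C ⟶ D} (e : F ≅ G) (X : C) :
    app e.hom X ≫ app e.inv X = 𝟙 _ := (appIso e X).hom_inv_id
@[simp] theorem inv_hom_app {F G : C ⟶ D} (e : F ≅ G) (X : C) :
    app e.inv X ≫ app e.hom X = 𝟙 _ := (appIso e X).inv_hom_id

instance : Bicategory (LinCat.{v, u} R) where
  homCategory := inferInstance
  whiskerLeft F _ _ t := ⟨Functor.whiskerLeft F.functor t.nat⟩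
  whiskerRight t H := ⟨Functor.whiskerRight t.nat H.functor⟩
  associator F G H := isoMk (fun _ => Iso.refl _) (by simp)
  leftUnitor F := isoMk (fun _ => Iso.refl _) (by simp)
  rightUnitor F := isoMk (fun _ => Iso.refl _) (by simp)
  whiskerLeft_id _ _ := rfl
  whiskerLeft_comp _ _ _ _ _ _ := rfl
  id_whiskerLeft t := hom₂_ext fun X => ((Category.id_comp _).trans (Category.comp_id _)).symm
  comp_whiskerLeft _ _ _ _ t := hom₂_ext fun X => ((Category.id_comp _).trans (Category.comp_id _)).symm
  id_whiskerRight F G := hom₂_ext fun X => map_id G _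
  comp_whiskerRight s t H := hom₂_ext fun X => map_comp H _ _
  whiskerRight_id t := hom₂_ext fun X => ((Category.id_comp _).trans (Category.comp_id _)).symm
  whiskerRight_comp t _ _ := hom₂_ext fun X => ((Category.id_comp _).trans (Category.comp_id _)).symm
  whisker_assoc _ _ _ t _ := hom₂_ext fun X => ((Category.id_comp _).trans (Category.comp_id _)).symm
  whisker_exchange s t := hom₂_ext fun X => (naturality t (app s X)).symm
  pentagon F G H K := hom₂_ext fun X => by
    change map K (𝟙 _) ≫ 𝟙 _ ≫ 𝟙 _ = 𝟙 _ ≫ 𝟙 _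
    simp
  triangle F G := hom₂_ext fun X => by
    change 𝟙 _ ≫ 𝟙 _ = map G (𝟙 _)
    simp

@[simp] theorem whiskerLeft_app (F : C ⟶ D) {G H : D ⟶ E} (t : G ⟶ H) (X : C) :
    app (F ◁ t) X = app t (obj F X) := rfl
@[simp] theorem whiskerRight_app {F G : C ⟶ D} (t : F ⟶ G) (H : D ⟶ E) (X : C) :
    app (t ▷ H) X = map H (app t X) := rfl
@[simp] theorem associator_hom_app {E' : LinCat.{v, u} R} (F : C ⟶ D) (G : D ⟶ E) (H : E ⟶ E')
    (X : C) : app (α_ F G H).hom X = 𝟙 (obj H (obj G (obj F X))) := rfl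
@[simp] theorem associator_inv_app {E' : LinCat.{v, u} R} (F : C ⟶ D) (G : D ⟶ E) (H : E ⟶ E')
    (X : C) : app (α_ F G H).inv X = 𝟙 (obj H (obj G (obj F X))) := rfl
@[simp] theorem leftUnitor_hom_app (F : C ⟶ D) (X : C) : app (λ_ F).hom X = 𝟙 (obj F X) := rfl
@[simp] theorem leftUnitor_inv_app (F : C ⟶ D) (X : C) : app (λ_ F).inv X = 𝟙 (obj F X) := rfl
@[simp] theorem rightUnitor_hom_app (F : C ⟶ D) (X : C) : app (ρ_ F).hom X = 𝟙 (obj F X) := rfl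
@[simp] theorem rightUnitor_inv_app (F : C ⟶ D) (X : C) : app (ρ_ F).inv X = 𝟙 (obj F X) := rfl

end LinCat

/-! ### The tensor product of linear categories -/

namespace LinCat

variable {R : Type} [CommRing R]

/-- Objects of the tensor product `C ⊗ D`: pairs of objects. -/
@[ext]
structure TensorObj (C D : LinCat.{v, u} R) where
  fst : C
  snd : D

variable {C D E C' D' E' : LinCat.{v, u} R}

/-- Composition in `C ⊗ D`. -/
def tensorCompMap (X Y Z : TensorObj C D) :
    (X.fst ⟶ Y.fst) ⊗[R] (X.snd ⟶ Y.snd) →ₗ[R] (Y.fst ⟶ Z.fst) ⊗[R] (Y.snd ⟶ Z.snd) →ₗ[R]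
      (X.fst ⟶ Z.fst) ⊗[R] (X.snd ⟶ Z.snd) :=
  TensorProduct.map₂ (Linear.comp X.fst Y.fst Z.fst) (Linear.comp X.snd Y.snd Z.snd)

@[simp] theorem tensorCompMap_tmul (X Y Z : TensorObj C D) (f : X.fst ⟶ Y.fst) (g : X.snd ⟶ Y.snd)
    (f' : Y.fst ⟶ Z.fst) (g' : Y.snd ⟶ Z.snd) :
    tensorCompMap X Y Z (f ⊗ₜ g) (f' ⊗ₜ g') = (f ≫ f') ⊗ₜ[R] (g ≫ g') := rfl

instance : Category.{v} (TensorObj C D) where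
  Hom X Y := (X.fst ⟶ Y.fst) ⊗[R] (X.snd ⟶ Y.snd)
  id X := 𝟙 X.fst ⊗ₜ 𝟙 X.snd
  comp f g := tensorCompMap _ _ _ f g
  id_comp {X Y} f := by
    induction f using TensorProduct.induction_on with
    | zero => simp
    | tmul a b => simp
    | add a b ha hb => rw [_root_.map_add, ha, hb]
  comp_id {X Y} f := by
    induction f using TensorProduct.induction_on with
    | zero => simp
    | tmul a b => simp
    | add a b ha hb => rw [_root_.map_add, LinearMap.add_apply, ha, hb]
  assoc {X Y Z W} f g h := by
    induction f using TensorProduct.induction_on with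
    | zero => simp
    | add a b ha hb => simp only [_root_.map_add, LinearMap.add_apply, ha, hb]
    | tmul a b =>
      induction g using TensorProduct.induction_on with
      | zero => simp
      | add a b ha hb => simp only [_root_.map_add, LinearMap.add_apply, ha, hb]
      | tmul a b =>
        induction h using TensorProduct.induction_on with
        | zero => simp
        | add a b ha hb => simp only [_root_.map_add, ha, hb]
        | tmul a b => simp

instance : Preadditive (TensorObj C D) where
  homGroup X Y := inferInstanceAs (AddCommGroup ((X.fst ⟶ Y.fst) ⊗[R] (X.snd ⟶ Y.snd)))
  add_comp X Y Z f f' g := by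
    exact congrArg (fun t => t g) ((tensorCompMap X Y Z).map_add f f')
  comp_add X Y Z f g g' := (tensorCompMap X Y Z f).map_add g g'

instance : Linear R (TensorObj C D) where
  homModule X Y := inferInstanceAs (Module R ((X.fst ⟶ Y.fst) ⊗[R] (X.snd ⟶ Y.snd)))
  smul_comp X Y Z r f g := by
    exact congrArg (fun t => t g) ((tensorCompMap X Y Z).map_smul r f)
  comp_smul X Y Z f r g := (tensorCompMap X Y Z f).map_smul r g

/-- The tensor product `C ⊗ D` of linear categories: objects are pairs, morphisms are tensor
products of the modules of morphisms. -/
def tensor (C D : LinCat.{v, u} R) : LinCat.{v, u} R where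
  carrier := TensorObj C D

/-- A pair of objects. -/
def pr (X : C) (Y : D) : tensor C D := TensorObj.mk X Y

/-- The first component of an object of `C ⊗ D`. -/
def fst (X : tensor C D) : C := TensorObj.fst X

/-- The second component of an object of `C ⊗ D`. -/
def snd (X : tensor C D) : D := TensorObj.snd X

@[simp] theorem fst_pr (X : C) (Y : D) : fst (pr X Y) = X := rfl
@[simp] theorem snd_pr (X : C) (Y : D) : snd (pr X Y) = Y := rfl
@[simp] theorem pr_eta (X : tensor C D) : pr (fst X) (snd X) = X := rfl

/-- Pure tensors as a bilinear map. -/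
def tmL (X X' : C) (Y Y' : D) : (X ⟶ X') →ₗ[R] (Y ⟶ Y') →ₗ[R] (pr X Y ⟶ pr X' Y') :=
  TensorProduct.mk R (X ⟶ X') (Y ⟶ Y')

/-- A pure tensor, as a morphism of `C ⊗ D`. -/
def tm {X X' : C} {Y Y' : D} (f : X ⟶ X') (g : Y ⟶ Y') : pr X Y ⟶ pr X' Y' := tmL X X' Y Y' f g

/-- The linear map on morphisms of `C ⊗ D` induced by a bilinear map. -/
def tmLift {X Y : tensor C D} {M : Type v} [AddCommGroup M] [Module R M]
    (m : (fst X ⟶ fst Y) →ₗ[R] (snd X ⟶ snd Y) →ₗ[R] M) : (X ⟶ Y) →ₗ[R] M :=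
  TensorProduct.lift m

@[simp] theorem tmL_apply {X X' : C} {Y Y' : D} (f : X ⟶ X') (g : Y ⟶ Y') :
    tmL X X' Y Y' f g = tm f g := rfl
@[simp] theorem tmLift_tm {X X' : C} {Y Y' : D} {M : Type v} [AddCommGroup M] [Module R M]
    (m : (X ⟶ X') →ₗ[R] (Y ⟶ Y') →ₗ[R] M) (f : X ⟶ X') (g : Y ⟶ Y') :
    tmLift (X := pr X Y) (Y := pr X' Y') m (tm f g) = m f g := TensorProduct.lift.tmul f g
@[simp] theorem tm_comp {X X' X'' : C} {Y Y' Y'' : D} (f : X ⟶ X') (g : Y ⟶ Y')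
    (f' : X' ⟶ X'') (g' : Y' ⟶ Y'') : tm f g ≫ tm f' g' = tm (f ≫ f') (g ≫ g') := rfl
@[simp] theorem tm_id (X : C) (Y : D) : tm (𝟙 X) (𝟙 Y) = 𝟙 (pr X Y) := rfl
theorem add_tm {X X' : C} {Y Y' : D} (f f' : X ⟶ X') (g : Y ⟶ Y') :
    tm (f + f') g = tm f g + tm f' g := by simp [← tmL_apply]
theorem tm_add {X X' : C} {Y Y' : D} (f : X ⟶ X') (g g' : Y ⟶ Y') :
    tm f (g + g') = tm f g + tm f g' := by simp [← tmL_apply]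
theorem smul_tm {X X' : C} {Y Y' : D} (r : R) (f : X ⟶ X') (g : Y ⟶ Y') :
    tm (r • f) g = r • tm f g := by simp [← tmL_apply]
theorem tm_smul {X X' : C} {Y Y' : D} (r : R) (f : X ⟶ X') (g : Y ⟶ Y') :
    tm f (r • g) = r • tm f g := by simp [← tmL_apply]

theorem tm_induction {X X' : C} {Y Y' : D} {P : (pr X Y ⟶ pr X' Y') → Prop}
    (pure : ∀ f g, P (tm f g)) (add : ∀ f g, P f → P g → P (f + g)) (f : pr X Y ⟶ pr X' Y') :
    P f := by
  refine TensorProduct.induction_on (motive := P) f ?_ pure add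
  have h := pure (0 : X ⟶ X') (0 : Y ⟶ Y')
  rwa [← tmL_apply, _root_.map_zero] at h

/-- An isomorphism in `C ⊗ D` from isomorphisms in `C` and `D`. -/
def tmIso {X X' : C} {Y Y' : D} (e : X ≅ X') (e' : Y ≅ Y') : pr X Y ≅ pr X' Y' where
  hom := tm e.hom e'.hom
  inv := tm e.inv e'.inv
  hom_inv_id := by simp
  inv_hom_id := by simp

@[simp] theorem tmIso_hom {X X' : C} {Y Y' : D} (e : X ≅ X') (e' : Y ≅ Y') :
    (tmIso e e').hom = tm e.hom e'.hom := rfl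
@[simp] theorem tmIso_inv {X X' : C} {Y Y' : D} (e : X ≅ X') (e' : Y ≅ Y') :
    (tmIso e e').inv = tm e.inv e'.inv := rfl

/-- The linear functor out of `C ⊗ D` given by a bilinear functor of two variables. -/
def lift (o : C → D → E)
    (m : ∀ (X X' : C) (Y Y' : D), (X ⟶ X') →ₗ[R] (Y ⟶ Y') →ₗ[R] (o X Y ⟶ o X' Y'))
    (hi : ∀ X Y, m X X Y Y (𝟙 X) (𝟙 Y) = 𝟙 (o X Y))
    (hc : ∀ {X X' X'' : C} {Y Y' Y'' : D} (f : X ⟶ X') (g : Y ⟶ Y') (f' : X' ⟶ X'') (g' : Y' ⟶ Y''),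
      m _ _ _ _ (f ≫ f') (g ≫ g') = m _ _ _ _ f g ≫ m _ _ _ _ f' g') : tensor C D ⟶ E :=
  mk' (fun X => o (fst X) (snd X)) (fun X Y => tmLift (m (fst X) (fst Y) (snd X) (snd Y)))
    (fun X => (tmLift_tm _ _ _).trans (hi (fst X) (snd X))) (by
      rintro ⟨X, X'⟩ ⟨Y, Y'⟩ ⟨Z, Z'⟩ f g
      change ((pr X X' : tensor C D) ⟶ pr Y Y') at f
      change ((pr Y Y' : tensor C D) ⟶ pr Z Z') at g
      change tmLift (m X Z X' Z') (f ≫ g) = tmLift (m X Y X' Y') f ≫ tmLift (m Y Z Y' Z') g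
      induction f using tm_induction with
      | add a b ha hb =>
        rw [Preadditive.add_comp, _root_.map_add, ha, hb, _root_.map_add, Preadditive.add_comp]
      | pure f f' =>
        induction g using tm_induction with
        | add a b ha hb =>
          rw [Preadditive.comp_add, _root_.map_add, ha, hb, _root_.map_add, Preadditive.comp_add]
        | pure g g' => rw [tm_comp, tmLift_tm, tmLift_tm, tmLift_tm, hc])

/-- Naturality can be checked on pure tensors. -/
theorem nat_tensor {F G : tensor C D ⟶ E} (t : ∀ X, obj F X ⟶ obj G X)
    (h : ∀ {X X' : C} {Y Y' : D} (f : X ⟶ X') (g : Y ⟶ Y'),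
      map F (tm f g) ≫ t (pr X' Y') = t (pr X Y) ≫ map G (tm f g)) {X Y : tensor C D} (f : X ⟶ Y) :
    map F f ≫ t Y = t X ≫ map G f :=
  tm_induction (X := fst X) (X' := fst Y) (Y := snd X) (Y' := snd Y)
    (P := fun f => map F f ≫ t Y = t X ≫ map G f) (fun f g => h f g)
    (fun a b ha hb => by
      exact (congrArg (· ≫ t Y) (map_add F (X := X) (Y := Y) a b)).trans
        ((Preadditive.add_comp _ _ _ _ _ _).trans ((congrArg₂ (· + ·) ha hb).trans
          ((Preadditive.comp_add _ _ _ _ _ _).symm.trans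
            (congrArg (t X ≫ ·) (map_add G (X := X) (Y := Y) a b).symm)))) ) f

/-- Construct an invertible 2-cell out of `C ⊗ D` from its components. -/
def isoMkT {F G : tensor C D ⟶ E} (e : ∀ X Y, obj F (pr X Y) ≅ obj G (pr X Y))
    (h : ∀ {X X' : C} {Y Y' : D} (f : X ⟶ X') (g : Y ⟶ Y'),
      map F (tm f g) ≫ (e X' Y').hom = (e X Y).hom ≫ map G (tm f g)) : F ≅ G :=
  isoMk (fun X => e (fst X) (snd X))
    (fun f => nat_tensor (fun X => (e (fst X) (snd X)).hom) (fun f g => h f g) f)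

@[simp] theorem isoMkT_hom_app {F G : tensor C D ⟶ E} (e : ∀ X Y, obj F (pr X Y) ≅ obj G (pr X Y))
    (h : ∀ {X X' : C} {Y Y' : D} (f : X ⟶ X') (g : Y ⟶ Y'),
      map F (tm f g) ≫ (e X' Y').hom = (e X Y).hom ≫ map G (tm f g)) (X : C) (Y : D) :
    app (isoMkT e h).hom (pr X Y) = (e X Y).hom := rfl

/-- The tensor product of linear functors. -/
def tensorHom (F : C ⟶ C') (G : D ⟶ D') : tensor C D ⟶ tensor C' D' :=
  lift (fun X Y => pr (obj F X) (obj G Y))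
    (fun X X' Y Y' => (tmL _ _ _ _).compl₁₂ (lmap F X X') (lmap G Y Y')) (by simp) (by simp)

@[simp] theorem tensorHom_obj (F : C ⟶ C') (G : D ⟶ D') (X : C) (Y : D) :
    obj (tensorHom F G) (pr X Y) = pr (obj F X) (obj G Y) := rfl
@[simp] theorem tensorHom_map (F : C ⟶ C') (G : D ⟶ D') {X X' : C} {Y Y' : D} (f : X ⟶ X')
    (g : Y ⟶ Y') : map (tensorHom F G) (tm f g) = tm (map F f) (map G g) := rfl

/-- The tensor product of invertible natural transformations. -/
def tensorIso {F F' : C ⟶ C'} {G G' : D ⟶ D'} (s : F ≅ F') (t : G ≅ G') :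
    tensorHom F G ≅ tensorHom F' G' :=
  isoMkT (fun X Y => tmIso (appIso s X) (appIso t Y)) (by simp [naturality])

@[simp] theorem tensorIso_hom_app {F F' : C ⟶ C'} {G G' : D ⟶ D'} (s : F ≅ F') (t : G ≅ G')
    (X : C) (Y : D) : app (tensorIso s t).hom (pr X Y) = tm (app s.hom X) (app t.hom Y) := rfl

/-- `𝟙 ⊗ 𝟙 ≅ 𝟙`, with identity components. -/
def tensorId (C D : LinCat.{v, u} R) : tensorHom (𝟙 C) (𝟙 D) ≅ 𝟙 (tensor C D) :=
  isoMkT (fun _ _ => Iso.refl _) (by simp)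

/-- `(F ≫ F') ⊗ (G ≫ G') ≅ (F ⊗ G) ≫ (F' ⊗ G')`, with identity components. -/
def tensorComp (F : C ⟶ C') (F' : C' ⟶ E) (G : D ⟶ D') (G' : D' ⟶ E') :
    tensorHom (F ≫ F') (G ≫ G') ≅ tensorHom F G ≫ tensorHom F' G' :=
  isoMkT (fun _ _ => Iso.refl _) (by simp)

@[simp] theorem tensorId_hom_app (X : C) (Y : D) : app (tensorId C D).hom (pr X Y) = 𝟙 (pr X Y) :=
  rfl
@[simp] theorem tensorComp_hom_app (F : C ⟶ C') (F' : C' ⟶ E) (G : D ⟶ D') (G' : D' ⟶ E')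
    (X : C) (Y : D) : app (tensorComp F F' G G').hom (pr X Y) =
      𝟙 (pr (obj F' (obj F X)) (obj G' (obj G Y))) := rfl

end LinCat

/-! ### The structural functors of the tensor product -/

namespace LinCat

variable {R : Type} [CommRing R] {C D E C' D' E' : LinCat.{v, u} R}

theorem comp_of_pure {X X' X'' : C} {Y Y' Y'' : D} {a b c : E}
    (m : (pr X Y ⟶ pr X' Y') →ₗ[R] (a ⟶ b)) (m' : (pr X' Y' ⟶ pr X'' Y'') →ₗ[R] (b ⟶ c))
    (m'' : (pr X Y ⟶ pr X'' Y'') →ₗ[R] (a ⟶ c))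
    (hc : ∀ (f : X ⟶ X') (g : Y ⟶ Y') (f' : X' ⟶ X'') (g' : Y' ⟶ Y''),
      m'' (tm (f ≫ f') (g ≫ g')) = m (tm f g) ≫ m' (tm f' g'))
    (f : pr X Y ⟶ pr X' Y') (g : pr X' Y' ⟶ pr X'' Y'') : m'' (f ≫ g) = m f ≫ m' g := by
  induction f using tm_induction with
  | add a b ha hb =>
    rw [Preadditive.add_comp, _root_.map_add, ha, hb, _root_.map_add, Preadditive.add_comp]
  | pure f f' =>
    induction g using tm_induction with
    | add a b ha hb =>
      rw [Preadditive.comp_add, _root_.map_add, ha, hb, _root_.map_add, Preadditive.comp_add]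
    | pure g g' => rw [tm_comp, hc]

theorem nat_of_pure {X X' : C} {Y Y' : D} {a b a' b' : E}
    (m : (pr X Y ⟶ pr X' Y') →ₗ[R] (a ⟶ b)) (m' : (pr X Y ⟶ pr X' Y') →ₗ[R] (a' ⟶ b'))
    (t : a ⟶ a') (t' : b ⟶ b') (h : ∀ (f : X ⟶ X') (g : Y ⟶ Y'), m (tm f g) ≫ t' = t ≫ m' (tm f g))
    (f : pr X Y ⟶ pr X' Y') : m f ≫ t' = t ≫ m' f := by
  induction f using tm_induction with
  | add a b ha hb =>
    rw [_root_.map_add, Preadditive.add_comp, ha, hb, _root_.map_add, Preadditive.comp_add]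
  | pure f f' => exact h f f'

/-- A linear functor out of `C ⊗ D`, given on objects and by linear maps on morphisms. -/
def mkT (o : tensor C D → E) (m : ∀ X Y : tensor C D, (X ⟶ Y) →ₗ[R] (o X ⟶ o Y))
    (hi : ∀ X Y, m (pr X Y) (pr X Y) (tm (𝟙 X) (𝟙 Y)) = 𝟙 (o (pr X Y)))
    (hc : ∀ {X X' X'' : C} {Y Y' Y'' : D} (f : X ⟶ X') (g : Y ⟶ Y') (f' : X' ⟶ X'') (g' : Y' ⟶ Y''),
      m (pr X Y) (pr X'' Y'') (tm (f ≫ f') (g ≫ g')) =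
        m (pr X Y) (pr X' Y') (tm f g) ≫ m (pr X' Y') (pr X'' Y'') (tm f' g')) : tensor C D ⟶ E :=
  mk' o m (fun X => hi (fst X) (snd X)) (fun X Y Z f g =>
    comp_of_pure (X := fst X) (X' := fst Y) (X'' := fst Z) (Y := snd X) (Y' := snd Y)
      (Y'' := snd Z) (m X Y) (m Y Z) (m X Z) hc f g)

/-- The associator `(C ⊗ D) ⊗ E ⟶ C ⊗ (D ⊗ E)`. -/
def assoc (C D E : LinCat.{v, u} R) : tensor (tensor C D) E ⟶ tensor C (tensor D E) :=
  mkT (fun X => pr (fst (fst X)) (pr (snd (fst X)) (snd X)))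
    (fun X Y => (TensorProduct.assoc R (fst (fst X) ⟶ fst (fst Y)) (snd (fst X) ⟶ snd (fst Y))
      (snd X ⟶ snd Y)).toLinearMap) (fun _ _ => rfl)
    (fun {X Y Z} {X₃ Y₃ Z₃} f f₃ g g₃ =>
      comp_of_pure (X := fst X) (X' := fst Y) (X'' := fst Z) (Y := snd X) (Y' := snd Y)
        (Y'' := snd Z) (E := tensor C (tensor D E))
        (a := pr (fst X) (pr (snd X) X₃)) (b := pr (fst Y) (pr (snd Y) Y₃))
        (c := pr (fst Z) (pr (snd Z) Z₃))
        ((TensorProduct.assoc R (fst X ⟶ fst Y) (snd X ⟶ snd Y) (X₃ ⟶ Y₃)).toLinearMap ∘ₗ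
          (tmL X Y X₃ Y₃).flip f₃)
        ((TensorProduct.assoc R (fst Y ⟶ fst Z) (snd Y ⟶ snd Z) (Y₃ ⟶ Z₃)).toLinearMap ∘ₗ
          (tmL Y Z Y₃ Z₃).flip g₃)
        ((TensorProduct.assoc R (fst X ⟶ fst Z) (snd X ⟶ snd Z) (X₃ ⟶ Z₃)).toLinearMap ∘ₗ
          (tmL X Z X₃ Z₃).flip (f₃ ≫ g₃)) (fun _ _ _ _ => rfl) f g)

@[simp] theorem assoc_obj (X : C) (Y : D) (Z : E) :
    obj (assoc C D E) (pr (pr X Y) Z) = pr X (pr Y Z) := rfl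
@[simp] theorem assoc_map {X X' : C} {Y Y' : D} {Z Z' : E} (f : X ⟶ X') (g : Y ⟶ Y')
    (h : Z ⟶ Z') : map (assoc C D E) (tm (tm f g) h) = tm f (tm g h) := rfl

/-- The braiding `C ⊗ D ⟶ D ⊗ C`. -/
def braid (C D : LinCat.{v, u} R) : tensor C D ⟶ tensor D C :=
  mkT (fun X => pr (snd X) (fst X)) (fun X Y =>
    (TensorProduct.comm R (fst X ⟶ fst Y) (snd X ⟶ snd Y)).toLinearMap) (fun _ _ => rfl)
    (fun _ _ _ _ => rfl)

@[simp] theorem braid_obj (X : C) (Y : D) : obj (braid C D) (pr X Y) = pr Y X := rfl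
@[simp] theorem braid_map {X X' : C} {Y Y' : D} (f : X ⟶ X') (g : Y ⟶ Y') :
    map (braid C D) (tm f g) = tm g f := rfl

/-- The interchange on morphisms. -/
def midL (X : tensor C D) (X' : tensor C' D') (Y : tensor C D) (Y' : tensor C' D') :
    (pr X X' ⟶ pr Y Y') →ₗ[R]
      ((pr (pr (fst X) (fst X')) (pr (snd X) (snd X')) : tensor (tensor C C') (tensor D D')) ⟶
        pr (pr (fst Y) (fst Y')) (pr (snd Y) (snd Y'))) :=
  (TensorProduct.tensorTensorTensorComm R (fst X ⟶ fst Y) (snd X ⟶ snd Y)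
    (fst X' ⟶ fst Y') (snd X' ⟶ snd Y')).toLinearMap

theorem midL_tm {X₁ X₂ : C} {Y₁ Y₂ : D} {X₁' X₂' : C'} {Y₁' Y₂' : D'} (f : X₁ ⟶ X₂)
    (g : Y₁ ⟶ Y₂) (f' : X₁' ⟶ X₂') (g' : Y₁' ⟶ Y₂') :
    midL (pr X₁ Y₁) (pr X₁' Y₁') (pr X₂ Y₂) (pr X₂' Y₂') (tm (tm f g) (tm f' g')) =
      tm (tm f f') (tm g g') := rfl

theorem midL_comp {X Y Z : tensor C D} {X' Y' Z' : tensor C' D'} (f : X ⟶ Y) (f' : X' ⟶ Y')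
    (g : Y ⟶ Z) (g' : Y' ⟶ Z') : midL X X' Z Z' (tm (f ≫ g) (f' ≫ g')) =
      midL X X' Y Y' (tm f f') ≫ midL Y Y' Z Z' (tm g g') := by
  obtain ⟨X₁, X₂⟩ := X
  obtain ⟨Y₁, Y₂⟩ := Y
  obtain ⟨Z₁, Z₂⟩ := Z
  obtain ⟨X₁', X₂'⟩ := X'
  obtain ⟨Y₁', Y₂'⟩ := Y'
  obtain ⟨Z₁', Z₂'⟩ := Z'
  refine comp_of_pure (X := X₁) (X' := Y₁) (X'' := Z₁) (Y := X₂) (Y' := Y₂) (Y'' := Z₂)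
    (midL (pr X₁ X₂) (pr X₁' X₂') (pr Y₁ Y₂) (pr Y₁' Y₂') ∘ₗ (tmL _ _ _ _).flip f')
    (midL (pr Y₁ Y₂) (pr Y₁' Y₂') (pr Z₁ Z₂) (pr Z₁' Z₂') ∘ₗ (tmL _ _ _ _).flip g')
    (midL (pr X₁ X₂) (pr X₁' X₂') (pr Z₁ Z₂) (pr Z₁' Z₂') ∘ₗ (tmL _ _ _ _).flip (f' ≫ g'))
    (fun h₁ h₂ k₁ k₂ => ?_) f g
  exact comp_of_pure (X := X₁') (X' := Y₁') (X'' := Z₁') (Y := X₂') (Y' := Y₂') (Y'' := Z₂')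
    (midL (pr X₁ X₂) (pr X₁' X₂') (pr Y₁ Y₂) (pr Y₁' Y₂') ∘ₗ tmL _ _ _ _ (tm h₁ h₂))
    (midL (pr Y₁ Y₂) (pr Y₁' Y₂') (pr Z₁ Z₂) (pr Z₁' Z₂') ∘ₗ tmL _ _ _ _ (tm k₁ k₂))
    (midL (pr X₁ X₂) (pr X₁' X₂') (pr Z₁ Z₂) (pr Z₁' Z₂') ∘ₗ
      tmL _ _ _ _ (tm (h₁ ≫ k₁) (h₂ ≫ k₂))) (fun _ _ _ _ => rfl) f' g'

/-- The interchange `(C ⊗ D) ⊗ (C' ⊗ D') ⟶ (C ⊗ C') ⊗ (D ⊗ D')`. -/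
def mid (C D C' D' : LinCat.{v, u} R) :
    tensor (tensor C D) (tensor C' D') ⟶ tensor (tensor C C') (tensor D D') :=
  mkT (fun X => pr (pr (fst (fst X)) (fst (snd X))) (pr (snd (fst X)) (snd (snd X))))
    (fun X Y => midL (fst X) (snd X) (fst Y) (snd Y)) (fun _ _ => rfl)
    (fun f f' g g' => midL_comp f f' g g')

@[simp] theorem mid_obj (X : C) (Y : D) (X' : C') (Y' : D') :
    obj (mid C D C' D') (pr (pr X Y) (pr X' Y')) = pr (pr X X') (pr Y Y') := rfl
@[simp] theorem mid_map {X₁ X₂ : C} {Y₁ Y₂ : D} {X₁' X₂' : C'} {Y₁' Y₂' : D'} (f : X₁ ⟶ X₂)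
    (g : Y₁ ⟶ Y₂) (f' : X₁' ⟶ X₂') (g' : Y₁' ⟶ Y₂') :
    map (mid C D C' D') (tm (tm f g) (tm f' g')) = tm (tm f f') (tm g g') := rfl

/-- The object of the unit `R`-linear category. -/
inductive UnitObj (R : Type) : Type u
  | pt

instance : Category.{v} (UnitObj.{u} R) where
  Hom _ _ := ULift.{v} R
  id _ := ⟨1⟩
  comp f g := ⟨f.down * g.down⟩
  id_comp f := congrArg ULift.up (one_mul f.down)
  comp_id f := congrArg ULift.up (mul_one f.down)
  assoc f g h := congrArg ULift.up (mul_assoc f.down g.down h.down)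

instance : Preadditive (UnitObj.{u} R) where
  homGroup _ _ := inferInstanceAs (AddCommGroup (ULift.{v} R))
  add_comp _ _ _ f g h := congrArg ULift.up (add_mul f.down g.down h.down)
  comp_add _ _ _ f g h := congrArg ULift.up (mul_add f.down g.down h.down)

instance : Linear R (UnitObj.{u} R) where
  homModule _ _ := inferInstanceAs (Module R (ULift.{v} R))
  smul_comp _ _ _ r f g := congrArg ULift.up (mul_assoc r f.down g.down)
  comp_smul _ _ _ f r g := congrArg ULift.up (mul_left_comm f.down r g.down)

/-- The unit `I` for the tensor product: the linear category with one object and endomorphism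
ring `R`. -/
def unit (R : Type) [CommRing R] : LinCat.{v, u} R where
  carrier := UnitObj.{u} R

/-- The object of `I`. -/
def pt : unit.{v, u} R := UnitObj.pt

/-- The identification of the endomorphism module of `pt` with `R`. -/
def scalar (X Y : unit.{v, u} R) : (X ⟶ Y) ≃ₗ[R] R :=
  (ULift.moduleEquiv : ULift.{v} R ≃ₗ[R] R)

theorem scalar_id (X : unit.{v, u} R) : scalar X X (𝟙 X) = 1 := rfl
theorem scalar_comp {X Y Z : unit.{v, u} R} (f : X ⟶ Y) (g : Y ⟶ Z) :
    scalar X Z (f ≫ g) = scalar X Y f * scalar Y Z g := rfl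

/-- The left unitor `I ⊗ C ⟶ C`. -/
def leftUnit (C : LinCat.{v, u} R) : tensor (unit.{v, u} R) C ⟶ C :=
  lift (fun _ X => X) (fun r r' X X' => (LinearMap.lsmul R (X ⟶ X')) ∘ₗ (scalar r r').toLinearMap)
    (fun r X => by
      change scalar r r (𝟙 r) • 𝟙 X = 𝟙 X
      rw [scalar_id, one_smul])
    (fun {r r' r''} {X X' X''} f g f' g' => by
      change scalar r r'' (f ≫ f') • (g ≫ g') = (scalar r r' f • g) ≫ (scalar r' r'' f' • g')
      rw [scalar_comp, Linear.smul_comp, Linear.comp_smul, mul_smul])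

/-- The right unitor `C ⊗ I ⟶ C`. -/
def rightUnit (C : LinCat.{v, u} R) : tensor C (unit.{v, u} R) ⟶ C :=
  lift (fun X _ => X)
    (fun X X' r r' => ((LinearMap.lsmul R (X ⟶ X')) ∘ₗ (scalar r r').toLinearMap).flip)
    (fun X r => by
      change scalar r r (𝟙 r) • 𝟙 X = 𝟙 X
      rw [scalar_id, one_smul])
    (fun {X X' X''} {r r' r''} g f g' f' => by
      change scalar r r'' (f ≫ f') • (g ≫ g') = (scalar r r' f • g) ≫ (scalar r' r'' f' • g')
      rw [scalar_comp, Linear.smul_comp, Linear.comp_smul, mul_smul])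

/-- The linear functor out of `I` that picks out an object. -/
def pick (X : C) : unit.{v, u} R ⟶ C :=
  mk' (fun _ => X) (fun r r' => LinearMap.toSpanSingleton R (X ⟶ X) (𝟙 X) ∘ₗ (scalar r r').toLinearMap)
    (fun r => by
      change scalar r r (𝟙 r) • 𝟙 X = 𝟙 X
      rw [scalar_id, one_smul])
    (fun r r' r'' f f' => by
      change scalar r r'' (f ≫ f') • 𝟙 X = (scalar r r' f • 𝟙 X) ≫ (scalar r' r'' f' • 𝟙 X)
      rw [scalar_comp, Linear.smul_comp, Linear.comp_smul, mul_smul, Category.comp_id])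

@[simp] theorem leftUnit_obj (r : unit.{v, u} R) (X : C) : obj (leftUnit C) (pr r X) = X := rfl
@[simp] theorem leftUnit_map {r r' : unit.{v, u} R} (f : r ⟶ r') {X Y : C} (g : X ⟶ Y) :
    map (leftUnit C) (tm f g) = scalar r r' f • g := rfl
@[simp] theorem rightUnit_obj (r : unit.{v, u} R) (X : C) : obj (rightUnit C) (pr X r) = X := rfl
@[simp] theorem rightUnit_map {r r' : unit.{v, u} R} (f : r ⟶ r') {X Y : C} (g : X ⟶ Y) :
    map (rightUnit C) (tm g f) = scalar r r' f • g := rfl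
@[simp] theorem pick_obj (r : unit.{v, u} R) (X : C) : obj (pick X) r = X := rfl
@[simp] theorem pick_map {r r' : unit.{v, u} R} (f : r ⟶ r') (X : C) :
    map (pick X) f = scalar r r' f • 𝟙 X := rfl

/-- A linear functor out of `I` is multiplication by scalars on morphisms. -/
theorem map_unit (F : unit.{v, u} R ⟶ C) {r : unit.{v, u} R} (f : r ⟶ r) :
    map F f = scalar r r f • 𝟙 (obj F r) := by
  rw [← map_id, ← map_smul]
  exact congrArg (map F) (congrArg ULift.up (mul_one f.down).symm)

end LinCat

/-! ### Pseudomonoids -/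

/-- A bicategory with a unit, a tensor product and structural 1-cells. -/
class TensorCells (B : Type u) [Bicategory.{w, v} B] where
  /-- the unit -/
  I : B
  /-- the tensor product on 0-cells -/
  tObj : B → B → B
  /-- the tensor product on 1-cells -/
  tHom : ∀ {X X' Y Y' : B}, (X ⟶ X') → (Y ⟶ Y') → (tObj X Y ⟶ tObj X' Y')
  /-- the tensor product preserves identities -/
  tId : ∀ X Y : B, tHom (𝟙 X) (𝟙 Y) ≅ 𝟙 (tObj X Y)
  /-- the tensor product preserves composition -/
  tComp : ∀ {X X' X'' Y Y' Y'' : B} (f : X ⟶ X') (f' : X' ⟶ X'') (g : Y ⟶ Y') (g' : Y' ⟶ Y''),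
    tHom (f ≫ f') (g ≫ g') ≅ tHom f g ≫ tHom f' g'
  /-- the associator -/
  as : ∀ X Y Z : B, tObj (tObj X Y) Z ⟶ tObj X (tObj Y Z)
  /-- the left unitor -/
  lu : ∀ X : B, tObj I X ⟶ X
  /-- the right unitor -/
  ru : ∀ X : B, tObj X I ⟶ X
  /-- the braiding -/
  br : ∀ X Y : B, tObj X Y ⟶ tObj Y X

open TensorCells

section

variable {B : Type u} [Bicategory.{w, v} B] [TensorCells B]

/-- The data of an `E_n`-algebra in a symmetric monoidal bicategory: a unit for `n ≥ 0` (a pointed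
object), a multiplication with associator and unitors for `n ≥ 1` (a pseudomonoid), a braiding for
`n ≥ 2`. -/
structure EnOb (n : ℕ∞) (X : B) where
  /-- the unit -/
  u : (I : B) ⟶ X
  /-- the multiplication -/
  m : 1 ≤ n → (tObj X X ⟶ X)
  /-- the associator -/
  a : ∀ h, tHom (m h) (𝟙 X) ≫ m h ≅ as X X X ≫ tHom (𝟙 X) (m h) ≫ m h
  /-- the left unitor -/
  l : ∀ h, tHom u (𝟙 X) ≫ m h ≅ lu X
  /-- the right unitor -/
  r : ∀ h, tHom (𝟙 X) u ≫ m h ≅ ru X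
  /-- the braiding -/
  b : ∀ h, 2 ≤ n → (m h ≅ br X X ≫ m h)

/-- The data of a morphism of `E_n`-algebras: compatibility with units and multiplications up to
specified invertible 2-cells. -/
structure EnMor {n : ℕ∞} {X Y : B} (x : EnOb n X) (y : EnOb n Y) (f : X ⟶ Y) where
  e : y.u ≅ x.u ≫ f
  t : ∀ h, tHom f f ≫ y.m h ≅ x.m h ≫ f

namespace EnMor

variable {n : ℕ∞} {X Y Z : B}

/-- The identity morphism. -/
def id (x : EnOb n X) : EnMor x x (𝟙 X) where
  e := (ρ_ x.u).symm
  t h := whiskerRightIso (tId X X) (x.m h) ≪≫ λ_ (x.m h) ≪≫ (ρ_ (x.m h)).symm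

/-- The composition of morphisms. -/
def comp {x : EnOb n X} {y : EnOb n Y} {z : EnOb n Z} {f : X ⟶ Y} {g : Y ⟶ Z} (p : EnMor x y f)
    (q : EnMor y z g) : EnMor x z (f ≫ g) where
  e := q.e ≪≫ whiskerRightIso p.e g ≪≫ α_ x.u f g
  t h := whiskerRightIso (tComp f g f g) (z.m h) ≪≫ α_ _ _ _ ≪≫
    whiskerLeftIso (tHom f f) (q.t h) ≪≫ (α_ _ _ _).symm ≪≫ whiskerRightIso (p.t h) g ≪≫ α_ _ _ _

end EnMor

end

/-! ### Pointed, monoidal, braided and symmetric linear categories -/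

namespace LinCat

variable {R : Type} [CommRing R]

instance : TensorCells (LinCat.{v, u} R) where
  I := unit R
  tObj := tensor
  tHom := tensorHom
  tId := tensorId
  tComp := tensorComp
  as := assoc
  lu := leftUnit
  ru := rightUnit
  br := braid

end LinCat

open LinCat

variable {R : Type} [CommRing R] {n : ℕ∞} {C D E : LinCat.{v, u} R}

namespace EnOb

variable (x : EnOb n C)

/-- The unit object. -/
def one : C := obj x.u pt

/-- The product of objects. -/
def mul (h : 1 ≤ n) (X Y : C) : C := obj (x.m h) (pr X Y)

/-- The product of morphisms. -/
def mm (h : 1 ≤ n) {X X' Y Y' : C} (f : X ⟶ X') (g : Y ⟶ Y') : x.mul h X Y ⟶ x.mul h X' Y' :=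
  map (x.m h) (tm f g)

/-- The components of the associator. -/
def ac (h : 1 ≤ n) (X Y Z : C) : x.mul h (x.mul h X Y) Z ≅ x.mul h X (x.mul h Y Z) :=
  appIso (x.a h) (pr (pr X Y) Z)

/-- The components of the left unitor. -/
def lc (h : 1 ≤ n) (X : C) : x.mul h x.one X ≅ X := appIso (x.l h) (pr pt X)

/-- The components of the right unitor. -/
def rc (h : 1 ≤ n) (X : C) : x.mul h X x.one ≅ X := appIso (x.r h) (pr X pt)

/-- The components of the braiding. -/
def bc (h : 1 ≤ n) (h' : 2 ≤ n) (X Y : C) : x.mul h X Y ≅ x.mul h Y X := appIso (x.b h h') (pr X Y)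

/-- The coherence laws of pointed (`n = 0`), monoidal (`n = 1`), braided monoidal (`n = 2`) and
symmetric monoidal (`n ≥ 3`) linear categories. -/
structure Laws : Prop where
  pentagon : ∀ h X Y Z W, x.mm h (x.ac h X Y Z).hom (𝟙 W) ≫ (x.ac h X (x.mul h Y Z) W).hom ≫
    x.mm h (𝟙 X) (x.ac h Y Z W).hom =
      (x.ac h (x.mul h X Y) Z W).hom ≫ (x.ac h X Y (x.mul h Z W)).hom
  triangle : ∀ h X Y, (x.ac h X x.one Y).hom ≫ x.mm h (𝟙 X) (x.lc h Y).hom =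
    x.mm h (x.rc h X).hom (𝟙 Y)
  hexagon : ∀ h h' X Y Z, (x.ac h X Y Z).hom ≫ (x.bc h h' X (x.mul h Y Z)).hom ≫
    (x.ac h Y Z X).hom =
      x.mm h (x.bc h h' X Y).hom (𝟙 Z) ≫ (x.ac h Y X Z).hom ≫ x.mm h (𝟙 Y) (x.bc h h' X Z).hom
  hexagon' : ∀ h h' X Y Z, (x.ac h X Y Z).inv ≫ (x.bc h h' (x.mul h X Y) Z).hom ≫
    (x.ac h Z X Y).inv =
      x.mm h (𝟙 X) (x.bc h h' Y Z).hom ≫ (x.ac h X Z Y).inv ≫ x.mm h (x.bc h h' X Z).hom (𝟙 Y)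
  symmetry : ∀ h h', 3 ≤ n → ∀ X Y, (x.bc h h' X Y).hom ≫ (x.bc h h' Y X).hom = 𝟙 _

variable {x}

theorem mm_comp (h : 1 ≤ n) {X X' X'' Y Y' Y'' : C} (f : X ⟶ X') (f' : X' ⟶ X'') (g : Y ⟶ Y')
    (g' : Y' ⟶ Y'') : x.mm h (f ≫ f') (g ≫ g') = x.mm h f g ≫ x.mm h f' g' :=
  (congrArg (LinCat.map (x.m h)) (tm_comp f g f' g').symm).trans (LinCat.map_comp _ _ _)

theorem mm_id (h : 1 ≤ n) (X Y : C) : x.mm h (𝟙 X) (𝟙 Y) = 𝟙 (x.mul h X Y) :=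
  LinCat.map_id (x.m h) (pr X Y)

theorem ac_nat (h : 1 ≤ n) {X X' Y Y' Z Z' : C} (f : X ⟶ X') (g : Y ⟶ Y') (k : Z ⟶ Z') :
    x.mm h (x.mm h f g) k ≫ (x.ac h X' Y' Z').hom = (x.ac h X Y Z).hom ≫ x.mm h f (x.mm h g k) :=
  naturality (x.a h).hom (tm (tm f g) k)

theorem lc_nat (h : 1 ≤ n) {X X' : C} (f : X ⟶ X') :
    x.mm h (𝟙 x.one) f ≫ (x.lc h X').hom = (x.lc h X).hom ≫ f := by
  have := naturality (x.l h).hom (tm (𝟙 (pt : unit.{v, u} R)) f)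
  change LinCat.map (x.m h) (tm (LinCat.map x.u (𝟙 (pt : unit.{v, u} R))) f) ≫ (x.lc h X').hom =
    (x.lc h X).hom ≫ (scalar pt pt (𝟙 (pt : unit.{v, u} R)) • f) at this
  rwa [LinCat.map_id, scalar_id, one_smul] at this

theorem rc_nat (h : 1 ≤ n) {X X' : C} (f : X ⟶ X') :
    x.mm h f (𝟙 x.one) ≫ (x.rc h X').hom = (x.rc h X).hom ≫ f := by
  have := naturality (x.r h).hom (tm f (𝟙 (pt : unit.{v, u} R)))
  change LinCat.map (x.m h) (tm f (LinCat.map x.u (𝟙 (pt : unit.{v, u} R)))) ≫ (x.rc h X').hom =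
    (x.rc h X).hom ≫ (scalar pt pt (𝟙 (pt : unit.{v, u} R)) • f) at this
  rwa [LinCat.map_id, scalar_id, one_smul] at this

theorem bc_nat (h : 1 ≤ n) (h' : 2 ≤ n) {X X' Y Y' : C} (f : X ⟶ X') (g : Y ⟶ Y') :
    x.mm h f g ≫ (x.bc h h' X' Y').hom = (x.bc h h' X Y).hom ≫ x.mm h g f :=
  naturality (x.b h h').hom (tm f g)

end EnOb

namespace EnMor

variable {x : EnOb n C} {y : EnOb n D} {z : EnOb n E}

/-- The comparison of unit objects. -/
def ec {F : C ⟶ D} (p : EnMor x y F) : y.one ≅ obj F x.one := appIso p.e pt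

/-- The comparison of products. -/
def mc {F : C ⟶ D} (p : EnMor x y F) (h : 1 ≤ n) (X Y : C) :
    y.mul h (obj F X) (obj F Y) ≅ obj F (x.mul h X Y) := appIso (p.t h) (pr X Y)

/-- The coherence laws of pointed, (strong) monoidal, braided monoidal and symmetric monoidal
linear functors. -/
structure Laws {F : C ⟶ D} (p : EnMor x y F) : Prop where
  assoc : ∀ h X Y Z, y.mm h (p.mc h X Y).hom (𝟙 (obj F Z)) ≫ (p.mc h (x.mul h X Y) Z).hom ≫
    map F (x.ac h X Y Z).hom =
      (y.ac h (obj F X) (obj F Y) (obj F Z)).hom ≫ y.mm h (𝟙 (obj F X)) (p.mc h Y Z).hom ≫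
        (p.mc h X (x.mul h Y Z)).hom
  left : ∀ h X, y.mm h p.ec.hom (𝟙 (obj F X)) ≫ (p.mc h x.one X).hom ≫ map F (x.lc h X).hom =
    (y.lc h (obj F X)).hom
  right : ∀ h X, y.mm h (𝟙 (obj F X)) p.ec.hom ≫ (p.mc h X x.one).hom ≫ map F (x.rc h X).hom =
    (y.rc h (obj F X)).hom
  braid : ∀ h h' X Y, (p.mc h X Y).hom ≫ map F (x.bc h h' X Y).hom =
    (y.bc h h' (obj F X) (obj F Y)).hom ≫ (p.mc h Y X).hom

/-- Pointed (`n = 0`) and monoidal (`n ≥ 1`) natural transformations. -/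
structure Two {F G : C ⟶ D} (p : EnMor x y F) (q : EnMor x y G) (t : F ⟶ G) : Prop where
  unit : p.ec.hom ≫ app t x.one = q.ec.hom
  mul : ∀ h X Y, (p.mc h X Y).hom ≫ app t (x.mul h X Y) =
    y.mm h (app t X) (app t Y) ≫ (q.mc h X Y).hom

theorem mc_nat {F : C ⟶ D} (p : EnMor x y F) (h : 1 ≤ n) {X X' Y Y' : C} (f : X ⟶ X')
    (g : Y ⟶ Y') : y.mm h (map F f) (map F g) ≫ (p.mc h X' Y').hom =
      (p.mc h X Y).hom ≫ map F (x.mm h f g) :=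
  naturality (p.t h).hom (tm f g)

@[simp] theorem id_ec : ((EnMor.id x).ec).hom = 𝟙 x.one := rfl
@[simp] theorem id_mc (h : 1 ≤ n) (X Y : C) : ((EnMor.id x).mc h X Y).hom = 𝟙 (x.mul h X Y) := by
  change LinCat.map (x.m h) (𝟙 (pr X Y)) ≫ 𝟙 (x.mul h X Y) ≫ 𝟙 (x.mul h X Y) = _
  rw [LinCat.map_id]
  exact (Category.id_comp _).trans (Category.id_comp _)
@[simp] theorem comp_ec {F : C ⟶ D} {G : D ⟶ E} (p : EnMor x y F) (q : EnMor y z G) :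
    ((p.comp q).ec).hom = q.ec.hom ≫ map G p.ec.hom := by
  change q.ec.hom ≫ map G p.ec.hom ≫ 𝟙 _ = _
  rw [Category.comp_id]
@[simp] theorem comp_mc {F : C ⟶ D} {G : D ⟶ E} (p : EnMor x y F) (q : EnMor y z G) (h : 1 ≤ n)
    (X Y : C) : ((p.comp q).mc h X Y).hom =
      (q.mc h (obj F X) (obj F Y)).hom ≫ map G (p.mc h X Y).hom := by
  change LinCat.map (z.m h) (𝟙 (pr (obj G (obj F X)) (obj G (obj F Y)))) ≫ 𝟙 _ ≫ (q.mc h (obj F X) (obj F Y)).hom ≫ 𝟙 _ ≫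
    map G (p.mc h X Y).hom ≫ 𝟙 _ = _
  rw [LinCat.map_id, Category.comp_id, Category.id_comp, Category.id_comp,
    Category.id_comp]
  rfl

end EnMor

section

variable {A : Type u} [Category.{v} A] {a b b' c c' d e : A}

theorem sq {f : a ⟶ b} {g : b ⟶ c} {k : a ⟶ b'} {l : b' ⟶ c} (h : f ≫ g = k ≫ l) (m : c ⟶ d) :
    f ≫ g ≫ m = k ≫ l ≫ m := by rw [← Category.assoc, h, Category.assoc]

theorem sq3 {f : a ⟶ b} {g : b ⟶ c} {k : c ⟶ d} {l : a ⟶ d} (h : f ≫ g ≫ k = l) (m : d ⟶ e) :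
    f ≫ g ≫ k ≫ m = l ≫ m := by rw [← h, Category.assoc, Category.assoc]

end

theorem EnOb.mm_left {x : EnOb n C} (h : 1 ≤ n) {X X' X'' Y : C} (f : X ⟶ X') (f' : X' ⟶ X'') :
    x.mm h (f ≫ f') (𝟙 Y) = x.mm h f (𝟙 Y) ≫ x.mm h f' (𝟙 Y) := by
  rw [← mm_comp, Category.comp_id]

theorem EnOb.mm_right {x : EnOb n C} (h : 1 ≤ n) {X Y Y' Y'' : C} (g : Y ⟶ Y') (g' : Y' ⟶ Y'') :
    x.mm h (𝟙 X) (g ≫ g') = x.mm h (𝟙 X) g ≫ x.mm h (𝟙 X) g' := by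
  rw [← mm_comp, Category.comp_id]

namespace EnMor

variable {x : EnOb n C} {y : EnOb n D} {z : EnOb n E}

theorem mc_left {F : C ⟶ D} (p : EnMor x y F) (h : 1 ≤ n) {X X' Y : C} (f : X ⟶ X') :
    y.mm h (map F f) (𝟙 (obj F Y)) ≫ (p.mc h X' Y).hom = (p.mc h X Y).hom ≫ map F (x.mm h f (𝟙 Y)) := by
  rw [← mc_nat, LinCat.map_id]

theorem mc_right {F : C ⟶ D} (p : EnMor x y F) (h : 1 ≤ n) {X Y Y' : C} (f : Y ⟶ Y') :
    y.mm h (𝟙 (obj F X)) (map F f) ≫ (p.mc h X Y').hom = (p.mc h X Y).hom ≫ map F (x.mm h (𝟙 X) f) := by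
  rw [← mc_nat, LinCat.map_id]

theorem Laws.id : (EnMor.id x).Laws where
  assoc h X Y Z := by
    simp only [id_obj, LinCat.id_map, id_mc, EnOb.mm_id, Category.id_comp, Category.comp_id]
  left h X := by
    simp only [id_obj, LinCat.id_map, id_mc, id_ec, EnOb.mm_id, Category.id_comp]
  right h X := by
    simp only [id_obj, LinCat.id_map, id_mc, id_ec, EnOb.mm_id, Category.id_comp]
  braid h h' X Y := by
    simp only [id_obj, LinCat.id_map, id_mc, Category.id_comp, Category.comp_id]

theorem Laws.comp {F : C ⟶ D} {G : D ⟶ E} {p : EnMor x y F} {q : EnMor y z G} (hp : p.Laws)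
    (hq : q.Laws) : (p.comp q).Laws where
  assoc h X Y Z := by
    have h₁ := hq.assoc h (obj F X) (obj F Y) (obj F Z)
    have h₂ := congrArg (LinCat.map G) (hp.assoc h X Y Z)
    simp only [LinCat.map_comp] at h₂
    simp only [comp_obj, LinCat.comp_map, comp_mc, Category.assoc, EnOb.mm_left, EnOb.mm_right]
    rw [sq (mc_left q h _), h₂, sq3 h₁, sq (mc_right q h _)]
    simp only [Category.assoc]
  left h X := by
    have h₁ := hq.left h (obj F X)
    have h₂ := congrArg (LinCat.map G) (hp.left h X)
    simp only [LinCat.map_comp] at h₂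
    simp only [comp_obj, LinCat.comp_map, comp_mc, comp_ec, Category.assoc, EnOb.mm_left]
    rw [sq (mc_left q h _), h₂, h₁]
  right h X := by
    have h₁ := hq.right h (obj F X)
    have h₂ := congrArg (LinCat.map G) (hp.right h X)
    simp only [LinCat.map_comp] at h₂
    simp only [comp_obj, LinCat.comp_map, comp_mc, comp_ec, Category.assoc, EnOb.mm_right]
    rw [sq (mc_right q h _), h₂, h₁]
  braid h h' X Y := by
    have h₁ := hq.braid h h' (obj F X) (obj F Y)
    have h₂ := congrArg (LinCat.map G) (hp.braid h h' X Y)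
    simp only [LinCat.map_comp] at h₂
    simp only [comp_obj, LinCat.comp_map, comp_mc, Category.assoc]
    rw [h₂, sq h₁]

theorem Two.id {F : C ⟶ D} (p : EnMor x y F) : Two p p (𝟙 F) where
  unit := Category.comp_id _
  mul h X Y := by
    simp only [id_app, EnOb.mm_id, Category.id_comp, Category.comp_id]

theorem Two.comp {F G H : C ⟶ D} {p : EnMor x y F} {q : EnMor x y G} {r : EnMor x y H} {s : F ⟶ G}
    {t : G ⟶ H} (hs : Two p q s) (ht : Two q r t) : Two p r (s ≫ t) where
  unit := by rw [comp_app, ← Category.assoc, hs.unit, ht.unit]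
  mul h X Y := by
    simp only [comp_app, EnOb.mm_comp, Category.assoc]
    rw [sq (hs.mul h X Y), ht.mul]

theorem Two.inv {F G : C ⟶ D} {p : EnMor x y F} {q : EnMor x y G} (e : F ≅ G)
    (he : Two p q e.hom) : Two q p e.inv where
  unit := by rw [← he.unit, Category.assoc, hom_inv_app, Category.comp_id]
  mul h X Y := by
    have h₁ : y.mm h (app e.inv X) (app e.inv Y) ≫ y.mm h (app e.hom X) (app e.hom Y) = 𝟙 _ := by
      rw [← EnOb.mm_comp, inv_hom_app, inv_hom_app, EnOb.mm_id]
    rw [← Category.id_comp (q.mc h X Y).hom, ← h₁, Category.assoc, Category.assoc,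
      ← sq (he.mul h X Y), hom_inv_app, Category.comp_id]

theorem Two.whiskerLeft {F : C ⟶ D} {G H : D ⟶ E} (p : EnMor x y F) {q : EnMor y z G}
    {r : EnMor y z H} {t : G ⟶ H} (ht : Two q r t) : Two (p.comp q) (p.comp r) (F ◁ t) where
  unit := by
    simp only [comp_obj, comp_ec, whiskerLeft_app, Category.assoc, naturality]
    rw [← ht.unit, Category.assoc]
  mul h X Y := by
    simp only [comp_obj, comp_mc, whiskerLeft_app, Category.assoc, naturality]
    rw [sq (ht.mul h _ _)]

theorem Two.whiskerRight {F G : C ⟶ D} {H : D ⟶ E} {p : EnMor x y F} {q : EnMor x y G} {t : F ⟶ G}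
    (r : EnMor y z H) (ht : Two p q t) : Two (p.comp r) (q.comp r) (t ▷ H) where
  unit := by
    simp only [comp_obj, comp_ec, whiskerRight_app, Category.assoc]
    rw [← LinCat.map_comp, ht.unit]
  mul h X Y := by
    simp only [comp_obj, comp_mc, whiskerRight_app, Category.assoc]
    rw [← LinCat.map_comp, ht.mul, LinCat.map_comp, sq (r.mc_nat h _ _)]

end EnMor

/-- The bicategory structure on `E_n`-algebras in linear categories. -/
def EnDisp (n : ℕ∞) : Disp (LinCat.{v, u} R) where
  Ob C := {x : EnOb n C // x.Laws}
  Mor x y F := {p : EnMor x.1 y.1 F // p.Laws}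
  Two p q t := EnMor.Two p.1 q.1 t
  id _ := ⟨EnMor.id _, EnMor.Laws.id⟩
  comp p q := ⟨p.1.comp q.1, p.2.comp q.2⟩
  two_id p := EnMor.Two.id p.1
  two_comp hs ht := hs.comp ht
  two_inv e he := EnMor.Two.inv e he
  two_whiskerLeft p _ _ _ ht := EnMor.Two.whiskerLeft p.1 ht
  two_whiskerRight r ht := EnMor.Two.whiskerRight r.1 ht
  two_associator {_ _ _ _ x y z w F G H} p q r :=
    { unit := by
        simp only [comp_obj, EnMor.comp_ec, associator_hom_app, LinCat.map_comp, LinCat.comp_map,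
          Category.assoc, Category.comp_id]
      mul := fun h X Y => by
        simp only [comp_obj, EnMor.comp_mc, associator_hom_app, LinCat.map_comp, LinCat.comp_map,
          Category.assoc, Category.comp_id, EnOb.mm_id, Category.id_comp] }
  two_leftUnitor p :=
    { unit := by
        simp only [id_obj, comp_obj, EnMor.comp_ec, EnMor.id_ec, leftUnitor_hom_app, LinCat.map_id,
          Category.comp_id]
      mul := fun h X Y => by
        simp only [id_obj, comp_obj, EnMor.comp_mc, EnMor.id_mc, leftUnitor_hom_app, LinCat.map_id,
          Category.comp_id, EnOb.mm_id, Category.id_comp] }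
  two_rightUnitor p :=
    { unit := by
        simp only [id_obj, comp_obj, EnMor.comp_ec, EnMor.id_ec, rightUnitor_hom_app, LinCat.id_map,
          Category.comp_id, Category.id_comp]
      mul := fun h X Y => by
        simp only [id_obj, comp_obj, EnMor.comp_mc, EnMor.id_mc, rightUnitor_hom_app, LinCat.id_map,
          Category.comp_id, EnOb.mm_id, Category.id_comp] }


/-! ### The tensor product of `E_n`-algebras in linear categories -/

namespace LinCat

variable {C' D' E' A : LinCat.{v, u} R}

theorem prInd {P : tensor C D → Prop} (h : ∀ X Y, P (pr X Y)) (X : tensor C D) : P X :=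
  h (fst X) (snd X)

/-- Naturality for functors of two objects, the first of which is a pair. -/
theorem nat_left {F G : tensor (tensor C D) A ⟶ E} (t : ∀ X, obj F X ⟶ obj G X)
    (h : ∀ {X X' : C} {Y Y' : D} {Z Z' : A} (f : X ⟶ X') (g : Y ⟶ Y') (k : Z ⟶ Z'),
      map F (tm (tm f g) k) ≫ t (pr (pr X' Y') Z') = t (pr (pr X Y) Z) ≫ map G (tm (tm f g) k))
    {X Y : tensor (tensor C D) A} (f : X ⟶ Y) : map F f ≫ t Y = t X ≫ map G f := by
  refine nat_tensor t (fun {X X' _ _} f k => ?_) f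
  induction X using prInd with | h X₁ X₂ =>
  induction X' using prInd with | h X₁' X₂' =>
  induction f using tm_induction with
  | add a b ha hb =>
    simp only [add_tm, LinCat.map_add, Preadditive.add_comp, Preadditive.comp_add, ha, hb]
  | pure f g => exact h f g k

/-- Naturality for functors of two objects, the second of which is a pair. -/
theorem nat_right {F G : tensor A (tensor C D) ⟶ E} (t : ∀ X, obj F X ⟶ obj G X)
    (h : ∀ {Z Z' : A} {X X' : C} {Y Y' : D} (k : Z ⟶ Z') (f : X ⟶ X') (g : Y ⟶ Y'),
      map F (tm k (tm f g)) ≫ t (pr Z' (pr X' Y')) = t (pr Z (pr X Y)) ≫ map G (tm k (tm f g)))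
    {X Y : tensor A (tensor C D)} (f : X ⟶ Y) : map F f ≫ t Y = t X ≫ map G f := by
  refine nat_tensor t (fun {_ _ X X'} k f => ?_) f
  induction X using prInd with | h X₁ X₂ =>
  induction X' using prInd with | h X₁' X₂' =>
  induction f using tm_induction with
  | add a b ha hb =>
    simp only [tm_add, LinCat.map_add, Preadditive.add_comp, Preadditive.comp_add, ha, hb]
  | pure f g => exact h k f g

/-- Naturality for functors of two pairs of objects. -/
theorem nat_two {F G : tensor (tensor C D) (tensor C' D') ⟶ E} (t : ∀ X, obj F X ⟶ obj G X)
    (h : ∀ {X X' : C} {Y Y' : D} {Z Z' : C'} {W W' : D'} (f : X ⟶ X') (g : Y ⟶ Y') (f' : Z ⟶ Z')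
      (g' : W ⟶ W'), map F (tm (tm f g) (tm f' g')) ≫ t (pr (pr X' Y') (pr Z' W')) =
        t (pr (pr X Y) (pr Z W)) ≫ map G (tm (tm f g) (tm f' g')))
    {X Y : tensor (tensor C D) (tensor C' D')} (f : X ⟶ Y) : map F f ≫ t Y = t X ≫ map G f := by
  refine nat_left t (fun {_ _ _ _ X X'} f g k => ?_) f
  induction X using prInd with | h X₁ X₂ =>
  induction X' using prInd with | h X₁' X₂' =>
  induction k using tm_induction with
  | add a b ha hb =>
    simp only [tm_add, LinCat.map_add, Preadditive.add_comp, Preadditive.comp_add, ha, hb]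
  | pure f' g' => exact h f g f' g'

/-- Naturality for functors of three pairs of objects. -/
theorem nat_three {F G : tensor (tensor (tensor C D) (tensor C' D')) (tensor E' A) ⟶ E}
    (t : ∀ X, obj F X ⟶ obj G X)
    (h : ∀ {X X' : C} {Y Y' : D} {Z Z' : C'} {W W' : D'} {U U' : E'} {V V' : A} (f : X ⟶ X')
      (g : Y ⟶ Y') (f' : Z ⟶ Z') (g' : W ⟶ W') (f'' : U ⟶ U') (g'' : V ⟶ V'),
      map F (tm (tm (tm f g) (tm f' g')) (tm f'' g'')) ≫
          t (pr (pr (pr X' Y') (pr Z' W')) (pr U' V')) =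
        t (pr (pr (pr X Y) (pr Z W)) (pr U V)) ≫
          map G (tm (tm (tm f g) (tm f' g')) (tm f'' g'')))
    {X Y : tensor (tensor (tensor C D) (tensor C' D')) (tensor E' A)} (f : X ⟶ Y) :
    map F f ≫ t Y = t X ≫ map G f := by
  refine nat_two t (fun {X X' Y Y' _ _ _ _} f g f'' g'' => ?_) f
  induction X using prInd with | h X₁ X₂ =>
  induction X' using prInd with | h X₁' X₂' =>
  induction Y using prInd with | h Y₁ Y₂ =>
  induction Y' using prInd with | h Y₁' Y₂' =>
  induction f using tm_induction with
  | add a b ha hb =>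
    simp only [add_tm, LinCat.map_add, Preadditive.add_comp, Preadditive.comp_add, ha, hb]
  | pure f₁ f₂ =>
    induction g using tm_induction with
    | add a b ha hb =>
      simp only [tm_add, add_tm, LinCat.map_add, Preadditive.add_comp, Preadditive.comp_add, ha, hb]
    | pure g₁ g₂ => exact h f₁ f₂ g₁ g₂ f'' g''

/-- Naturality is automatic for functors on the unit. -/
theorem nat_unit {F G : unit.{v, u} R ⟶ E} (t : ∀ X, obj F X ⟶ obj G X)
    {X Y : unit.{v, u} R} (f : X ⟶ Y) : map F f ≫ t Y = t X ≫ map G f := by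
  obtain rfl : X = Y := by cases X; cases Y; rfl
  rw [map_unit, map_unit, Linear.smul_comp, Linear.comp_smul, Category.id_comp, Category.comp_id]

theorem smul_sq {a b c d : E} (s : R) {f f' : a ⟶ b} {g : b ⟶ d} {k : a ⟶ c} {l l' : c ⟶ d}
    (hf : f' = s • f) (hl : l' = s • l) (h : f ≫ g = k ≫ l) : f' ≫ g = k ≫ l' := by
  rw [hf, hl, Linear.smul_comp, Linear.comp_smul, h]

theorem map_smul_tm (F : tensor C D ⟶ E) (s : R) {X X' : C} {Y Y' : D} (f : X ⟶ X') (g : Y ⟶ Y') :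
    map F (tm (s • f) g) = s • map F (tm f g) := by rw [smul_tm, LinCat.map_smul]

theorem map_tm_smul (F : tensor C D ⟶ E) (s : R) {X X' : C} {Y Y' : D} (f : X ⟶ X') (g : Y ⟶ Y') :
    map F (tm f (s • g)) = s • map F (tm f g) := by rw [tm_smul, LinCat.map_smul]

end LinCat

/-- The `E_n`-structure on the tensor product of `E_n`-algebras, formed componentwise. -/
def EnOb.tensor (x : EnOb n C) (y : EnOb n D) : EnOb n (tensor C D) where
  u := pick (pr x.one y.one)
  m h := mid C D C D ≫ tensorHom (x.m h) (y.m h)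
  a h := LinCat.isoMk (fun P => tmIso
      (x.ac h (fst (fst (fst P))) (fst (snd (fst P))) (fst (snd P)))
      (y.ac h (snd (fst (fst P))) (snd (snd (fst P))) (snd (snd P))))
    (nat_three (F := tensorHom (mid C D C D ≫ tensorHom (x.m h) (y.m h)) (𝟙 _) ≫ mid C D C D ≫
        tensorHom (x.m h) (y.m h))
      (G := assoc _ _ _ ≫ tensorHom (𝟙 _) (mid C D C D ≫ tensorHom (x.m h) (y.m h)) ≫
        mid C D C D ≫ tensorHom (x.m h) (y.m h))
      (fun P => tm (x.ac h (fst (fst (fst P))) (fst (snd (fst P))) (fst (snd P))).hom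
        (y.ac h (snd (fst (fst P))) (snd (snd (fst P))) (snd (snd P))).hom)
      fun f g f' g' f'' g'' => congrArg₂ tm (x.ac_nat h f f' f'') (y.ac_nat h g g' g''))
  l h := LinCat.isoMk (fun P => tmIso (x.lc h (fst (snd P))) (y.lc h (snd (snd P))))
    (nat_right (F := tensorHom (pick (pr x.one y.one)) (𝟙 _) ≫ mid C D C D ≫ tensorHom (x.m h) (y.m h))
      (G := leftUnit _)
      (fun P => tm (x.lc h (fst (snd P))).hom (y.lc h (snd (snd P))).hom)
      fun {r r' _ _ _ _} k f g => smul_sq (scalar r r' k) (l := tm f g)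
        (map_smul_tm (mid C D C D ≫ tensorHom (x.m h) (y.m h)) (scalar r r' k) (𝟙 (pr x.one y.one))
          (tm f g)) rfl (congrArg₂ tm (x.lc_nat h f) (y.lc_nat h g)))
  r h := LinCat.isoMk (fun P => tmIso (x.rc h (fst (fst P))) (y.rc h (snd (fst P))))
    (nat_left (F := tensorHom (𝟙 _) (pick (pr x.one y.one)) ≫ mid C D C D ≫ tensorHom (x.m h) (y.m h))
      (G := rightUnit _)
      (fun P => tm (x.rc h (fst (fst P))).hom (y.rc h (snd (fst P))).hom)
      fun {_ _ _ _ r r'} f g k => smul_sq (scalar r r' k) (l := tm f g)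
        (map_tm_smul (mid C D C D ≫ tensorHom (x.m h) (y.m h)) (scalar r r' k) (tm f g)
          (𝟙 (pr x.one y.one))) rfl (congrArg₂ tm (x.rc_nat h f) (y.rc_nat h g)))
  b h h' := LinCat.isoMk (fun P => tmIso (x.bc h h' (fst (fst P)) (fst (snd P)))
      (y.bc h h' (snd (fst P)) (snd (snd P))))
    (nat_two (F := mid C D C D ≫ tensorHom (x.m h) (y.m h))
      (G := braid _ _ ≫ mid C D C D ≫ tensorHom (x.m h) (y.m h))
      (fun P => tm (x.bc h h' (fst (fst P)) (fst (snd P))).hom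
        (y.bc h h' (snd (fst P)) (snd (snd P))).hom)
      fun f g f' g' => congrArg₂ tm (x.bc_nat h h' f f') (y.bc_nat h h' g g'))

namespace EnOb

@[simp] theorem tensor_one (x : EnOb n C) (y : EnOb n D) :
    (x.tensor y).one = pr x.one y.one := rfl
@[simp] theorem tensor_mul (x : EnOb n C) (y : EnOb n D) (h : 1 ≤ n) (X X' : C) (Y Y' : D) :
    (x.tensor y).mul h (pr X Y) (pr X' Y') = pr (x.mul h X X') (y.mul h Y Y') := rfl
@[simp] theorem tensor_mm (x : EnOb n C) (y : EnOb n D) (h : 1 ≤ n) {X X' Z Z' : C} {Y Y' W W' : D}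
    (f : X ⟶ X') (g : Y ⟶ Y') (f' : Z ⟶ Z') (g' : W ⟶ W') :
    (x.tensor y).mm h (tm f g) (tm f' g') = tm (x.mm h f f') (y.mm h g g') := rfl
theorem tensor_ac (x : EnOb n C) (y : EnOb n D) (h : 1 ≤ n) (X X' X'' : C) (Y Y' Y'' : D) :
    (x.tensor y).ac h (pr X Y) (pr X' Y') (pr X'' Y'') =
      tmIso (x.ac h X X' X'') (y.ac h Y Y' Y'') := rfl
theorem tensor_lc (x : EnOb n C) (y : EnOb n D) (h : 1 ≤ n) (X : C) (Y : D) :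
    (x.tensor y).lc h (pr X Y) = tmIso (x.lc h X) (y.lc h Y) := rfl
theorem tensor_rc (x : EnOb n C) (y : EnOb n D) (h : 1 ≤ n) (X : C) (Y : D) :
    (x.tensor y).rc h (pr X Y) = tmIso (x.rc h X) (y.rc h Y) := rfl
theorem tensor_bc (x : EnOb n C) (y : EnOb n D) (h : 1 ≤ n) (h' : 2 ≤ n) (X X' : C) (Y Y' : D) :
    (x.tensor y).bc h h' (pr X Y) (pr X' Y') = tmIso (x.bc h h' X X') (y.bc h h' Y Y') := rfl

theorem Laws.tensor {x : EnOb n C} {y : EnOb n D} (hx : x.Laws) (hy : y.Laws) :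
    (x.tensor y).Laws where
  pentagon h X Y Z W := congrArg₂ tm (hx.pentagon h (fst X) (fst Y) (fst Z) (fst W))
    (hy.pentagon h (snd X) (snd Y) (snd Z) (snd W))
  triangle h X Y := congrArg₂ tm (hx.triangle h (fst X) (fst Y)) (hy.triangle h (snd X) (snd Y))
  hexagon h h' X Y Z := congrArg₂ tm (hx.hexagon h h' (fst X) (fst Y) (fst Z))
    (hy.hexagon h h' (snd X) (snd Y) (snd Z))
  hexagon' h h' X Y Z := congrArg₂ tm (hx.hexagon' h h' (fst X) (fst Y) (fst Z))
    (hy.hexagon' h h' (snd X) (snd Y) (snd Z))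
  symmetry h h' h'' X Y := congrArg₂ tm (hx.symmetry h h' h'' (fst X) (fst Y))
    (hy.symmetry h h' h'' (snd X) (snd Y))

theorem smul_swap {X Y Z W : LinCat.unit.{v, u} R} (f : X ⟶ Y) (g : Z ⟶ W) :
    (scalar X Y f • g : Z ⟶ W) = (scalar Z W g • f : X ⟶ Y) :=
  congrArg ULift.up (mul_comm f.down g.down)

/-- The `E_n`-structure on the unit. -/
def unit (n : ℕ∞) (R : Type) [CommRing R] : EnOb n (LinCat.unit.{v, u} R) where
  u := 𝟙 _
  m _ := leftUnit _
  a _ := LinCat.isoMk (fun _ => Iso.refl _)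
    (nat_left (F := tensorHom (leftUnit _) (𝟙 _) ≫ leftUnit _)
      (G := assoc _ _ _ ≫ tensorHom (𝟙 _) (leftUnit _) ≫ leftUnit _) (fun P => 𝟙 (snd P))
      fun f g k => by
        change (scalar _ _ (scalar _ _ f • g) • k) ≫ 𝟙 _ = 𝟙 _ ≫ (scalar _ _ f • scalar _ _ g • k)
        rw [Category.comp_id, Category.id_comp, LinearEquiv.map_smul, smul_eq_mul, mul_smul])
  l _ := LinCat.isoMk (fun _ => Iso.refl _)
    (nat_tensor (F := tensorHom (𝟙 _) (𝟙 _) ≫ leftUnit _) (G := leftUnit _) (fun P => 𝟙 (snd P))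
      fun f g => by
        change (scalar _ _ f • g) ≫ 𝟙 _ = 𝟙 _ ≫ (scalar _ _ f • g)
        rw [Category.comp_id, Category.id_comp])
  r _ := LinCat.isoMk (fun P => (Iso.refl (snd P) : snd P ≅ snd P))
    (nat_tensor (F := tensorHom (𝟙 _) (𝟙 _) ≫ leftUnit _) (G := rightUnit _) (fun P => 𝟙 (snd P))
      fun f g => by
        change (scalar _ _ f • g) ≫ 𝟙 _ = 𝟙 _ ≫ (scalar _ _ g • f)
        rw [Category.comp_id, Category.id_comp]
        exact smul_swap f g)
  b _ _ := LinCat.isoMk (fun P => (Iso.refl (snd P) : snd P ≅ snd P))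
    (nat_tensor (F := leftUnit _) (G := braid _ _ ≫ leftUnit _) (fun P => 𝟙 (snd P))
      fun f g => by
        change (scalar _ _ f • g) ≫ 𝟙 _ = 𝟙 _ ≫ (scalar _ _ g • f)
        rw [Category.comp_id, Category.id_comp]
        exact smul_swap f g)

theorem unit_mm_id (X Y : LinCat.unit.{v, u} R) :
    map (leftUnit _) (tm (𝟙 X) (𝟙 Y)) = 𝟙 Y := LinCat.map_id (leftUnit _) (pr X Y)

theorem unit_eq (X Y : LinCat.unit.{v, u} R) : X = Y := by cases X; cases Y; rfl

theorem Laws.unit (n : ℕ∞) : (EnOb.unit.{v, u} n R).Laws where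
  pentagon h X Y Z W := by
    change map (leftUnit _) (tm (𝟙 Z) (𝟙 W)) ≫ 𝟙 W ≫ map (leftUnit _) (tm (𝟙 X) (𝟙 W)) = 𝟙 W ≫ 𝟙 W
    rw [unit_mm_id, unit_mm_id]
    exact Category.id_comp (𝟙 W ≫ 𝟙 W)
  triangle h X Y := Category.id_comp (map (leftUnit _) (tm (𝟙 X) (𝟙 Y)))
  hexagon h h' X Y Z := by
    obtain rfl := unit_eq X Y
    obtain rfl := unit_eq X Z
    change 𝟙 X ≫ 𝟙 X ≫ 𝟙 X = map (leftUnit _) (tm (𝟙 X) (𝟙 X)) ≫ 𝟙 X ≫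
      map (leftUnit _) (tm (𝟙 X) (𝟙 X))
    rw [unit_mm_id]
    rfl
  hexagon' h h' X Y Z := by
    obtain rfl := unit_eq X Y
    obtain rfl := unit_eq X Z
    change 𝟙 X ≫ 𝟙 X ≫ 𝟙 X = map (leftUnit _) (tm (𝟙 X) (𝟙 X)) ≫ 𝟙 X ≫
      map (leftUnit _) (tm (𝟙 X) (𝟙 X))
    rw [unit_mm_id]
    rfl
  symmetry h h' h'' X Y := Category.id_comp _

end EnOb

/-- The tensor product of morphisms of `E_n`-algebras. -/
def EnMor.tensor {C' D' : LinCat.{v, u} R} {x : EnOb n C} {x' : EnOb n C'} {y : EnOb n D}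
    {y' : EnOb n D'} {F : C ⟶ C'} {G : D ⟶ D'} (p : EnMor x x' F) (q : EnMor y y' G) :
    EnMor (x.tensor y) (x'.tensor y') (tensorHom F G) where
  e := LinCat.isoMk (fun _ => tmIso p.ec q.ec) (nat_unit (F := pick (pr x'.one y'.one)) (G := pick (pr x.one y.one) ≫ tensorHom F G)
    (fun _ => tm p.ec.hom q.ec.hom))
  t h := LinCat.isoMk (fun P => tmIso (p.mc h (fst (fst P)) (fst (snd P)))
      (q.mc h (snd (fst P)) (snd (snd P))))
    (nat_two (F := tensorHom (tensorHom F G) (tensorHom F G) ≫ mid _ _ _ _ ≫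
        tensorHom (x'.m h) (y'.m h)) (G := (mid _ _ _ _ ≫ tensorHom (x.m h) (y.m h)) ≫ tensorHom F G)
      (fun P => tm (p.mc h (fst (fst P)) (fst (snd P))).hom
        (q.mc h (snd (fst P)) (snd (snd P))).hom)
      fun f g f' g' => congrArg₂ tm (p.mc_nat h f f') (q.mc_nat h g g'))

namespace EnMor

theorem Laws.tensor {C' D' : LinCat.{v, u} R} {x : EnOb n C} {x' : EnOb n C'} {y : EnOb n D}
    {y' : EnOb n D'} {F : C ⟶ C'} {G : D ⟶ D'} {p : EnMor x x' F} {q : EnMor y y' G}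
    (hp : p.Laws) (hq : q.Laws) : (p.tensor q).Laws where
  assoc h X Y Z := congrArg₂ tm (hp.assoc h (fst X) (fst Y) (fst Z))
    (hq.assoc h (snd X) (snd Y) (snd Z))
  left h X := congrArg₂ tm (hp.left h (fst X)) (hq.left h (snd X))
  right h X := congrArg₂ tm (hp.right h (fst X)) (hq.right h (snd X))
  braid h h' X Y := congrArg₂ tm (hp.braid h h' (fst X) (fst Y)) (hq.braid h h' (snd X) (snd Y))

end EnMor

/-! ### Structural morphisms between tensor products of `E_n`-algebras -/

namespace LinCat

/-- Naturality for functors of two triples of objects. -/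
theorem nat_six {C' D' E' A : LinCat.{v, u} R}
    {F G : tensor (tensor (tensor C D) E) (tensor (tensor C' D') E') ⟶ A}
    (t : ∀ X, obj F X ⟶ obj G X)
    (h : ∀ {X₁ Y₁ : C} {X₂ Y₂ : D} {X₃ Y₃ : E} {Z₁ W₁ : C'} {Z₂ W₂ : D'} {Z₃ W₃ : E'} (f₁ : X₁ ⟶ Y₁)
      (f₂ : X₂ ⟶ Y₂) (f₃ : X₃ ⟶ Y₃) (g₁ : Z₁ ⟶ W₁) (g₂ : Z₂ ⟶ W₂) (g₃ : Z₃ ⟶ W₃),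
      map F (tm (tm (tm f₁ f₂) f₃) (tm (tm g₁ g₂) g₃)) ≫ t (pr (pr (pr Y₁ Y₂) Y₃) (pr (pr W₁ W₂) W₃)) =
        t (pr (pr (pr X₁ X₂) X₃) (pr (pr Z₁ Z₂) Z₃)) ≫
          map G (tm (tm (tm f₁ f₂) f₃) (tm (tm g₁ g₂) g₃)))
    {X Y : tensor (tensor (tensor C D) E) (tensor (tensor C' D') E')} (f : X ⟶ Y) :
    map F f ≫ t Y = t X ≫ map G f := by
  refine nat_two t (fun {X X' _ _ Z Z' _ _} f g f' g' => ?_) f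
  induction X using prInd with | h X₁ X₂ =>
  induction X' using prInd with | h X₁' X₂' =>
  induction Z using prInd with | h Z₁ Z₂ =>
  induction Z' using prInd with | h Z₁' Z₂' =>
  induction f using tm_induction with
  | add a b ha hb =>
    simp only [add_tm, LinCat.map_add, Preadditive.add_comp, Preadditive.comp_add, ha, hb]
  | pure f₁ f₂ =>
    induction f' using tm_induction with
    | add a b ha hb =>
      simp only [tm_add, add_tm, LinCat.map_add, Preadditive.add_comp, Preadditive.comp_add, ha, hb]
    | pure g₁ g₂ => exact h f₁ f₂ g g₁ g₂ g'

end LinCat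

theorem EnOb.tensor_m_obj (x : EnOb n C) (y : EnOb n D) (h : 1 ≤ n) (X Z : C) (Y W : D) :
    obj ((x.tensor y).m h) (pr (pr X Y) (pr Z W)) = pr (x.mul h X Z) (y.mul h Y W) := rfl
theorem EnOb.tensor_m_map (x : EnOb n C) (y : EnOb n D) (h : 1 ≤ n) {X X' Z Z' : C} {Y Y' W W' : D}
    (f : X ⟶ X') (g : Y ⟶ Y') (f' : Z ⟶ Z') (g' : W ⟶ W') :
    map ((x.tensor y).m h) (tm (tm f g) (tm f' g')) = tm (x.mm h f f') (y.mm h g g') := rfl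

namespace EnOb

theorem unit_one : (EnOb.unit.{v, u} n R).one = pt := rfl
theorem unit_mul (h : 1 ≤ n) (X Y : LinCat.unit.{v, u} R) : (EnOb.unit n R).mul h X Y = Y := rfl
theorem unit_m_obj (h : 1 ≤ n) (X Y : LinCat.unit.{v, u} R) :
    obj ((EnOb.unit n R).m h) (pr X Y) = Y := rfl
theorem unit_mm (h : 1 ≤ n) {X X' Y Y' : LinCat.unit.{v, u} R} (f : X ⟶ X') (g : Y ⟶ Y') :
    (EnOb.unit n R).mm h f g = scalar X X' f • g := rfl
theorem unit_ac (h : 1 ≤ n) (X Y Z : LinCat.unit.{v, u} R) :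
    ((EnOb.unit n R).ac h X Y Z).hom = 𝟙 Z := rfl
theorem unit_lc (h : 1 ≤ n) (X : LinCat.unit.{v, u} R) :
    ((EnOb.unit n R).lc h X).hom = 𝟙 X := rfl
theorem unit_rc (h : 1 ≤ n) (X : LinCat.unit.{v, u} R) :
    ((EnOb.unit n R).rc h X).hom = 𝟙 pt := rfl
theorem unit_bc (h : 1 ≤ n) (h' : 2 ≤ n) (X Y : LinCat.unit.{v, u} R) :
    ((EnOb.unit n R).bc h h' X Y).hom = 𝟙 Y := rfl

end EnOb

namespace EnMor

variable {x : EnOb n C} {y : EnOb n D} {z : EnOb n E}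

/-- The associator is a morphism of `E_n`-algebras. -/
def assoc (x : EnOb n C) (y : EnOb n D) (z : EnOb n E) :
    EnMor ((x.tensor y).tensor z) (x.tensor (y.tensor z)) (LinCat.assoc C D E) where
  e := LinCat.isoMk (fun _ => Iso.refl (pr x.one (pr y.one z.one)))
    (nat_unit (F := pick (pr x.one (pr y.one z.one)))
      (G := pick (pr (pr x.one y.one) z.one) ≫ LinCat.assoc C D E)
      (fun _ => 𝟙 (pr x.one (pr y.one z.one))))
  t h := LinCat.isoMk (fun P => Iso.refl (pr
      (x.mul h (fst (fst (fst P))) (fst (fst (snd P))))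
      (pr (y.mul h (snd (fst (fst P))) (snd (fst (snd P)))) (z.mul h (snd (fst P)) (snd (snd P))))))
    (nat_six (F := tensorHom (LinCat.assoc C D E) (LinCat.assoc C D E) ≫ (x.tensor (y.tensor z)).m h)
      (G := ((x.tensor y).tensor z).m h ≫ LinCat.assoc C D E) (fun P => 𝟙 (pr
      (x.mul h (fst (fst (fst P))) (fst (fst (snd P))))
      (pr (y.mul h (snd (fst (fst P))) (snd (fst (snd P)))) (z.mul h (snd (fst P)) (snd (snd P))))))
      fun f₁ f₂ f₃ g₁ g₂ g₃ => by
        simp only [comp_obj, tensorHom_obj, assoc_obj, EnOb.tensor_m_obj, LinCat.comp_map,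
          tensorHom_map, assoc_map, EnOb.tensor_m_map, EnOb.tensor_mm, EnOb.tensor_mul, fst_pr,
          snd_pr, Category.comp_id, Category.id_comp])

theorem assoc_ec : (assoc x y z).ec.hom = 𝟙 (pr x.one (pr y.one z.one)) := rfl

theorem assoc_mc (h : 1 ≤ n) (X X' : C) (Y Y' : D) (Z Z' : E) :
    ((assoc x y z).mc h (pr (pr X Y) Z) (pr (pr X' Y') Z')).hom =
      𝟙 (pr (x.mul h X X') (pr (y.mul h Y Y') (z.mul h Z Z'))) := rfl

theorem Laws.assoc_laws : (EnMor.assoc x y z).Laws where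
  assoc h X Y Z := by
    induction X using prInd with | h X X₃ =>
    induction X using prInd with | h X₁ X₂ =>
    induction Y using prInd with | h Y Y₃ =>
    induction Y using prInd with | h Y₁ Y₂ =>
    induction Z using prInd with | h Z Z₃ =>
    induction Z using prInd with | h Z₁ Z₂ =>
    simp only [EnOb.tensor_mul, EnOb.tensor_ac, assoc_obj, assoc_mc, tmIso_hom, assoc_map,
      EnOb.mm_id, Category.id_comp, Category.comp_id]
  left h X := by
    induction X using prInd with | h X X₃ =>
    induction X using prInd with | h X₁ X₂ =>
    simp only [EnOb.tensor_one, EnOb.tensor_mul, EnOb.tensor_lc, assoc_obj, assoc_mc, assoc_ec,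
      tmIso_hom, assoc_map, EnOb.mm_id, Category.id_comp]
  right h X := by
    induction X using prInd with | h X X₃ =>
    induction X using prInd with | h X₁ X₂ =>
    simp only [EnOb.tensor_one, EnOb.tensor_mul, EnOb.tensor_rc, assoc_obj, assoc_mc, assoc_ec,
      tmIso_hom, assoc_map, EnOb.mm_id, Category.id_comp]
  braid h h' X Y := by
    induction X using prInd with | h X X₃ =>
    induction X using prInd with | h X₁ X₂ =>
    induction Y using prInd with | h Y Y₃ =>
    induction Y using prInd with | h Y₁ Y₂ =>
    simp only [EnOb.tensor_mul, EnOb.tensor_bc, assoc_obj, assoc_mc,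
      tmIso_hom, assoc_map, Category.id_comp, Category.comp_id]

end EnMor

namespace EnOb

theorem m_obj (x : EnOb n C) (h : 1 ≤ n) (X Y : C) : obj (x.m h) (pr X Y) = x.mul h X Y := rfl
theorem m_map (x : EnOb n C) (h : 1 ≤ n) {X X' Y Y' : C} (f : X ⟶ X') (g : Y ⟶ Y') :
    map (x.m h) (tm f g) = x.mm h f g := rfl
theorem smul_mm (x : EnOb n C) (h : 1 ≤ n) (r : R) {X X' Y Y' : C} (f : X ⟶ X') (g : Y ⟶ Y') :
    x.mm h (r • f) g = r • x.mm h f g := map_smul_tm (x.m h) r f g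
theorem mm_smul (x : EnOb n C) (h : 1 ≤ n) (r : R) {X X' Y Y' : C} (f : X ⟶ X') (g : Y ⟶ Y') :
    x.mm h f (r • g) = r • x.mm h f g := map_tm_smul (x.m h) r f g

end EnOb

namespace EnMor

variable {x : EnOb n C} {y : EnOb n D} {z : EnOb n E}

/-- The left unitor is a morphism of `E_n`-algebras. -/
def leftUnit (x : EnOb n C) : EnMor ((EnOb.unit n R).tensor x) x (LinCat.leftUnit C) where
  e := LinCat.isoMk (fun _ => Iso.refl x.one)
    (nat_unit (F := x.u) (G := pick (pr pt x.one) ≫ LinCat.leftUnit C) (fun _ => 𝟙 x.one))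
  t h := LinCat.isoMk (fun P => Iso.refl (x.mul h (snd (fst P)) (snd (snd P))))
    (nat_two (F := tensorHom (LinCat.leftUnit C) (LinCat.leftUnit C) ≫ x.m h)
      (G := ((EnOb.unit n R).tensor x).m h ≫ LinCat.leftUnit C)
      (fun P => 𝟙 (x.mul h (snd (fst P)) (snd (snd P))))
      fun f g f' g' => by
        simp only [comp_obj, tensorHom_obj, leftUnit_obj, EnOb.m_obj, EnOb.tensor_mul,
          LinCat.comp_map, tensorHom_map, leftUnit_map, EnOb.m_map, EnOb.tensor_mm, EnOb.unit_mul,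
          EnOb.unit_mm, fst_pr, snd_pr, Category.comp_id, Category.id_comp, EnOb.smul_mm,
          EnOb.mm_smul, LinearEquiv.map_smul, smul_eq_mul, mul_smul]
        exact smul_comm _ _ _)

/-- The right unitor is a morphism of `E_n`-algebras. -/
def rightUnit (x : EnOb n C) : EnMor (x.tensor (EnOb.unit n R)) x (LinCat.rightUnit C) where
  e := LinCat.isoMk (fun _ => Iso.refl x.one)
    (nat_unit (F := x.u) (G := pick (pr x.one pt) ≫ LinCat.rightUnit C) (fun _ => 𝟙 x.one))
  t h := LinCat.isoMk (fun P => Iso.refl (x.mul h (fst (fst P)) (fst (snd P))))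
    (nat_two (F := tensorHom (LinCat.rightUnit C) (LinCat.rightUnit C) ≫ x.m h)
      (G := (x.tensor (EnOb.unit n R)).m h ≫ LinCat.rightUnit C)
      (fun P => 𝟙 (x.mul h (fst (fst P)) (fst (snd P))))
      fun f g f' g' => by
        simp only [comp_obj, tensorHom_obj, rightUnit_obj, EnOb.m_obj, EnOb.tensor_mul,
          LinCat.comp_map, tensorHom_map, rightUnit_map, EnOb.m_map, EnOb.tensor_mm, EnOb.unit_mul,
          EnOb.unit_mm, fst_pr, snd_pr, Category.comp_id, Category.id_comp, EnOb.smul_mm,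
          EnOb.mm_smul, LinearEquiv.map_smul, smul_eq_mul, mul_smul]
        exact smul_comm _ _ _)

/-- The braiding is a morphism of `E_n`-algebras. -/
def braid (x : EnOb n C) (y : EnOb n D) :
    EnMor (x.tensor y) (y.tensor x) (LinCat.braid C D) where
  e := LinCat.isoMk (fun _ => Iso.refl (pr y.one x.one))
    (nat_unit (F := pick (pr y.one x.one)) (G := pick (pr x.one y.one) ≫ LinCat.braid C D)
      (fun _ => 𝟙 (pr y.one x.one)))
  t h := LinCat.isoMk (fun P => Iso.refl (pr (y.mul h (snd (fst P)) (snd (snd P)))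
      (x.mul h (fst (fst P)) (fst (snd P)))))
    (nat_two (F := tensorHom (LinCat.braid C D) (LinCat.braid C D) ≫ (y.tensor x).m h)
      (G := (x.tensor y).m h ≫ LinCat.braid C D)
      (fun P => 𝟙 (pr (y.mul h (snd (fst P)) (snd (snd P)))
        (x.mul h (fst (fst P)) (fst (snd P)))))
      fun f g f' g' => by
        simp only [comp_obj, tensorHom_obj, braid_obj, EnOb.m_obj, EnOb.tensor_mul,
          LinCat.comp_map, tensorHom_map, braid_map, EnOb.m_map, EnOb.tensor_mm,
          fst_pr, snd_pr, Category.comp_id, Category.id_comp])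

theorem leftUnit_ec : (leftUnit x).ec.hom = 𝟙 x.one := rfl
theorem leftUnit_mc (h : 1 ≤ n) (r s : LinCat.unit.{v, u} R) (X Y : C) :
    ((leftUnit x).mc h (pr r X) (pr s Y)).hom = 𝟙 (x.mul h X Y) := rfl
theorem rightUnit_ec : (rightUnit x).ec.hom = 𝟙 x.one := rfl
theorem rightUnit_mc (h : 1 ≤ n) (r s : LinCat.unit.{v, u} R) (X Y : C) :
    ((rightUnit x).mc h (pr X r) (pr Y s)).hom = 𝟙 (x.mul h X Y) := rfl
theorem braid_ec : (EnMor.braid x y).ec.hom = 𝟙 (pr y.one x.one) := rfl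
theorem braid_mc (h : 1 ≤ n) (X X' : C) (Y Y' : D) :
    ((EnMor.braid x y).mc h (pr X Y) (pr X' Y')).hom = 𝟙 (pr (y.mul h Y Y') (x.mul h X X')) := rfl

theorem leftUnit_ac (h : 1 ≤ n) (r s t : LinCat.unit.{v, u} R) (X Y Z : C) :
    map (LinCat.leftUnit C) (((EnOb.unit n R).tensor x).ac h (pr r X) (pr s Y) (pr t Z)).hom =
      (x.ac h X Y Z).hom := one_smul R _
theorem leftUnit_lc (h : 1 ≤ n) (r : LinCat.unit.{v, u} R) (X : C) :
    map (LinCat.leftUnit C) (((EnOb.unit n R).tensor x).lc h (pr r X)).hom = (x.lc h X).hom :=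
  one_smul R _
theorem leftUnit_rc (h : 1 ≤ n) (r : LinCat.unit.{v, u} R) (X : C) :
    map (LinCat.leftUnit C) (((EnOb.unit n R).tensor x).rc h (pr r X)).hom = (x.rc h X).hom :=
  one_smul R _
theorem leftUnit_bc (h : 1 ≤ n) (h' : 2 ≤ n) (r s : LinCat.unit.{v, u} R) (X Y : C) :
    map (LinCat.leftUnit C) (((EnOb.unit n R).tensor x).bc h h' (pr r X) (pr s Y)).hom =
      (x.bc h h' X Y).hom := one_smul R _

theorem Laws.leftUnit_laws : (leftUnit x).Laws where
  assoc h X Y Z := by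
    induction X using prInd with | h X₁ X₂ =>
    induction Y using prInd with | h Y₁ Y₂ =>
    induction Z using prInd with | h Z₁ Z₂ =>
    simp only [EnOb.tensor_mul, leftUnit_obj, leftUnit_mc, EnOb.mm_id, Category.id_comp,
      Category.comp_id]
    exact (Category.id_comp (LinCat.map (LinCat.leftUnit C) _)).trans (leftUnit_ac h _ _ _ _ _ _)
  left h X := by
    induction X using prInd with | h X₁ X₂ =>
    simp only [EnOb.tensor_one, EnOb.tensor_mul, leftUnit_obj, leftUnit_mc, leftUnit_ec,
      EnOb.mm_id, Category.id_comp]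
    exact (Category.id_comp (LinCat.map (LinCat.leftUnit C) _)).trans (leftUnit_lc h _ _)
  right h X := by
    induction X using prInd with | h X₁ X₂ =>
    simp only [EnOb.tensor_one, EnOb.tensor_mul, leftUnit_obj, leftUnit_mc, leftUnit_ec,
      EnOb.mm_id, Category.id_comp]
    exact (Category.id_comp (LinCat.map (LinCat.leftUnit C) _)).trans (leftUnit_rc h _ _)
  braid h h' X Y := by
    induction X using prInd with | h X₁ X₂ =>
    induction Y using prInd with | h Y₁ Y₂ =>
    simp only [EnOb.tensor_mul, leftUnit_obj, leftUnit_mc, Category.comp_id]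
    exact (Category.id_comp (LinCat.map (LinCat.leftUnit C) _)).trans (leftUnit_bc h h' _ _ _ _)

theorem rightUnit_ac (h : 1 ≤ n) (r s t : LinCat.unit.{v, u} R) (X Y Z : C) :
    map (LinCat.rightUnit C) ((x.tensor (EnOb.unit n R)).ac h (pr X r) (pr Y s) (pr Z t)).hom =
      (x.ac h X Y Z).hom := one_smul R _
theorem rightUnit_lc (h : 1 ≤ n) (r : LinCat.unit.{v, u} R) (X : C) :
    map (LinCat.rightUnit C) ((x.tensor (EnOb.unit n R)).lc h (pr X r)).hom = (x.lc h X).hom :=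
  one_smul R _
theorem rightUnit_rc (h : 1 ≤ n) (r : LinCat.unit.{v, u} R) (X : C) :
    map (LinCat.rightUnit C) ((x.tensor (EnOb.unit n R)).rc h (pr X r)).hom = (x.rc h X).hom :=
  one_smul R _
theorem rightUnit_bc (h : 1 ≤ n) (h' : 2 ≤ n) (r s : LinCat.unit.{v, u} R) (X Y : C) :
    map (LinCat.rightUnit C) ((x.tensor (EnOb.unit n R)).bc h h' (pr X r) (pr Y s)).hom =
      (x.bc h h' X Y).hom := one_smul R _

theorem Laws.rightUnit_laws : (rightUnit x).Laws where
  assoc h X Y Z := by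
    induction X using prInd with | h X₁ X₂ =>
    induction Y using prInd with | h Y₁ Y₂ =>
    induction Z using prInd with | h Z₁ Z₂ =>
    simp only [EnOb.tensor_mul, rightUnit_obj, rightUnit_mc, EnOb.mm_id, Category.id_comp,
      Category.comp_id]
    exact (Category.id_comp (LinCat.map (LinCat.rightUnit C) _)).trans (rightUnit_ac h _ _ _ _ _ _)
  left h X := by
    induction X using prInd with | h X₁ X₂ =>
    simp only [EnOb.tensor_one, EnOb.tensor_mul, rightUnit_obj, rightUnit_mc, rightUnit_ec,
      EnOb.mm_id, Category.id_comp]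
    exact (Category.id_comp (LinCat.map (LinCat.rightUnit C) _)).trans (rightUnit_lc h _ _)
  right h X := by
    induction X using prInd with | h X₁ X₂ =>
    simp only [EnOb.tensor_one, EnOb.tensor_mul, rightUnit_obj, rightUnit_mc, rightUnit_ec,
      EnOb.mm_id, Category.id_comp]
    exact (Category.id_comp (LinCat.map (LinCat.rightUnit C) _)).trans (rightUnit_rc h _ _)
  braid h h' X Y := by
    induction X using prInd with | h X₁ X₂ =>
    induction Y using prInd with | h Y₁ Y₂ =>
    simp only [EnOb.tensor_mul, rightUnit_obj, rightUnit_mc, Category.comp_id]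
    exact (Category.id_comp (LinCat.map (LinCat.rightUnit C) _)).trans (rightUnit_bc h h' _ _ _ _)

theorem Laws.braid_laws : (EnMor.braid x y).Laws where
  assoc h X Y Z := by
    induction X using prInd with | h X₁ X₂ =>
    induction Y using prInd with | h Y₁ Y₂ =>
    induction Z using prInd with | h Z₁ Z₂ =>
    simp only [EnOb.tensor_mul, EnOb.tensor_ac, braid_obj, braid_mc, tmIso_hom, braid_map,
      EnOb.mm_id, Category.id_comp, Category.comp_id]
  left h X := by
    induction X using prInd with | h X₁ X₂ =>
    simp only [EnOb.tensor_one, EnOb.tensor_mul, EnOb.tensor_lc, braid_obj, braid_mc, braid_ec,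
      tmIso_hom, braid_map, EnOb.mm_id, Category.id_comp]
  right h X := by
    induction X using prInd with | h X₁ X₂ =>
    simp only [EnOb.tensor_one, EnOb.tensor_mul, EnOb.tensor_rc, braid_obj, braid_mc, braid_ec,
      tmIso_hom, braid_map, EnOb.mm_id, Category.id_comp]
  braid h h' X Y := by
    induction X using prInd with | h X₁ X₂ =>
    induction Y using prInd with | h Y₁ Y₂ =>
    simp only [EnOb.tensor_mul, EnOb.tensor_bc, braid_obj, braid_mc, tmIso_hom, braid_map,
      Category.id_comp, Category.comp_id]

variable {C' D' E' : LinCat.{v, u} R} {x' : EnOb n C'} {y' : EnOb n D'} {z' : EnOb n E'}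

theorem tensor_ec {F : C ⟶ C'} {G : D ⟶ D'} (p : EnMor x x' F) (q : EnMor y y' G) :
    (p.tensor q).ec.hom = tm p.ec.hom q.ec.hom := rfl
theorem tensor_mc {F : C ⟶ C'} {G : D ⟶ D'} (p : EnMor x x' F) (q : EnMor y y' G) (h : 1 ≤ n)
    (X X' : C) (Y Y' : D) : ((p.tensor q).mc h (pr X Y) (pr X' Y')).hom =
      tm (p.mc h X X').hom (q.mc h Y Y').hom := rfl

theorem Two.tensorId : Two ((EnMor.id x).tensor (EnMor.id y)) (EnMor.id (x.tensor y))
    (LinCat.tensorId C D).hom where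
  unit := by
    simp only [tensor_ec, id_ec, EnOb.tensor_one, tensorId_hom_app, tensorHom_obj, id_obj, tm_id,
      Category.comp_id]
  mul h X Y := by
    induction X using prInd with | h X₁ X₂ =>
    induction Y using prInd with | h Y₁ Y₂ =>
    simp only [tensor_mc, id_mc, EnOb.tensor_mul, tensorId_hom_app, tensorHom_obj, id_obj, tm_id,
      Category.comp_id, EnOb.mm_id]

theorem Two.tensorComp {F : C ⟶ C'} {G : D ⟶ D'} {F' : C' ⟶ E} {G' : D' ⟶ E'} (p : EnMor x x' F)
    (p' : EnMor x' z F') (q : EnMor y y' G) (q' : EnMor y' z' G') :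
    Two ((p.comp p').tensor (q.comp q')) ((p.tensor q).comp (p'.tensor q'))
      (LinCat.tensorComp F F' G G').hom where
  unit := by
    simp only [tensor_ec, comp_ec, EnOb.tensor_one, tensorComp_hom_app, tensorHom_obj, comp_obj,
      tensorHom_map, tm_comp, Category.comp_id]
  mul h X Y := by
    induction X using prInd with | h X₁ X₂ =>
    induction Y using prInd with | h Y₁ Y₂ =>
    simp only [tensor_mc, comp_mc, EnOb.tensor_mul, tensorComp_hom_app, tensorHom_obj, comp_obj,
      tensorHom_map, tm_comp, Category.comp_id, EnOb.mm_id, Category.id_comp]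

end EnMor

/-! ### The bicategory of `E_n`-algebras in linear categories -/

/-- The bicategory of `E_n`-algebras in `R`-linear categories: pointed (`n = 0`), monoidal
(`n = 1`), braided monoidal (`n = 2`) and symmetric monoidal (`n ≥ 3`) `R`-linear categories. -/
abbrev EnLin (n : ℕ∞) (R : Type) [CommRing R] := TotalBicat (EnDisp.{v, u} (R := R) n)

instance : TensorCells (EnLin.{v, u} n R) where
  I := ⟨LinCat.unit R, ⟨EnOb.unit n R, EnOb.Laws.unit n⟩⟩
  tObj X Y := ⟨LinCat.tensor X.base Y.base, ⟨X.str.1.tensor Y.str.1, X.str.2.tensor Y.str.2⟩⟩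
  tHom F G := ⟨tensorHom F.base G.base, ⟨F.str.1.tensor G.str.1, F.str.2.tensor G.str.2⟩⟩
  tId X Y := TotalBicat.isoMk (tensorId X.base Y.base) EnMor.Two.tensorId
  tComp F F' G G' := TotalBicat.isoMk (tensorComp F.base F'.base G.base G'.base)
    (EnMor.Two.tensorComp F.str.1 F'.str.1 G.str.1 G'.str.1)
  as X Y Z := ⟨assoc X.base Y.base Z.base,
    ⟨EnMor.assoc X.str.1 Y.str.1 Z.str.1, EnMor.Laws.assoc_laws⟩⟩
  lu X := ⟨leftUnit X.base, ⟨EnMor.leftUnit X.str.1, EnMor.Laws.leftUnit_laws⟩⟩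
  ru X := ⟨rightUnit X.base, ⟨EnMor.rightUnit X.str.1, EnMor.Laws.rightUnit_laws⟩⟩
  br X Y := ⟨braid X.base Y.base, ⟨EnMor.braid X.str.1 Y.str.1, EnMor.Laws.braid_laws⟩⟩

/-! ### Base change -/

variable (k : Type) [CommRing k] [Algebra R k]

namespace LinCat

/-- Objects of the base change of `C`. -/
@[ext]
structure BCObj (k : Type) (C : LinCat.{v, u} R) where
  of : C

variable {k}

/-- Composition in the base change of `C`. -/
def bcCompMap (X Y Z : BCObj k C) : k ⊗[R] (X.of ⟶ Y.of) →ₗ[R] k ⊗[R] (Y.of ⟶ Z.of) →ₗ[R]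
    k ⊗[R] (X.of ⟶ Z.of) :=
  TensorProduct.map₂ (LinearMap.mul R k) (Linear.comp X.of Y.of Z.of)

@[simp] theorem bcCompMap_tmul (X Y Z : BCObj k C) (r s : k) (f : X.of ⟶ Y.of) (g : Y.of ⟶ Z.of) :
    bcCompMap X Y Z (r ⊗ₜ f) (s ⊗ₜ g) = (r * s) ⊗ₜ[R] (f ≫ g) := rfl

instance : Category.{v} (BCObj k C) where
  Hom X Y := k ⊗[R] (X.of ⟶ Y.of)
  id X := 1 ⊗ₜ 𝟙 X.of
  comp f g := bcCompMap _ _ _ f g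
  id_comp {X Y} f := by
    induction f using TensorProduct.induction_on with
    | zero => simp
    | tmul a b => simp
    | add a b ha hb => rw [_root_.map_add, ha, hb]
  comp_id {X Y} f := by
    induction f using TensorProduct.induction_on with
    | zero => simp
    | tmul a b => simp
    | add a b ha hb => rw [_root_.map_add, LinearMap.add_apply, ha, hb]
  assoc {X Y Z W} f g h := by
    induction f using TensorProduct.induction_on with
    | zero => simp
    | add a b ha hb => simp only [_root_.map_add, LinearMap.add_apply, ha, hb]
    | tmul a b =>
      induction g using TensorProduct.induction_on with
      | zero => simp
      | add a b ha hb => simp only [_root_.map_add, LinearMap.add_apply, ha, hb]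
      | tmul a b =>
        induction h using TensorProduct.induction_on with
        | zero => simp
        | add a b ha hb => simp only [_root_.map_add, ha, hb]
        | tmul a b => simp [mul_assoc]

instance : Preadditive (BCObj k C) where
  homGroup X Y := inferInstanceAs (AddCommGroup (k ⊗[R] (X.of ⟶ Y.of)))
  add_comp X Y Z f f' g := by
    exact congrArg (fun t => t g) ((bcCompMap X Y Z).map_add f f')
  comp_add X Y Z f g g' := (bcCompMap X Y Z f).map_add g g'

theorem bc_smul_comp (X Y Z : BCObj k C) (r : k) (f : k ⊗[R] (X.of ⟶ Y.of))
    (g : k ⊗[R] (Y.of ⟶ Z.of)) : bcCompMap X Y Z (r • f) g = r • bcCompMap X Y Z f g := by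
  induction f using TensorProduct.induction_on with
  | zero => simp
  | add a b ha hb => simp only [smul_add, _root_.map_add, LinearMap.add_apply, ha, hb]
  | tmul a b =>
    induction g using TensorProduct.induction_on with
    | zero => simp
    | add a b ha hb => simp only [smul_add, _root_.map_add, ha, hb]
    | tmul c d => simp [TensorProduct.smul_tmul', mul_assoc]

theorem bc_comp_smul (X Y Z : BCObj k C) (r : k) (f : k ⊗[R] (X.of ⟶ Y.of))
    (g : k ⊗[R] (Y.of ⟶ Z.of)) : bcCompMap X Y Z f (r • g) = r • bcCompMap X Y Z f g := by
  induction f using TensorProduct.induction_on with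
  | zero => simp
  | add a b ha hb => simp only [smul_add, _root_.map_add, LinearMap.add_apply, ha, hb]
  | tmul a b =>
    induction g using TensorProduct.induction_on with
    | zero => simp
    | add a b ha hb => simp only [smul_add, _root_.map_add, ha, hb]
    | tmul c d => simp [TensorProduct.smul_tmul', mul_left_comm]

instance : Linear k (BCObj k C) where
  homModule X Y := inferInstanceAs (Module k (k ⊗[R] (X.of ⟶ Y.of)))
  smul_comp X Y Z r f g := bc_smul_comp X Y Z r f g
  comp_smul X Y Z f r g := bc_comp_smul X Y Z r f g

variable (k)

/-- The base change `k ⊗ C` of an `R`-linear category along `R → k`: same objects, and the base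
changes of the modules of morphisms. -/
def bc (C : LinCat.{v, u} R) : LinCat.{v, u} k where
  carrier := BCObj k C

variable {k}

/-- An object of `C` as an object of the base change. -/
def bo (X : C) : bc k C := BCObj.mk X

/-- The object of `C` underlying an object of the base change. -/
def un (X : bc k C) : C := BCObj.of X

@[simp] theorem un_bo (X : C) : un (bo X : bc k C) = X := rfl

/-- The morphism `1 ⊗ f` of the base change. -/
def bm {X Y : C} (f : X ⟶ Y) : (bo X : bc k C) ⟶ bo Y := (1 : k) ⊗ₜ[R] f

/-- The base change of a linear map. -/
def bL {D' : LinCat.{v, u} R} {X Y : C} {X' Y' : D'} (m : (X ⟶ Y) →ₗ[R] (X' ⟶ Y')) :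
    ((bo X : bc k C) ⟶ bo Y) →ₗ[k] ((bo X' : bc k D') ⟶ bo Y') := m.baseChange k

theorem bL_bm {D' : LinCat.{v, u} R} {X Y : C} {X' Y' : D'} (m : (X ⟶ Y) →ₗ[R] (X' ⟶ Y'))
    (f : X ⟶ Y) : bL m (bm f : (bo X : bc k C) ⟶ bo Y) = bm (m f) := rfl

@[simp] theorem bm_id (X : C) : (bm (𝟙 X) : (bo X : bc k C) ⟶ bo X) = 𝟙 (bo X) := rfl
@[simp] theorem bm_comp {X Y Z : C} (f : X ⟶ Y) (g : Y ⟶ Z) :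
    (bm f : (bo X : bc k C) ⟶ bo Y) ≫ bm g = bm (f ≫ g) := by
  change ((1 : k) * 1) ⊗ₜ[R] (f ≫ g) = (1 : k) ⊗ₜ[R] (f ≫ g)
  rw [mul_one]
theorem bm_add {X Y : C} (f g : X ⟶ Y) :
    (bm (f + g) : (bo X : bc k C) ⟶ bo Y) = bm f + bm g := TensorProduct.tmul_add _ _ _
theorem bm_smul {X Y : C} (r : R) (f : X ⟶ Y) :
    (bm (r • f) : (bo X : bc k C) ⟶ bo Y) = algebraMap R k r • bm f := by
  change (1 : k) ⊗ₜ[R] (r • f) = (algebraMap R k r * 1) ⊗ₜ[R] f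
  rw [← TensorProduct.smul_tmul, Algebra.smul_def]

theorem bm_induction {X Y : C} {P : ((bo X : bc k C) ⟶ bo Y) → Prop}
    (pure : ∀ f, P (bm f)) (add : ∀ f g, P f → P g → P (f + g)) (smul : ∀ (r : k) f, P f → P (r • f))
    (f : (bo X : bc k C) ⟶ bo Y) : P f := by
  refine TensorProduct.induction_on (motive := P) f ?_ (fun r g => ?_) add
  · have h := smul 0 _ (pure (0 : X ⟶ Y))
    rwa [zero_smul] at h
  · have h := smul r _ (pure g)
    change P ((r * 1) ⊗ₜ[R] g) at h
    rwa [mul_one] at h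

theorem boInd {P : bc k C → Prop} (h : ∀ X, P (bo X)) (X : bc k C) : P X := h (un X)

/-- An isomorphism of `C` as an isomorphism of the base change. -/
def bmIso {X Y : C} (e : X ≅ Y) : (bo X : bc k C) ≅ bo Y where
  hom := bm e.hom
  inv := bm e.inv
  hom_inv_id := by simp
  inv_hom_id := by simp

@[simp] theorem bmIso_hom {X Y : C} (e : X ≅ Y) : (bmIso e : (bo X : bc k C) ≅ bo Y).hom = bm e.hom :=
  rfl
@[simp] theorem bmIso_inv {X Y : C} (e : X ≅ Y) : (bmIso e : (bo X : bc k C) ≅ bo Y).inv = bm e.inv :=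
  rfl

theorem comp_of_bm {A : LinCat.{v, u} k} {X Y Z : C} {a b c : A}
    (m : ((bo X : bc k C) ⟶ bo Y) →ₗ[k] (a ⟶ b)) (m' : ((bo Y : bc k C) ⟶ bo Z) →ₗ[k] (b ⟶ c))
    (m'' : ((bo X : bc k C) ⟶ bo Z) →ₗ[k] (a ⟶ c))
    (hc : ∀ (f : X ⟶ Y) (g : Y ⟶ Z), m'' (bm (f ≫ g)) = m (bm f) ≫ m' (bm g))
    (f : (bo X : bc k C) ⟶ bo Y) (g : (bo Y : bc k C) ⟶ bo Z) : m'' (f ≫ g) = m f ≫ m' g := by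
  induction f using bm_induction with
  | add a b ha hb =>
    rw [Preadditive.add_comp, _root_.map_add, ha, hb, _root_.map_add, Preadditive.add_comp]
  | smul r a ha =>
    rw [Linear.smul_comp, _root_.map_smul, ha, _root_.map_smul, Linear.smul_comp]
  | pure f =>
    induction g using bm_induction with
    | add a b ha hb =>
      rw [Preadditive.comp_add, _root_.map_add, ha, hb, _root_.map_add, Preadditive.comp_add]
    | smul r a ha =>
      rw [Linear.comp_smul, _root_.map_smul, ha, _root_.map_smul, Linear.comp_smul]
    | pure g => rw [bm_comp, hc]

/-- Naturality can be checked on the morphisms `1 ⊗ f`. -/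
theorem nat_bc {A : LinCat.{v, u} k} {F G : bc k C ⟶ A} (t : ∀ X, obj F X ⟶ obj G X)
    (h : ∀ {X Y : C} (f : X ⟶ Y), map F (bm f) ≫ t (bo Y) = t (bo X) ≫ map G (bm f))
    {X Y : bc k C} (f : X ⟶ Y) : map F f ≫ t Y = t X ≫ map G f := by
  induction X using boInd with | h X =>
  induction Y using boInd with | h Y =>
  induction f using bm_induction with
  | add a b ha hb =>
    simp only [LinCat.map_add, Preadditive.add_comp, Preadditive.comp_add, ha, hb]
  | smul r a ha => simp only [LinCat.map_smul, Linear.smul_comp, Linear.comp_smul, ha]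
  | pure f => exact h f

/-- Naturality for functors of two objects of base changes. -/
theorem nat_bc₂ {A : LinCat.{v, u} k} {F G : tensor (bc k C) (bc k D) ⟶ A}
    (t : ∀ X, obj F X ⟶ obj G X)
    (h : ∀ {X Y : C} {X' Y' : D} (f : X ⟶ Y) (g : X' ⟶ Y'), map F (tm (bm f) (bm g)) ≫
      t (pr (bo Y) (bo Y')) = t (pr (bo X) (bo X')) ≫ map G (tm (bm f) (bm g)))
    {X Y : tensor (bc k C) (bc k D)} (f : X ⟶ Y) : map F f ≫ t Y = t X ≫ map G f := by
  refine nat_tensor t (fun {X Y X' Y'} f g => ?_) f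
  induction X using boInd with | h X =>
  induction Y using boInd with | h Y =>
  induction X' using boInd with | h X' =>
  induction Y' using boInd with | h Y' =>
  induction f using bm_induction with
  | add a b ha hb =>
    simp only [add_tm, LinCat.map_add, Preadditive.add_comp, Preadditive.comp_add, ha, hb]
  | smul r a ha => simp only [smul_tm, LinCat.map_smul, Linear.smul_comp, Linear.comp_smul, ha]
  | pure f =>
    induction g using bm_induction with
    | add a b ha hb =>
      simp only [tm_add, LinCat.map_add, Preadditive.add_comp, Preadditive.comp_add, ha, hb]
    | smul r a ha => simp only [tm_smul, LinCat.map_smul, Linear.smul_comp, Linear.comp_smul, ha]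
    | pure g => exact h f g

/-- Naturality for functors of three objects of base changes. -/
theorem nat_bc₃ {A : LinCat.{v, u} k} {F G : tensor (tensor (bc k C) (bc k D)) (bc k E) ⟶ A}
    (t : ∀ X, obj F X ⟶ obj G X)
    (h : ∀ {X Y : C} {X' Y' : D} {X'' Y'' : E} (f : X ⟶ Y) (f' : X' ⟶ Y') (f'' : X'' ⟶ Y''),
      map F (tm (tm (bm f) (bm f')) (bm f'')) ≫ t (pr (pr (bo Y) (bo Y')) (bo Y'')) =
        t (pr (pr (bo X) (bo X')) (bo X'')) ≫ map G (tm (tm (bm f) (bm f')) (bm f'')))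
    {X Y : tensor (tensor (bc k C) (bc k D)) (bc k E)} (f : X ⟶ Y) :
    map F f ≫ t Y = t X ≫ map G f := by
  refine nat_left t (fun {X Y X' Y' Z Z'} f g e => ?_) f
  induction X using boInd with | h X =>
  induction Y using boInd with | h Y =>
  induction X' using boInd with | h X' =>
  induction Y' using boInd with | h Y' =>
  induction Z using boInd with | h Z =>
  induction Z' using boInd with | h Z' =>
  induction f using bm_induction with
  | add a b ha hb =>
    simp only [add_tm, LinCat.map_add, Preadditive.add_comp, Preadditive.comp_add, ha, hb]
  | smul r a ha => simp only [smul_tm, LinCat.map_smul, Linear.smul_comp, Linear.comp_smul, ha]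
  | pure f =>
    induction g using bm_induction with
    | add a b ha hb =>
      simp only [tm_add, add_tm, LinCat.map_add, Preadditive.add_comp, Preadditive.comp_add, ha, hb]
    | smul r a ha =>
      simp only [tm_smul, smul_tm, LinCat.map_smul, Linear.smul_comp, Linear.comp_smul, ha]
    | pure g =>
      induction e using bm_induction with
      | add a b ha hb =>
        simp only [tm_add, LinCat.map_add, Preadditive.add_comp, Preadditive.comp_add, ha, hb]
      | smul r a ha => simp only [tm_smul, LinCat.map_smul, Linear.smul_comp, Linear.comp_smul, ha]
      | pure e => exact h f g e

/-- A linear functor out of a base change, given on objects and by linear maps on morphisms. -/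
def mkB {A : LinCat.{v, u} k} (o : C → A)
    (m : ∀ X Y : C, ((bo X : bc k C) ⟶ bo Y) →ₗ[k] (o X ⟶ o Y))
    (hi : ∀ X, m X X (bm (𝟙 X)) = 𝟙 (o X))
    (hc : ∀ {X Y Z : C} (f : X ⟶ Y) (g : Y ⟶ Z), m X Z (bm (f ≫ g)) = m X Y (bm f) ≫ m Y Z (bm g)) :
    bc k C ⟶ A :=
  mk' (fun X => o (un X)) (fun X Y => m (un X) (un Y)) (fun X => hi (un X))
    (fun X Y Z f g => comp_of_bm (m (un X) (un Y)) (m (un Y) (un Z)) (m (un X) (un Z)) hc f g)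

variable (k)

/-- The base change of a linear functor. -/
def bcHom (F : C ⟶ D) : bc k C ⟶ bc k D :=
  mkB (fun X => bo (obj F X)) (fun X Y => bL (lmap F X Y))
    (fun X => by rw [bL_bm, lmap_apply, LinCat.map_id, bm_id])
    (fun f g => by
      rw [bL_bm, bL_bm, bL_bm, lmap_apply, lmap_apply, lmap_apply, LinCat.map_comp, bm_comp])

@[simp] theorem bcHom_obj (F : C ⟶ D) (X : C) : obj (bcHom k F) (bo X) = bo (obj F X) := rfl
@[simp] theorem bcHom_map (F : C ⟶ D) {X Y : C} (f : X ⟶ Y) :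
    map (bcHom k F) (bm f) = bm (map F f) := rfl

/-- Construct a 2-cell from its components. -/
def homMk {F G : C ⟶ D} (t : ∀ X, obj F X ⟶ obj G X)
    (h : ∀ {X Y : C} (f : X ⟶ Y), map F f ≫ t Y = t X ≫ map G f) : F ⟶ G :=
  ⟨{ app := t, naturality := fun _ _ f => h f }⟩

/-- The base change of a natural transformation. -/
def bc₂ {F G : C ⟶ D} (t : F ⟶ G) : bcHom k F ⟶ bcHom k G :=
  homMk (fun X => bm (app t (un X))) (nat_bc (F := bcHom k F) (G := bcHom k G)
    (fun X => bm (app t (un X))) fun f => by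
      simp only [bcHom_map, bcHom_obj, un_bo, bm_comp, naturality])

@[simp] theorem bc₂_app {F G : C ⟶ D} (t : F ⟶ G) (X : C) : app (bc₂ k t) (bo X) = bm (app t X) :=
  rfl

/-- Base change preserves identities. -/
def bcId (C : LinCat.{v, u} R) : bcHom k (𝟙 C) ≅ 𝟙 (bc k C) :=
  isoMk (fun X => Iso.refl X) (nat_bc (F := bcHom k (𝟙 C)) (G := 𝟙 _) (fun X => 𝟙 X) fun f => by
    exact (Category.comp_id _).trans (Category.id_comp _).symm)

/-- Base change preserves composition. -/
def bcComp (F : C ⟶ D) (G : D ⟶ E) : bcHom k (F ≫ G) ≅ bcHom k F ≫ bcHom k G :=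
  isoMk (fun X => Iso.refl (bo (obj G (obj F (un X)))))
    (nat_bc (F := bcHom k (F ≫ G)) (G := bcHom k F ≫ bcHom k G)
      (fun X => 𝟙 (bo (obj G (obj F (un X))))) fun f => by
      simp only [bcHom_map, comp_obj, bcHom_obj, un_bo, LinCat.comp_map, Category.comp_id,
        Category.id_comp])

@[simp] theorem bcId_hom_app (X : C) : app (bcId k C).hom (bo X) = 𝟙 (bo X) := rfl
@[simp] theorem bcComp_hom_app (F : C ⟶ D) (G : D ⟶ E) (X : C) :
    app (bcComp k F G).hom (bo X) = 𝟙 (bo (obj G (obj F X))) := rfl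

/-- The comparison `(k ⊗ M) ⊗ (k ⊗ N) → k ⊗ (M ⊗ N)` on morphisms. -/
def mergeL (X X' : C) (Y Y' : D) : ((pr (bo X) (bo Y) : tensor (bc k C) (bc k D)) ⟶
    pr (bo X') (bo Y')) ≃ₗ[k] ((bo (pr X Y) : bc k (tensor C D)) ⟶ bo (pr X' Y')) :=
  (TensorProduct.AlgebraTensorModule.distribBaseChange R k (X ⟶ X') (Y ⟶ Y')).symm

theorem mergeL_symm_bm {X X' : C} {Y Y' : D} (f : X ⟶ X') (g : Y ⟶ Y') :
    (mergeL k X X' Y Y').symm (bm (tm f g)) = tm (bm f) (bm g) := rfl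

theorem mergeL_tm {X X' : C} {Y Y' : D} (f : X ⟶ X') (g : Y ⟶ Y') :
    mergeL k X X' Y Y' (tm (bm f) (bm g)) = bm (tm f g) := by
  rw [← mergeL_symm_bm, LinearEquiv.apply_symm_apply]

theorem mergeL_comp {X₁ X₂ X₃ : C} {Y₁ Y₂ Y₃ : D} (f : (bo X₁ : bc k C) ⟶ bo X₂)
    (f' : (bo Y₁ : bc k D) ⟶ bo Y₂) (g : (bo X₂ : bc k C) ⟶ bo X₃)
    (g' : (bo Y₂ : bc k D) ⟶ bo Y₃) :
    mergeL k X₁ X₃ Y₁ Y₃ (tm (f ≫ g) (f' ≫ g')) =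
      mergeL k X₁ X₂ Y₁ Y₂ (tm f f') ≫ mergeL k X₂ X₃ Y₂ Y₃ (tm g g') := by
  induction f using bm_induction with
  | add a b ha hb => simp only [Preadditive.add_comp, add_tm, _root_.map_add, ha, hb]
  | smul r a ha => simp only [Linear.smul_comp, smul_tm, _root_.map_smul, ha]
  | pure f =>
    induction g using bm_induction with
    | add a b ha hb =>
      simp only [Preadditive.comp_add, add_tm, _root_.map_add, ha, hb]
    | smul r a ha => simp only [Linear.comp_smul, smul_tm, _root_.map_smul, ha]
    | pure g =>
      induction f' using bm_induction with
      | add a b ha hb =>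
        simp only [Preadditive.add_comp, tm_add, _root_.map_add, ha, hb]
      | smul r a ha => simp only [Linear.smul_comp, tm_smul, _root_.map_smul, ha]
      | pure f' =>
        induction g' using bm_induction with
        | add a b ha hb =>
          simp only [Preadditive.comp_add, tm_add, _root_.map_add, ha, hb]
        | smul r a ha => simp only [Linear.comp_smul, tm_smul, _root_.map_smul, ha]
        | pure g' => rw [bm_comp, bm_comp, mergeL_tm, mergeL_tm, mergeL_tm, bm_comp, tm_comp]

/-- The comparison `(k ⊗ C) ⊗ (k ⊗ D) ⟶ k ⊗ (C ⊗ D)`. -/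
def merge (C D : LinCat.{v, u} R) : tensor (bc k C) (bc k D) ⟶ bc k (tensor C D) :=
  mkT (fun X => bo (pr (un (fst X)) (un (snd X))))
    (fun X Y => (mergeL k (un (fst X)) (un (fst Y)) (un (snd X)) (un (snd Y))).toLinearMap)
    (fun X Y => mergeL_tm k (𝟙 (un X)) (𝟙 (un Y))) (fun f f' g g' => mergeL_comp k f f' g g')

theorem split_comp {X₁ X₂ X₃ : C} {Y₁ Y₂ Y₃ : D} (f : pr X₁ Y₁ ⟶ pr X₂ Y₂)
    (g : pr X₂ Y₂ ⟶ pr X₃ Y₃) : (mergeL k X₁ X₃ Y₁ Y₃).symm (bm (f ≫ g)) =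
      (mergeL k X₁ X₂ Y₁ Y₂).symm (bm f) ≫ (mergeL k X₂ X₃ Y₂ Y₃).symm (bm g) := by
  induction f using tm_induction with
  | add a b ha hb => simp only [Preadditive.add_comp, bm_add, _root_.map_add, ha, hb]
  | pure f f' =>
    induction g using tm_induction with
    | add a b ha hb => simp only [Preadditive.comp_add, bm_add, _root_.map_add, ha, hb]
    | pure g g' =>
      rw [tm_comp, mergeL_symm_bm, mergeL_symm_bm, mergeL_symm_bm, tm_comp, bm_comp, bm_comp]

/-- The comparison `k ⊗ (C ⊗ D) ⟶ (k ⊗ C) ⊗ (k ⊗ D)`. -/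
def split (C D : LinCat.{v, u} R) : bc k (tensor C D) ⟶ tensor (bc k C) (bc k D) :=
  mkB (fun X => pr (bo (fst X)) (bo (snd X)))
    (fun X Y => (mergeL k (fst X) (fst Y) (snd X) (snd Y)).symm.toLinearMap)
    (fun _ => rfl) (fun f g => split_comp k f g)

@[simp] theorem merge_obj (X : C) (Y : D) : obj (merge k C D) (pr (bo X) (bo Y)) = bo (pr X Y) := rfl
@[simp] theorem split_obj (X : C) (Y : D) : obj (split k C D) (bo (pr X Y)) = pr (bo X) (bo Y) := rfl
@[simp] theorem split_map {X X' : C} {Y Y' : D} (f : X ⟶ X') (g : Y ⟶ Y') :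
    map (split k C D) (bm (tm f g)) = tm (bm f) (bm g) := rfl
@[simp] theorem merge_map {X X' : C} {Y Y' : D} (f : X ⟶ X') (g : Y ⟶ Y') :
    map (merge k C D) (tm (bm f) (bm g)) = bm (tm f g) := mergeL_tm k f g

/-- The linear map `k ⊗ R → k` on morphisms. -/
def bcUnitL (r s : unit.{v, u} R) :
    ((bo r : bc k (unit.{v, u} R)) ⟶ bo s) ≃ₗ[k] ((pt : unit.{v, u} k) ⟶ pt) :=
  ((TensorProduct.AlgebraTensorModule.congr (LinearEquiv.refl k k) (scalar r s)).trans
    (TensorProduct.AlgebraTensorModule.rid R k k)).trans (scalar (pt : unit.{v, u} k) pt).symm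

theorem bcUnitL_bm {r s : unit.{v, u} R} (f : r ⟶ s) :
    bcUnitL k r s (bm f) = algebraMap R k (scalar r s f) • 𝟙 (pt : unit.{v, u} k) := by
  change (scalar (pt : unit.{v, u} k) pt).symm (scalar r s f • (1 : k)) = _
  rw [Algebra.smul_def]
  rfl

/-- The comparison `k ⊗ I ⟶ I`. -/
def bcUnit : bc k (unit.{v, u} R) ⟶ unit.{v, u} k :=
  mkB (fun _ => pt) (fun r s => (bcUnitL k r s).toLinearMap)
    (fun r => (bcUnitL_bm k (𝟙 r)).trans (by rw [scalar_id, map_one, one_smul]))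
    (fun {r s t} f g => by
      change bcUnitL k r t (bm (f ≫ g)) = bcUnitL k r s (bm f) ≫ bcUnitL k s t (bm g)
      rw [bcUnitL_bm, bcUnitL_bm, bcUnitL_bm, scalar_comp, map_mul, mul_smul, Linear.smul_comp,
        Linear.comp_smul, Category.comp_id])

@[simp] theorem bcUnit_obj (r : bc k (unit.{v, u} R)) : obj (bcUnit k) r = pt := rfl
@[simp] theorem bcUnit_map {r s : unit.{v, u} R} (f : r ⟶ s) :
    map (bcUnit k) (bm f) = algebraMap R k (scalar r s f) • 𝟙 pt := bcUnitL_bm k f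

end LinCat

variable {k}

namespace LinCat

/-- Naturality for functors on `I ⊗ (k ⊗ C)`. -/
theorem nat_bc_right {A : LinCat.{v, u} k} {B : LinCat.{v, u} k} {F G : tensor B (bc k C) ⟶ A}
    (t : ∀ X, obj F X ⟶ obj G X)
    (h : ∀ {r s : B} {X Y : C} (e : r ⟶ s) (f : X ⟶ Y), map F (tm e (bm f)) ≫
      t (pr s (bo Y)) = t (pr r (bo X)) ≫ map G (tm e (bm f)))
    {X Y : tensor B (bc k C)} (f : X ⟶ Y) : map F f ≫ t Y = t X ≫ map G f := by
  refine nat_tensor t (fun {_ _ X Y} e f => ?_) f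
  induction X using boInd with | h X =>
  induction Y using boInd with | h Y =>
  induction f using bm_induction with
  | add a b ha hb =>
    simp only [tm_add, LinCat.map_add, Preadditive.add_comp, Preadditive.comp_add, ha, hb]
  | smul r a ha => simp only [tm_smul, LinCat.map_smul, Linear.smul_comp, Linear.comp_smul, ha]
  | pure f => exact h e f

/-- Naturality for functors on `(k ⊗ C) ⊗ I`. -/
theorem nat_bc_left {A : LinCat.{v, u} k} {B : LinCat.{v, u} k} {F G : tensor (bc k C) B ⟶ A}
    (t : ∀ X, obj F X ⟶ obj G X)
    (h : ∀ {r s : B} {X Y : C} (f : X ⟶ Y) (e : r ⟶ s), map F (tm (bm f) e) ≫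
      t (pr (bo Y) s) = t (pr (bo X) r) ≫ map G (tm (bm f) e))
    {X Y : tensor (bc k C) B} (f : X ⟶ Y) : map F f ≫ t Y = t X ≫ map G f := by
  refine nat_tensor t (fun {X Y _ _} f e => ?_) f
  induction X using boInd with | h X =>
  induction Y using boInd with | h Y =>
  induction f using bm_induction with
  | add a b ha hb =>
    simp only [add_tm, LinCat.map_add, Preadditive.add_comp, Preadditive.comp_add, ha, hb]
  | smul r a ha => simp only [smul_tm, LinCat.map_smul, Linear.smul_comp, Linear.comp_smul, ha]
  | pure f => exact h f e

end LinCat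

namespace EnOb

variable (k)

theorem bc_mul_map (x : EnOb n C) (h : 1 ≤ n) {X X' Y Y' : C} (f : X ⟶ X') (g : Y ⟶ Y') :
    LinCat.map (merge k C C ≫ bcHom k (x.m h)) (tm (bm f) (bm g)) = bm (x.mm h f g) :=
  (congrArg (LinCat.map (bcHom k (x.m h))) (merge_map k f g)).trans rfl

/-- The base change of an `E_n`-algebra. -/
def baseChange (x : EnOb n C) : EnOb n (LinCat.bc k C) where
  u := pick (bo x.one)
  m h := merge k C C ≫ bcHom k (x.m h)
  a h := LinCat.isoMk (fun P => bmIso (x.ac h (un (fst (fst P))) (un (snd (fst P))) (un (snd P))))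
    (nat_bc₃ (F := tensorHom (merge k C C ≫ bcHom k (x.m h)) (𝟙 _) ≫ merge k C C ≫ bcHom k (x.m h))
      (G := LinCat.assoc _ _ _ ≫ tensorHom (𝟙 _) (merge k C C ≫ bcHom k (x.m h)) ≫ merge k C C ≫
        bcHom k (x.m h))
      (fun P => bm (x.ac h (un (fst (fst P))) (un (snd (fst P))) (un (snd P))).hom)
      fun f g e => by
        simp only [comp_obj, LinCat.comp_map, tensorHom_obj, id_obj, LinCat.id_map, merge_obj,
          merge_map, bcHom_obj, bcHom_map, tensorHom_map, assoc_obj, assoc_map, m_obj, m_map,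
          fst_pr, snd_pr, un_bo]
        exact (bm_comp _ _).trans ((congrArg bm (x.ac_nat h f g e)).trans (bm_comp _ _).symm))
  l h := LinCat.isoMk (fun P => bmIso (x.lc h (un (snd P))))
    (nat_bc_right (F := tensorHom (pick (bo x.one)) (𝟙 _) ≫ merge k C C ≫ bcHom k (x.m h))
      (G := leftUnit _) (fun P => bm (x.lc h (un (snd P))).hom)
      fun {r s _ _} e f => smul_sq (scalar r s e) (l := bm f)
        ((map_smul_tm (merge k C C ≫ bcHom k (x.m h)) (scalar r s e) (𝟙 (bo x.one)) (bm f)).trans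
          (congrArg (scalar r s e • ·) (bc_mul_map k x h (𝟙 x.one) f))) rfl
        ((bm_comp _ _).trans ((congrArg bm (x.lc_nat h f)).trans (bm_comp _ _).symm)))
  r h := LinCat.isoMk (fun P => bmIso (x.rc h (un (fst P))))
    (nat_bc_left (F := tensorHom (𝟙 _) (pick (bo x.one)) ≫ merge k C C ≫ bcHom k (x.m h))
      (G := rightUnit _) (fun P => bm (x.rc h (un (fst P))).hom)
      fun {r s _ _} f e => smul_sq (scalar r s e) (l := bm f)
        ((map_tm_smul (merge k C C ≫ bcHom k (x.m h)) (scalar r s e) (bm f) (𝟙 (bo x.one))).trans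
          (congrArg (scalar r s e • ·) (bc_mul_map k x h f (𝟙 x.one)))) rfl
        ((bm_comp _ _).trans ((congrArg bm (x.rc_nat h f)).trans (bm_comp _ _).symm)))
  b h h' := LinCat.isoMk (fun P => bmIso (x.bc h h' (un (fst P)) (un (snd P))))
    (nat_bc₂ (F := merge k C C ≫ bcHom k (x.m h)) (G := braid _ _ ≫ merge k C C ≫ bcHom k (x.m h))
      (fun P => bm (x.bc h h' (un (fst P)) (un (snd P))).hom)
      fun f g => by
        simp only [comp_obj, LinCat.comp_map, merge_obj, merge_map, bcHom_obj, bcHom_map, braid_obj,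
          braid_map, m_obj, m_map, fst_pr, snd_pr, un_bo]
        exact (bm_comp _ _).trans ((congrArg bm (x.bc_nat h h' f g)).trans (bm_comp _ _).symm))

theorem baseChange_one (x : EnOb n C) : (x.baseChange k).one = bo x.one := rfl
theorem baseChange_mul (x : EnOb n C) (h : 1 ≤ n) (X Y : C) :
    (x.baseChange k).mul h (bo X) (bo Y) = bo (x.mul h X Y) := rfl
theorem baseChange_mm (x : EnOb n C) (h : 1 ≤ n) {X X' Y Y' : C} (f : X ⟶ X') (g : Y ⟶ Y') :
    (x.baseChange k).mm h (bm f) (bm g) = bm (x.mm h f g) := bc_mul_map k x h f g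
theorem baseChange_mm_left (x : EnOb n C) (h : 1 ≤ n) {X X' Y : C} (f : X ⟶ X') :
    (x.baseChange k).mm h (bm f) (𝟙 (bo Y)) = bm (x.mm h f (𝟙 Y)) := bc_mul_map k x h f (𝟙 Y)
theorem baseChange_mm_right (x : EnOb n C) (h : 1 ≤ n) {X Y Y' : C} (f : Y ⟶ Y') :
    (x.baseChange k).mm h (𝟙 (bo X)) (bm f) = bm (x.mm h (𝟙 X) f) := bc_mul_map k x h (𝟙 X) f
theorem baseChange_ac (x : EnOb n C) (h : 1 ≤ n) (X Y Z : C) :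
    (x.baseChange k).ac h (bo X) (bo Y) (bo Z) = bmIso (x.ac h X Y Z) := rfl
theorem baseChange_lc (x : EnOb n C) (h : 1 ≤ n) (X : C) :
    (x.baseChange k).lc h (bo X) = bmIso (x.lc h X) := rfl
theorem baseChange_rc (x : EnOb n C) (h : 1 ≤ n) (X : C) :
    (x.baseChange k).rc h (bo X) = bmIso (x.rc h X) := rfl
theorem baseChange_bc (x : EnOb n C) (h : 1 ≤ n) (h' : 2 ≤ n) (X Y : C) :
    (x.baseChange k).bc h h' (bo X) (bo Y) = bmIso (x.bc h h' X Y) := rfl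

theorem Laws.baseChange {x : EnOb n C} (hx : x.Laws) : (x.baseChange k).Laws where
  pentagon h X Y Z W := by
    induction X using boInd with | h X =>
    induction Y using boInd with | h Y =>
    induction Z using boInd with | h Z =>
    induction W using boInd with | h W =>
    simp only [baseChange_mul, baseChange_ac, bmIso_hom, baseChange_mm_left, baseChange_mm_right,
      bm_comp, hx.pentagon]
  triangle h X Y := by
    induction X using boInd with | h X =>
    induction Y using boInd with | h Y =>
    simp only [baseChange_one, baseChange_mul, baseChange_ac, baseChange_lc, baseChange_rc,
      bmIso_hom, baseChange_mm_left, baseChange_mm_right, bm_comp, hx.triangle]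
  hexagon h h' X Y Z := by
    induction X using boInd with | h X =>
    induction Y using boInd with | h Y =>
    induction Z using boInd with | h Z =>
    simp only [baseChange_mul, baseChange_ac, baseChange_bc, bmIso_hom, baseChange_mm_left,
      baseChange_mm_right, bm_comp, hx.hexagon]
  hexagon' h h' X Y Z := by
    induction X using boInd with | h X =>
    induction Y using boInd with | h Y =>
    induction Z using boInd with | h Z =>
    simp only [baseChange_mul, baseChange_ac, baseChange_bc, bmIso_hom, bmIso_inv,
      baseChange_mm_left, baseChange_mm_right, bm_comp, hx.hexagon']
  symmetry h h' h'' X Y := by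
    induction X using boInd with | h X =>
    induction Y using boInd with | h Y =>
    simp only [baseChange_mul, baseChange_bc, bmIso_hom, bm_comp, hx.symmetry h h' h'', bm_id]

end EnOb

namespace EnMor

variable (k) {x : EnOb n C} {y : EnOb n D} {z : EnOb n E}

/-- The base change of a morphism of `E_n`-algebras. -/
def baseChange {F : C ⟶ D} (p : EnMor x y F) :
    EnMor (x.baseChange k) (y.baseChange k) (bcHom k F) where
  e := LinCat.isoMk (fun _ => bmIso p.ec)
    (nat_unit (F := pick (bo y.one)) (G := pick (bo x.one) ≫ bcHom k F) (fun _ => bm p.ec.hom))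
  t h := LinCat.isoMk (fun P => bmIso (p.mc h (un (fst P)) (un (snd P))))
    (nat_bc₂ (F := tensorHom (bcHom k F) (bcHom k F) ≫ merge k D D ≫ bcHom k (y.m h))
      (G := (merge k C C ≫ bcHom k (x.m h)) ≫ bcHom k F)
      (fun P => bm (p.mc h (un (fst P)) (un (snd P))).hom)
      fun f g => by
        simp only [comp_obj, LinCat.comp_map, tensorHom_obj, merge_obj,
          merge_map, bcHom_obj, bcHom_map, tensorHom_map, EnOb.m_obj, EnOb.m_map,
          fst_pr, snd_pr, un_bo]
        exact (bm_comp _ _).trans ((congrArg bm (p.mc_nat h f g)).trans (bm_comp _ _).symm))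

theorem baseChange_ec {F : C ⟶ D} (p : EnMor x y F) : (p.baseChange k).ec.hom = bm p.ec.hom := rfl
theorem baseChange_mc {F : C ⟶ D} (p : EnMor x y F) (h : 1 ≤ n) (X Y : C) :
    ((p.baseChange k).mc h (bo X) (bo Y)).hom = bm (p.mc h X Y).hom := rfl

theorem Laws.baseChange {F : C ⟶ D} {p : EnMor x y F} (hp : p.Laws) : (p.baseChange k).Laws where
  assoc h X Y Z := by
    induction X using boInd with | h X =>
    induction Y using boInd with | h Y =>
    induction Z using boInd with | h Z =>
    simp only [EnOb.baseChange_mul, EnOb.baseChange_ac, bmIso_hom, baseChange_mc, bcHom_obj,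
      bcHom_map, EnOb.baseChange_mm_left, EnOb.baseChange_mm_right, bm_comp, hp.assoc]
  left h X := by
    induction X using boInd with | h X =>
    simp only [EnOb.baseChange_one, EnOb.baseChange_mul, EnOb.baseChange_lc, bmIso_hom,
      baseChange_mc, baseChange_ec, bcHom_obj,
      bcHom_map, EnOb.baseChange_mm_left, bm_comp, hp.left]
  right h X := by
    induction X using boInd with | h X =>
    simp only [EnOb.baseChange_one, EnOb.baseChange_mul, EnOb.baseChange_rc, bmIso_hom,
      baseChange_mc, baseChange_ec, bcHom_obj,
      bcHom_map, EnOb.baseChange_mm_right, bm_comp, hp.right]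
  braid h h' X Y := by
    induction X using boInd with | h X =>
    induction Y using boInd with | h Y =>
    simp only [EnOb.baseChange_mul, EnOb.baseChange_bc, bmIso_hom,
      baseChange_mc, bcHom_obj, bcHom_map, bm_comp, hp.braid]

theorem Two.baseChange {F G : C ⟶ D} {p : EnMor x y F} {q : EnMor x y G} {t : F ⟶ G}
    (ht : Two p q t) : Two (p.baseChange k) (q.baseChange k) (bc₂ k t) where
  unit := by
    simp only [EnOb.baseChange_one, baseChange_ec, bcHom_obj, bc₂_app, bm_comp, ht.unit]
  mul h X Y := by
    induction X using boInd with | h X =>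
    induction Y using boInd with | h Y =>
    simp only [EnOb.baseChange_mul, baseChange_mc, bcHom_obj, bc₂_app, bm_comp, ht.mul,
      EnOb.baseChange_mm]

theorem Two.bcId : Two ((EnMor.id x).baseChange k) (EnMor.id (x.baseChange k))
    (LinCat.bcId k C).hom where
  unit := by
    simp only [EnOb.baseChange_one, baseChange_ec, id_ec, bcHom_obj, id_obj, bcId_hom_app, bm_id,
      Category.comp_id]
  mul h X Y := by
    induction X using boInd with | h X =>
    induction Y using boInd with | h Y =>
    simp only [EnOb.baseChange_mul, baseChange_mc, id_mc, bcHom_obj, id_obj, bcId_hom_app, bm_id,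
      EnOb.mm_id, Category.comp_id]

theorem Two.bcComp {F : C ⟶ D} {G : D ⟶ E} (p : EnMor x y F) (q : EnMor y z G) :
    Two ((p.comp q).baseChange k) ((p.baseChange k).comp (q.baseChange k))
      (LinCat.bcComp k F G).hom where
  unit := by
    simp only [EnOb.baseChange_one, baseChange_ec, comp_ec, bcHom_obj, comp_obj, bcComp_hom_app,
      bcHom_map, bm_comp, Category.comp_id]
  mul h X Y := by
    induction X using boInd with | h X =>
    induction Y using boInd with | h Y =>
    simp only [EnOb.baseChange_mul, baseChange_mc, comp_mc, bcHom_obj, comp_obj, bcComp_hom_app,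
      bcHom_map, bm_comp, Category.comp_id, EnOb.mm_id, Category.id_comp]

end EnMor

/-! ### Base change and restriction of `E_n`-algebras -/

/-- The `E_n`-algebra underlying an `E_∞`-algebra. -/
def EnOb.res (n : ℕ∞) (x : EnOb ⊤ C) : EnOb n C where
  u := x.u
  m _ := x.m le_top
  a _ := x.a le_top
  l _ := x.l le_top
  r _ := x.r le_top
  b _ _ := x.b le_top le_top

theorem EnOb.Laws.res (n : ℕ∞) {x : EnOb ⊤ C} (hx : x.Laws) : (x.res n).Laws where
  pentagon _ := hx.pentagon le_top
  triangle _ := hx.triangle le_top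
  hexagon _ _ := hx.hexagon le_top le_top
  hexagon' _ _ := hx.hexagon' le_top le_top
  symmetry _ _ _ := hx.symmetry le_top le_top le_top

/-- The morphism of `E_n`-algebras underlying a morphism of `E_∞`-algebras. -/
def EnMor.res (n : ℕ∞) {x : EnOb ⊤ C} {y : EnOb ⊤ D} {F : C ⟶ D} (p : EnMor x y F) :
    EnMor (x.res n) (y.res n) F where
  e := p.e
  t _ := p.t le_top

theorem EnMor.Laws.res (n : ℕ∞) {x : EnOb ⊤ C} {y : EnOb ⊤ D} {F : C ⟶ D} {p : EnMor x y F}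
    (hp : p.Laws) : (p.res n).Laws where
  assoc _ := hp.assoc le_top
  left _ := hp.left le_top
  right _ := hp.right le_top
  braid _ _ := hp.braid le_top le_top

namespace EnLin

variable {X Y Z : EnLin.{v, u} n R}

section

variable (k)

/-- Base change on 0-cells. -/
def bcObj (X : EnLin.{v, u} n R) : EnLin.{v, u} n k :=
  ⟨LinCat.bc k X.base, ⟨X.str.1.baseChange k, X.str.2.baseChange k⟩⟩

/-- Base change on 1-cells. -/
def bcHom (F : X ⟶ Y) : bcObj k X ⟶ bcObj k Y :=
  ⟨LinCat.bcHom k F.base, ⟨F.str.1.baseChange k, F.str.2.baseChange k⟩⟩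

/-- Base change on 2-cells. -/
def bc₂ {F G : X ⟶ Y} (t : F ⟶ G) : bcHom k F ⟶ bcHom k G :=
  ⟨LinCat.bc₂ k t.base, EnMor.Two.baseChange k t.prop⟩

/-- Base change preserves identities. -/
def bcId (X : EnLin.{v, u} n R) : bcHom k (𝟙 X) ≅ 𝟙 (bcObj k X) :=
  TotalBicat.isoMk (LinCat.bcId k X.base) (EnMor.Two.bcId k)

/-- Base change preserves composition. -/
def bcComp (F : X ⟶ Y) (G : Y ⟶ Z) : bcHom k (F ≫ G) ≅ bcHom k F ≫ bcHom k G :=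
  TotalBicat.isoMk (LinCat.bcComp k F.base G.base) (EnMor.Two.bcComp k F.str.1 G.str.1)

end

variable (n)

/-- Restriction on 0-cells. -/
def resObj (X : EnLin.{v, u} ⊤ R) : EnLin.{v, u} n R := ⟨X.base, ⟨X.str.1.res n, X.str.2.res n⟩⟩

variable {X Y Z : EnLin.{v, u} ⊤ R}

/-- Restriction on 1-cells. -/
def resHom (F : X ⟶ Y) : resObj n X ⟶ resObj n Y := ⟨F.base, ⟨F.str.1.res n, F.str.2.res n⟩⟩

/-- Restriction on 2-cells. -/
def res₂ {F G : X ⟶ Y} (t : F ⟶ G) : resHom n F ⟶ resHom n G :=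
  ⟨t.base, ⟨t.prop.unit, fun _ => t.prop.mul le_top⟩⟩

/-- Restriction preserves identities. -/
def resId (X : EnLin.{v, u} ⊤ R) : resHom n (𝟙 X) ≅ 𝟙 (resObj n X) := Iso.refl _

/-- Restriction preserves composition. -/
def resComp (F : X ⟶ Y) (G : Y ⟶ Z) : resHom n (F ≫ G) ≅ resHom n F ≫ resHom n G := Iso.refl _

end EnLin

/-! ### Categorified almost Poisson algebras and Beilinson–Drinfeld algebras -/

/-- An `E_n`-equivalence from the base change of an `E_n`-category over `R` to a symmetric monoidal
category over `k`. -/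
structure APOb (X : EnLin.{v, u} n R × EnLin.{v, u} ⊤ k) where
  hom : EnLin.bcObj k X.1 ⟶ EnLin.resObj n X.2
  isEquivalence : hom.base.functor.IsEquivalence

/-- Compatibility of a pair of functors with the `E_n`-equivalences, up to a specified invertible
`E_n`-natural transformation. -/
structure APMor {X Y : EnLin.{v, u} n R × EnLin.{v, u} ⊤ k} (ψ : APOb X) (χ : APOb Y)
    (F : X ⟶ Y) where
  iso : EnLin.bcHom k F.1 ≫ χ.hom ≅ ψ.hom ≫ EnLin.resHom n F.2

namespace APOb

variable {X : EnLin.{v, u} n R × EnLin.{v, u} ⊤ k} (ψ : APOb X)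

/-- The equivalence on objects. -/
def o (A : X.1.base) : X.2.base := obj ψ.hom.base (bo A)

/-- The equivalence on morphisms. -/
def mp {A B : X.1.base} (f : A ⟶ B) : ψ.o A ⟶ ψ.o B := map ψ.hom.base (bm f)

theorem mp_id (A : X.1.base) : ψ.mp (𝟙 A) = 𝟙 (ψ.o A) := LinCat.map_id ψ.hom.base (bo A)

theorem mp_comp {A B C : X.1.base} (f : A ⟶ B) (g : B ⟶ C) : ψ.mp (f ≫ g) = ψ.mp f ≫ ψ.mp g :=
  (congrArg (LinCat.map ψ.hom.base) (bm_comp f g).symm).trans (LinCat.map_comp ψ.hom.base _ _)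

end APOb

namespace APMor

variable {X Y Z W : EnLin.{v, u} n R × EnLin.{v, u} ⊤ k} {ψ : APOb X} {χ : APOb Y} {ω : APOb Z}
  {π : APOb W}

/-- Compatibility of a pair of natural transformations with the specified invertible
transformations. -/
def Two {F G : X ⟶ Y} (φ : APMor ψ χ F) (φ' : APMor ψ χ G) (t : F ⟶ G) : Prop :=
  φ.iso.hom ≫ ψ.hom ◁ EnLin.res₂ n t.2 = EnLin.bc₂ k t.1 ▷ χ.hom ≫ φ'.iso.hom

/-- The identity 1-cell. -/
def id (ψ : APOb X) : APMor ψ ψ (𝟙 X) where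
  iso := whiskerRightIso (EnLin.bcId k X.1) ψ.hom ≪≫ λ_ ψ.hom ≪≫ (ρ_ ψ.hom).symm ≪≫
    whiskerLeftIso ψ.hom (EnLin.resId n X.2).symm

/-- The composition of 1-cells. -/
def comp {F : X ⟶ Y} {G : Y ⟶ Z} (φ : APMor ψ χ F) (φ' : APMor χ ω G) : APMor ψ ω (F ≫ G) where
  iso := whiskerRightIso (EnLin.bcComp k F.1 G.1) ω.hom ≪≫ α_ _ _ _ ≪≫
    whiskerLeftIso (EnLin.bcHom k F.1) φ'.iso ≪≫ (α_ _ _ _).symm ≪≫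
    whiskerRightIso φ.iso (EnLin.resHom n G.2) ≪≫ α_ _ _ _ ≪≫
    whiskerLeftIso ψ.hom (EnLin.resComp n F.2 G.2).symm

/-- The components of the compatibility transformation. -/
def c {F : X ⟶ Y} (φ : APMor ψ χ F) (A : X.1.base) :
    χ.o (obj F.1.base A) ⟶ obj F.2.base (ψ.o A) :=
  app φ.iso.hom.base (bo A)

theorem two_iff {F G : X ⟶ Y} {φ : APMor ψ χ F} {φ' : APMor ψ χ G} {t : F ⟶ G} :
    Two φ φ' t ↔ ∀ A, φ.c A ≫ app t.2.base (ψ.o A) = χ.mp (app t.1.base A) ≫ φ'.c A :=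
  ⟨fun h A => congrArg (fun s : EnLin.bcHom k F.1 ≫ χ.hom ⟶ ψ.hom ≫ EnLin.resHom n G.2 =>
      app s.base (bo A)) h,
    fun h => TotalBicat.hom₂_ext (hom₂_ext fun A => h (un A))⟩

theorem id_c (ψ : APOb X) (A : X.1.base) : (APMor.id ψ).c A = 𝟙 (ψ.o A) := by
  change ψ.mp (𝟙 A) ≫ 𝟙 (ψ.o A) ≫ 𝟙 (ψ.o A) ≫ 𝟙 (ψ.o A) = _
  rw [APOb.mp_id, Category.id_comp, Category.id_comp, Category.id_comp]

theorem comp_c {F : X ⟶ Y} {G : Y ⟶ Z} (φ : APMor ψ χ F) (φ' : APMor χ ω G) (A : X.1.base) :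
    (φ.comp φ').c A = φ'.c (obj F.1.base A) ≫ map G.2.base (φ.c A) := by
  change ω.mp (𝟙 (obj G.1.base (obj F.1.base A))) ≫
    𝟙 (ω.o (obj G.1.base (obj F.1.base A))) ≫ φ'.c (obj F.1.base A) ≫
    𝟙 (obj G.2.base (χ.o (obj F.1.base A))) ≫ map G.2.base (φ.c A) ≫
    𝟙 (obj G.2.base (obj F.2.base (ψ.o A))) ≫ 𝟙 (obj G.2.base (obj F.2.base (ψ.o A))) = _
  rw [APOb.mp_id, Category.id_comp, Category.id_comp, Category.id_comp, Category.comp_id,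
    Category.comp_id]

theorem c_nat {F : X ⟶ Y} (φ : APMor ψ χ F) {A B : X.1.base} (f : A ⟶ B) :
    χ.mp (map F.1.base f) ≫ φ.c B = φ.c A ≫ map F.2.base (ψ.mp f) :=
  naturality φ.iso.hom.base (bm f)

end APMor

variable (k) in
/-- The 0-, 1- and 2-cells of the homotopy pullback of base change `E_n(R-Cat) → E_n(k-Cat)` and
restriction `E_∞(k-Cat) → E_n(k-Cat)`: pairs of cells with compatibility data. -/
def APDisp (n : ℕ∞) (R : Type) [CommRing R] [Algebra R k] :
    Disp (EnLin.{v, u} n R × EnLin.{v, u} ⊤ k) where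
  Ob := APOb
  Mor := APMor
  Two := APMor.Two
  id := APMor.id
  comp := APMor.comp
  two_id {X Y ψ χ F} φ := APMor.two_iff.2 fun A => by
    change φ.c A ≫ 𝟙 (obj F.2.base (ψ.o A)) = χ.mp (𝟙 (obj F.1.base A)) ≫ φ.c A
    rw [APOb.mp_id, Category.comp_id, Category.id_comp]
  two_comp {X Y ψ χ F G H p q r s t} hs ht := APMor.two_iff.2 fun A => by
    have h₁ := APMor.two_iff.1 hs A
    have h₂ := APMor.two_iff.1 ht A
    change p.c A ≫ app s.2.base _ ≫ app t.2.base _ =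
      χ.mp (app s.1.base A ≫ app t.1.base A) ≫ r.c A
    rw [APOb.mp_comp, sq h₁, h₂, Category.assoc]
  two_inv {X Y ψ χ F G p q} e he := APMor.two_iff.2 fun A => by
    have h₁ := APMor.two_iff.1 he A
    have h₂ : app e.inv.1.base A ≫ app e.hom.1.base A = 𝟙 (obj G.1.base A) :=
      congrArg (fun s : G ⟶ G => app s.1.base A) e.inv_hom_id
    have h₃ : app e.hom.2.base (ψ.o A) ≫ app e.inv.2.base (ψ.o A) = 𝟙 (obj F.2.base (ψ.o A)) :=
      congrArg (fun s : F ⟶ F => app s.2.base (ψ.o A)) e.hom_inv_id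
    rw [← Category.comp_id (p.c A), ← h₃, sq h₁, ← Category.assoc (χ.mp _), ← APOb.mp_comp, h₂,
      APOb.mp_id, Category.id_comp]
  two_whiskerLeft {X Y Z ψ χ ω F G H} p q r t ht := APMor.two_iff.2 fun A => by
    have h₁ := APMor.two_iff.1 ht (obj F.1.base A)
    rw [APMor.comp_c, APMor.comp_c]
    change (q.c (obj F.1.base A) ≫ map G.2.base (p.c A)) ≫
      app t.2.base (obj F.2.base (ψ.o A)) = ω.mp (app t.1.base (obj F.1.base A)) ≫
        r.c (obj F.1.base A) ≫ map H.2.base (p.c A)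
    rw [Category.assoc, naturality, sq h₁]
  two_whiskerRight {X Y Z ψ χ ω F G H p q t} r ht := APMor.two_iff.2 fun A => by
    have h₁ := congrArg (LinCat.map H.2.base) (APMor.two_iff.1 ht A)
    rw [LinCat.map_comp, LinCat.map_comp] at h₁
    rw [APMor.comp_c, APMor.comp_c]
    change (r.c (obj F.1.base A) ≫ map H.2.base (p.c A)) ≫
      map H.2.base (app t.2.base (ψ.o A)) = ω.mp (map H.1.base (app t.1.base A)) ≫
        r.c (obj G.1.base A) ≫ map H.2.base (q.c A)
    rw [Category.assoc, h₁, sq (r.c_nat (app t.1.base A))]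
  two_associator {X Y Z W ψ χ ω π F G H} p q r := APMor.two_iff.2 fun A => by
    rw [APMor.comp_c, APMor.comp_c, APMor.comp_c, APMor.comp_c]
    change (r.c (obj G.1.base (obj F.1.base A)) ≫ map H.2.base (q.c (obj F.1.base A) ≫
      map G.2.base (p.c A))) ≫ 𝟙 (obj H.2.base (obj G.2.base (obj F.2.base (ψ.o A)))) =
      π.mp (𝟙 (obj H.1.base (obj G.1.base (obj F.1.base A)))) ≫
        (r.c (obj G.1.base (obj F.1.base A)) ≫ map H.2.base (q.c (obj F.1.base A))) ≫
          map H.2.base (map G.2.base (p.c A))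
    rw [APOb.mp_id, Category.comp_id, Category.id_comp, LinCat.map_comp, Category.assoc]
  two_leftUnitor {X Y ψ χ F} p := APMor.two_iff.2 fun A => by
    rw [APMor.comp_c, APMor.id_c]
    change (p.c A ≫ map F.2.base (𝟙 (ψ.o A))) ≫ 𝟙 (obj F.2.base (ψ.o A)) =
      χ.mp (𝟙 (obj F.1.base A)) ≫ p.c A
    rw [APOb.mp_id, LinCat.map_id, Category.comp_id, Category.comp_id, Category.id_comp]
  two_rightUnitor {X Y ψ χ F} p := APMor.two_iff.2 fun A => by
    rw [APMor.comp_c, APMor.id_c]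
    change (𝟙 (χ.o (obj F.1.base A)) ≫ p.c A) ≫ 𝟙 (obj F.2.base (ψ.o A)) =
      χ.mp (𝟙 (obj F.1.base A)) ≫ p.c A
    rw [APOb.mp_id, Category.comp_id]

variable (k) in
/-- The 2-category of categorified algebras: for `R = ℂ[ε]/ε²` and `k = ℂ` the 2-category of almost
Poisson `n`-categories, for `R = ℂ⟦ħ⟧` and `k = ℂ` the 2-category of Beilinson–Drinfeld
`n`-categories. -/
abbrev AP (n : ℕ∞) (R : Type) [CommRing R] [Algebra R k] := TotalBicat (APDisp.{v, u} k n R)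

/-! ### Equivalences of linear categories -/

namespace LinCat

/-- The natural isomorphism underlying an invertible 2-cell. -/
def toNatIso {F G : C ⟶ D} (e : F ≅ G) : F.functor ≅ G.functor where
  hom := e.hom.nat
  inv := e.inv.nat
  hom_inv_id := congrArg Nat₂.nat e.hom_inv_id
  inv_hom_id := congrArg Nat₂.nat e.inv_hom_id

/-- The invertible 2-cell given by a natural isomorphism. -/
def ofNatIso {F G : C ⟶ D} (e : F.functor ≅ G.functor) : F ≅ G where
  hom := ⟨e.hom⟩
  inv := ⟨e.inv⟩
  hom_inv_id := Nat₂.ext e.hom_inv_id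
  inv_hom_id := Nat₂.ext e.inv_hom_id

theorem isEquivalence_of_inverse {F : C ⟶ D} (G : D ⟶ C) (e : F ≫ G ≅ 𝟙 C) (e' : G ≫ F ≅ 𝟙 D) :
    F.functor.IsEquivalence :=
  (CategoryTheory.Equivalence.mk F.functor G.functor (toNatIso e).symm
    (toNatIso e')).isEquivalence_functor

theorem exists_inverse {F : C ⟶ D} (h : F.functor.IsEquivalence) :
    ∃ G : D ⟶ C, Nonempty (F ≫ G ≅ 𝟙 C) ∧ Nonempty (G ≫ F ≅ 𝟙 D) := by
  have : F.functor.asEquivalence.functor.Additive := F.additive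
  have : F.functor.asEquivalence.functor.Linear R := F.isLinear
  have : F.functor.asEquivalence.inverse.Additive := inferInstance
  exact ⟨⟨F.functor.asEquivalence.inverse⟩, ⟨ofNatIso F.functor.asEquivalence.unitIso.symm⟩,
    ⟨ofNatIso F.functor.asEquivalence.counitIso⟩⟩

theorem isEquivalence_comp {F : C ⟶ D} {G : D ⟶ E} (hF : F.functor.IsEquivalence)
    (hG : G.functor.IsEquivalence) : (F ≫ G).functor.IsEquivalence :=
  inferInstanceAs (F.functor ⋙ G.functor).IsEquivalence

theorem isEquivalence_tensorHom {C' D' : LinCat.{v, u} R} {F : C ⟶ C'} {G : D ⟶ D'}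
    (hF : F.functor.IsEquivalence) (hG : G.functor.IsEquivalence) :
    (tensorHom F G).functor.IsEquivalence := by
  obtain ⟨F', ⟨e⟩, ⟨e'⟩⟩ := exists_inverse hF
  obtain ⟨G', ⟨d⟩, ⟨d'⟩⟩ := exists_inverse hG
  exact isEquivalence_of_inverse (tensorHom F' G')
    ((tensorComp F F' G G').symm ≪≫ tensorIso e d ≪≫ tensorId C D)
    ((tensorComp F' F G' G).symm ≪≫ tensorIso e' d' ≪≫ tensorId C' D')

theorem isEquivalence_split (C D : LinCat.{v, u} R) : (split k C D).functor.IsEquivalence where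
  faithful := ⟨fun {X Y _ _} h => (mergeL k (fst (un X)) (fst (un Y)) (snd (un X)) (snd (un Y))).symm.injective h⟩
  full := ⟨fun {X Y} f => (mergeL k (fst (un X)) (fst (un Y)) (snd (un X)) (snd (un Y))).symm.surjective f⟩
  essSurj := ⟨fun X => ⟨bo (pr (un (fst X)) (un (snd X))), ⟨Iso.refl _⟩⟩⟩

theorem isEquivalence_bcUnit : (bcUnit (R := R) k).functor.IsEquivalence where
  faithful := ⟨fun {X Y _ _} h => (bcUnitL k (un X) (un Y)).injective h⟩
  full := ⟨fun {X Y} f => (bcUnitL k (un X) (un Y)).surjective f⟩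
  essSurj := ⟨fun _ => ⟨bo pt, ⟨Iso.refl _⟩⟩⟩

/-- Naturality for functors on `k ⊗ (C ⊗ D)`. -/
theorem nat_bcT {A : LinCat.{v, u} k} {F G : bc k (tensor C D) ⟶ A} (t : ∀ X, obj F X ⟶ obj G X)
    (h : ∀ {X X' : C} {Y Y' : D} (f : X ⟶ X') (g : Y ⟶ Y'), map F (bm (tm f g)) ≫
      t (bo (pr X' Y')) = t (bo (pr X Y)) ≫ map G (bm (tm f g)))
    {X Y : bc k (tensor C D)} (f : X ⟶ Y) : map F f ≫ t Y = t X ≫ map G f := by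
  refine nat_bc t (fun {X Y} f => ?_) f
  induction X using prInd with | h X X' =>
  induction Y using prInd with | h Y Y' =>
  induction f using tm_induction with
  | add a b ha hb =>
    simp only [bm_add, LinCat.map_add, Preadditive.add_comp, Preadditive.comp_add, ha, hb]
  | pure f g => exact h f g

/-- Naturality for functors on `k ⊗ ((C ⊗ D) ⊗ E)`. -/
theorem nat_bcT₃ {A : LinCat.{v, u} k} {F G : bc k (tensor (tensor C D) E) ⟶ A}
    (t : ∀ X, obj F X ⟶ obj G X)
    (h : ∀ {X X' : C} {Y Y' : D} {Z Z' : E} (f : X ⟶ X') (g : Y ⟶ Y') (e : Z ⟶ Z'),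
      map F (bm (tm (tm f g) e)) ≫ t (bo (pr (pr X' Y') Z')) =
        t (bo (pr (pr X Y) Z)) ≫ map G (bm (tm (tm f g) e)))
    {X Y : bc k (tensor (tensor C D) E)} (f : X ⟶ Y) : map F f ≫ t Y = t X ≫ map G f := by
  refine nat_bcT t (fun {X Y _ _} f e => ?_) f
  induction X using prInd with | h X X' =>
  induction Y using prInd with | h Y Y' =>
  induction f using tm_induction with
  | add a b ha hb =>
    simp only [add_tm, bm_add, LinCat.map_add, Preadditive.add_comp, Preadditive.comp_add, ha, hb]
  | pure f g => exact h f g e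

end LinCat

/-! ### The tensor product of categorified algebras -/

theorem not_one_le_zero (h : (1 : ℕ∞) ≤ 0) : False := by simp at h

/-- A morphism of pointed linear categories. -/
def EnMor.pointed {x : EnOb 0 C} {y : EnOb 0 D} (F : C ⟶ D) (e : y.one ≅ obj F x.one) :
    EnMor x y F where
  e := LinCat.isoMk (fun _ => e) (nat_unit (F := y.u) (G := x.u ≫ F) (fun _ => e.hom))
  t h := (not_one_le_zero h).elim

theorem EnMor.pointed_ec {x : EnOb 0 C} {y : EnOb 0 D} (F : C ⟶ D) (e : y.one ≅ obj F x.one) :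
    (EnMor.pointed F e).ec = e := rfl

theorem EnMor.Laws.zero {x : EnOb 0 C} {y : EnOb 0 D} {F : C ⟶ D} (p : EnMor x y F) : p.Laws where
  assoc h := (not_one_le_zero h).elim
  left h := (not_one_le_zero h).elim
  right h := (not_one_le_zero h).elim
  braid h := (not_one_le_zero h).elim

namespace EnLin

/-- A 1-cell of pointed linear categories. -/
def pointed {X Y : EnLin.{v, u} 0 R} (F : X.base ⟶ Y.base)
    (e : Y.str.1.one ≅ obj F X.str.1.one) : X ⟶ Y :=
  ⟨F, ⟨EnMor.pointed F e, EnMor.Laws.zero _⟩⟩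

/-- An invertible 2-cell of pointed linear categories. -/
def isoPt {X Y : EnLin.{v, u} 0 R} {F G : X ⟶ Y} (e : F.base ≅ G.base)
    (h : F.str.1.ec.hom ≫ app e.hom X.str.1.one = G.str.1.ec.hom) : F ≅ G :=
  TotalBicat.isoMk e ⟨h, fun h => (not_one_le_zero h).elim⟩

end EnLin

namespace APOb

/-- The tensor product of `E_0`-equivalences. -/
def tensor {X Y : EnLin.{v, u} 0 R × EnLin.{v, u} ⊤ k} (ψ : APOb X) (χ : APOb Y) :
    APOb ((tObj X.1 Y.1, tObj X.2 Y.2) : EnLin.{v, u} 0 R × EnLin.{v, u} ⊤ k) where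
  hom := EnLin.pointed (split k X.1.base Y.1.base ≫ tensorHom ψ.hom.base χ.hom.base)
    (tmIso ψ.hom.str.1.ec χ.hom.str.1.ec)
  isEquivalence := isEquivalence_comp (isEquivalence_split _ _)
    (isEquivalence_tensorHom ψ.isEquivalence χ.isEquivalence)

/-- The unit `E_0`-equivalence. -/
def unit (R : Type) [CommRing R] [Algebra R k] :
    APOb ((I, I) : EnLin.{v, u} 0 R × EnLin.{v, u} ⊤ k) where
  hom := EnLin.pointed (bcUnit k) (Iso.refl pt)
  isEquivalence := isEquivalence_bcUnit

end APOb

namespace LinCat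

variable {C' D' E' : LinCat.{v, u} k} (F : bc k C ⟶ C') (G : bc k D ⟶ D') (H : bc k E ⟶ E')

/-- The associator is compatible with base change, with identity components. -/
def bcAssoc : bcHom k (assoc C D E) ≫ split k _ _ ≫ tensorHom F (split k _ _ ≫ tensorHom G H) ≅
    (split k _ _ ≫ tensorHom (split k _ _ ≫ tensorHom F G) H) ≫ assoc _ _ _ :=
  isoMk (fun A => Iso.refl (pr (obj F (bo (fst (fst (un A))))) (pr (obj G (bo (snd (fst (un A)))))
      (obj H (bo (snd (un A)))))))
    (nat_bcT₃ (F := bcHom k (assoc C D E) ≫ split k _ _ ≫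
        tensorHom F (split k _ _ ≫ tensorHom G H))
      (G := (split k _ _ ≫ tensorHom (split k _ _ ≫ tensorHom F G) H) ≫ assoc _ _ _)
      (fun A => 𝟙 (pr (obj F (bo (fst (fst (un A))))) (pr (obj G (bo (snd (fst (un A)))))
        (obj H (bo (snd (un A)))))))
      fun f g e => by
        simp only [comp_obj, LinCat.comp_map, bcHom_obj, bcHom_map, assoc_obj, assoc_map,
          split_obj, split_map, tensorHom_obj, tensorHom_map, un_bo, fst_pr, snd_pr,
          Category.comp_id, Category.id_comp])

/-- The braiding is compatible with base change, with identity components. -/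
def bcBraid : bcHom k (braid C D) ≫ split k _ _ ≫ tensorHom G F ≅
    (split k _ _ ≫ tensorHom F G) ≫ braid _ _ :=
  isoMk (fun A => Iso.refl (pr (obj G (bo (snd (un A)))) (obj F (bo (fst (un A))))))
    (nat_bcT (F := bcHom k (braid C D) ≫ split k _ _ ≫ tensorHom G F)
      (G := (split k _ _ ≫ tensorHom F G) ≫ braid _ _)
      (fun A => 𝟙 (pr (obj G (bo (snd (un A)))) (obj F (bo (fst (un A))))))
      fun f g => by
        simp only [comp_obj, LinCat.comp_map, bcHom_obj, bcHom_map, braid_obj, braid_map,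
          split_obj, split_map, tensorHom_obj, tensorHom_map, un_bo, fst_pr, snd_pr,
          Category.comp_id, Category.id_comp])

/-- The left unitor is compatible with base change, with identity components. -/
def bcLeftUnit : bcHom k (leftUnit C) ≫ F ≅
    (split k _ _ ≫ tensorHom (bcUnit k) F) ≫ leftUnit _ :=
  isoMk (fun A => Iso.refl (obj F (bo (snd (un A)))))
    (nat_bcT (F := bcHom k (leftUnit C) ≫ F)
      (G := (split k _ _ ≫ tensorHom (bcUnit k) F) ≫ leftUnit _)
      (fun A => 𝟙 (obj F (bo (snd (un A)))))
      fun f g => by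
        simp only [comp_obj, LinCat.comp_map, bcHom_obj, bcHom_map, leftUnit_obj, leftUnit_map,
          split_obj, split_map, tensorHom_obj, tensorHom_map, un_bo, snd_pr,
          bcUnit_obj, bcUnit_map, bm_smul, LinCat.map_smul, LinearEquiv.map_smul, scalar_id,
          smul_eq_mul, mul_one, Category.comp_id, Category.id_comp])

/-- The right unitor is compatible with base change, with identity components. -/
def bcRightUnit : bcHom k (rightUnit C) ≫ F ≅
    (split k _ _ ≫ tensorHom F (bcUnit k)) ≫ rightUnit _ :=
  isoMk (fun A => Iso.refl (obj F (bo (fst (un A)))))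
    (nat_bcT (F := bcHom k (rightUnit C) ≫ F)
      (G := (split k _ _ ≫ tensorHom F (bcUnit k)) ≫ rightUnit _)
      (fun A => 𝟙 (obj F (bo (fst (un A)))))
      fun f g => by
        simp only [comp_obj, LinCat.comp_map, bcHom_obj, bcHom_map, rightUnit_obj, rightUnit_map,
          split_obj, split_map, tensorHom_obj, tensorHom_map, un_bo, fst_pr,
          bcUnit_obj, bcUnit_map, bm_smul, LinCat.map_smul, LinearEquiv.map_smul, scalar_id,
          smul_eq_mul, mul_one, Category.comp_id, Category.id_comp])

end LinCat

namespace APOb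

variable {X : EnLin.{v, u} n R × EnLin.{v, u} ⊤ k}

/-- The comparison of unit objects. -/
def pc (ψ : APOb X) : X.2.str.1.one ≅ ψ.o X.1.str.1.one := ψ.hom.str.1.ec

end APOb

theorem leftUnit_pc {X Y : C} (f : X ⟶ Y) :
    map (leftUnit C) (tm (𝟙 (pt : LinCat.unit.{v, u} R)) f) = f := one_smul R f

theorem rightUnit_pc {X Y : C} (f : X ⟶ Y) :
    map (rightUnit C) (tm f (𝟙 (pt : LinCat.unit.{v, u} R))) = f := one_smul R f

namespace APMor

theorem c_unit {X Y : EnLin.{v, u} n R × EnLin.{v, u} ⊤ k} {ψ : APOb X} {χ : APOb Y} {F : X ⟶ Y}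
    (φ : APMor ψ χ F) : χ.pc.hom ≫ χ.mp F.1.str.1.ec.hom ≫ φ.c X.1.str.1.one =
      F.2.str.1.ec.hom ≫ map F.2.base ψ.pc.hom := by
  have h := φ.iso.hom.prop.unit
  have h₁ := EnMor.comp_ec (F.1.str.1.baseChange k) χ.hom.str.1
  have h₂ := EnMor.comp_ec ψ.hom.str.1 (F.2.str.1.res n)
  exact (Category.assoc _ _ _).symm.trans ((congrArg (· ≫ φ.c X.1.str.1.one) h₁.symm).trans
    (h.trans h₂))

variable {X Y Z X' Y' Z' : EnLin.{v, u} 0 R × EnLin.{v, u} ⊤ k} {ψ : APOb X} {χ : APOb Y}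
  {ω : APOb Z} {ψ' : APOb X'} {χ' : APOb Y'} {ω' : APOb Z'}

/-- A 1-cell of `E_0`-equivalences from an invertible natural transformation. -/
def mk₀ (ψ : APOb X) (χ : APOb Y) {F : X ⟶ Y}
    (e : LinCat.bcHom k F.1.base ≫ χ.hom.base ≅ ψ.hom.base ≫ F.2.base)
    (unit : χ.pc.hom ≫ χ.mp F.1.str.1.ec.hom ≫ app e.hom (bo X.1.str.1.one) =
      F.2.str.1.ec.hom ≫ map F.2.base ψ.pc.hom) : APMor ψ χ F where
  iso := EnLin.isoPt e (by
    have h₁ := EnMor.comp_ec (F.1.str.1.baseChange k) χ.hom.str.1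
    have h₂ := EnMor.comp_ec ψ.hom.str.1 (F.2.str.1.res 0)
    exact (congrArg (· ≫ app e.hom (bo X.1.str.1.one)) h₁).trans ((Category.assoc _ _ _).trans
      (unit.trans h₂.symm)))

theorem mk₀_c {F : X ⟶ Y} (e : LinCat.bcHom k F.1.base ≫ χ.hom.base ≅ ψ.hom.base ≫ F.2.base)
    (unit) (A : X.1.base) : (mk₀ ψ χ (F := F) e unit).c A = app e.hom (bo A) := rfl

/-- The components of the compatibility transformation, as isomorphisms. -/
def ci {F : X ⟶ Y} (φ : APMor ψ χ F) (A : X.1.base) :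
    χ.o (obj F.1.base A) ≅ obj F.2.base (ψ.o A) :=
  appIso (TotalBicat.isoBase φ.iso) (bo A)

theorem ci_hom {F : X ⟶ Y} (φ : APMor ψ χ F) (A : X.1.base) : (φ.ci A).hom = φ.c A := rfl

theorem tensor_o (A : X.1.base) (A' : X'.1.base) :
    (ψ.tensor ψ').o (pr A A') = pr (ψ.o A) (ψ'.o A') := rfl
theorem tensor_mp {A B : X.1.base} {A' B' : X'.1.base} (f : A ⟶ B) (f' : A' ⟶ B') :
    (ψ.tensor ψ').mp (tm f f') = tm (ψ.mp f) (ψ'.mp f') := rfl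
theorem tensor_pc : (ψ.tensor ψ').pc = tmIso ψ.pc ψ'.pc := rfl

/-- The tensor product of compatibility transformations. -/
def tensorIso {F : X ⟶ Y} {F' : X' ⟶ Y'} (φ : APMor ψ χ F) (φ' : APMor ψ' χ' F') :
    LinCat.bcHom k (tensorHom F.1.base F'.1.base) ≫ split k _ _ ≫
        tensorHom χ.hom.base χ'.hom.base ≅
      (split k _ _ ≫ tensorHom ψ.hom.base ψ'.hom.base) ≫ tensorHom F.2.base F'.2.base :=
  LinCat.isoMk (fun A => tmIso (φ.ci (fst (un A))) (φ'.ci (snd (un A))))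
    (nat_bcT (F := LinCat.bcHom k (tensorHom F.1.base F'.1.base) ≫ split k _ _ ≫
        tensorHom χ.hom.base χ'.hom.base)
      (G := (split k _ _ ≫ tensorHom ψ.hom.base ψ'.hom.base) ≫ tensorHom F.2.base F'.2.base)
      (fun A => tm (φ.c (fst (un A))) (φ'.c (snd (un A))))
      (fun f f' => congrArg₂ tm (φ.c_nat f) (φ'.c_nat f')))

/-- The tensor product of 1-cells. -/
def tensor {F : X ⟶ Y} {F' : X' ⟶ Y'} (φ : APMor ψ χ F) (φ' : APMor ψ' χ' F') :
    APMor (F := ((tHom F.1 F'.1, tHom F.2 F'.2) : ((tObj X.1 X'.1, tObj X.2 X'.2) :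
      EnLin.{v, u} 0 R × EnLin.{v, u} ⊤ k) ⟶ (tObj Y.1 Y'.1, tObj Y.2 Y'.2)))
      (ψ.tensor ψ') (χ.tensor χ') :=
  mk₀ (ψ.tensor ψ') (χ.tensor χ') (tensorIso φ φ')
    (congrArg₂ tm φ.c_unit φ'.c_unit)

theorem tensor_c {F : X ⟶ Y} {F' : X' ⟶ Y'} (φ : APMor ψ χ F) (φ' : APMor ψ' χ' F') (A : X.1.base)
    (A' : X'.1.base) : (φ.tensor φ').c (pr A A') = tm (φ.c A) (φ'.c A') := rfl

theorem unit_aux {A : Type u} [Category.{v} A] {a b : A} (f : a ⟶ b) (g : b ⟶ b) (h : g = 𝟙 b) :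
    f ≫ g ≫ 𝟙 b = 𝟙 a ≫ f := by rw [h, Category.comp_id, Category.comp_id, Category.id_comp]

/-- The associator. -/
def assoc (ψ : APOb X) (χ : APOb Y) (ω : APOb Z) :
    APMor (F := ((as X.1 Y.1 Z.1, as X.2 Y.2 Z.2) :
      ((tObj (tObj X.1 Y.1) Z.1, tObj (tObj X.2 Y.2) Z.2) :
        EnLin.{v, u} 0 R × EnLin.{v, u} ⊤ k) ⟶
      (tObj X.1 (tObj Y.1 Z.1), tObj X.2 (tObj Y.2 Z.2))))
      ((ψ.tensor χ).tensor ω) (ψ.tensor (χ.tensor ω)) :=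
  mk₀ _ _ (bcAssoc ψ.hom.base χ.hom.base ω.hom.base)
    (unit_aux (tm ψ.pc.hom (tm χ.pc.hom ω.pc.hom))
      ((ψ.tensor (χ.tensor ω)).mp (𝟙 (pr X.1.str.1.one (pr Y.1.str.1.one Z.1.str.1.one))))
      (APOb.mp_id _ _))

/-- The braiding. -/
def braid (ψ : APOb X) (χ : APOb Y) :
    APMor (F := ((br X.1 Y.1, br X.2 Y.2) :
      ((tObj X.1 Y.1, tObj X.2 Y.2) : EnLin.{v, u} 0 R × EnLin.{v, u} ⊤ k) ⟶
      (tObj Y.1 X.1, tObj Y.2 X.2))) (ψ.tensor χ) (χ.tensor ψ) :=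
  mk₀ _ _ (bcBraid ψ.hom.base χ.hom.base)
    (unit_aux (tm χ.pc.hom ψ.pc.hom) ((χ.tensor ψ).mp (𝟙 (pr Y.1.str.1.one X.1.str.1.one)))
      (APOb.mp_id _ _))

/-- The left unitor. -/
def leftUnit (ψ : APOb X) :
    APMor (F := ((lu X.1, lu X.2) :
      ((tObj I X.1, tObj I X.2) : EnLin.{v, u} 0 R × EnLin.{v, u} ⊤ k) ⟶
      (X.1, X.2))) ((APOb.unit R).tensor ψ) ψ :=
  mk₀ _ _ (bcLeftUnit ψ.hom.base)
    ((unit_aux ψ.pc.hom (ψ.mp (𝟙 X.1.str.1.one)) (APOb.mp_id _ _)).trans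
      (congrArg (𝟙 X.2.str.1.one ≫ ·) (leftUnit_pc ψ.pc.hom).symm))

/-- The right unitor. -/
def rightUnit (ψ : APOb X) :
    APMor (F := ((ru X.1, ru X.2) :
      ((tObj X.1 I, tObj X.2 I) : EnLin.{v, u} 0 R × EnLin.{v, u} ⊤ k) ⟶
      (X.1, X.2))) (ψ.tensor (APOb.unit R)) ψ :=
  mk₀ _ _ (bcRightUnit ψ.hom.base)
    ((unit_aux ψ.pc.hom (ψ.mp (𝟙 X.1.str.1.one)) (APOb.mp_id _ _)).trans
      (congrArg (𝟙 X.2.str.1.one ≫ ·) (rightUnit_pc ψ.pc.hom).symm))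

end APMor

namespace APMor

variable {X Y Z X' Y' Z' : EnLin.{v, u} 0 R × EnLin.{v, u} ⊤ k} {ψ : APOb X} {χ : APOb Y}
  {ω : APOb Z} {ψ' : APOb X'} {χ' : APOb Y'} {ω' : APOb Z'}

theorem two_tensorId (ψ : APOb X) (ψ' : APOb X') :
    Two ((APMor.id ψ).tensor (APMor.id ψ')) (APMor.id (ψ.tensor ψ'))
      (Iso.prod (tId X.1 X'.1) (tId X.2 X'.2)).hom := two_iff.2 fun A => by
  induction A using prInd with | h A A' =>
  have h : ((APMor.id ψ).tensor (APMor.id ψ')).c (pr A A') = 𝟙 (pr (ψ.o A) (ψ'.o A')) := by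
    rw [tensor_c, id_c, id_c]
    rfl
  have h' : (APMor.id (ψ.tensor ψ')).c (pr A A') = 𝟙 (pr (ψ.o A) (ψ'.o A')) := id_c _ _
  rw [h, h']
  exact congrArg (· ≫ 𝟙 (pr (ψ.o A) (ψ'.o A'))) (APOb.mp_id (ψ.tensor ψ') (pr A A')).symm

theorem two_tensorComp {F : X ⟶ Y} {G : Y ⟶ Z} {F' : X' ⟶ Y'} {G' : Y' ⟶ Z'}
    (φ : APMor ψ χ F) (θ : APMor χ ω G) (φ' : APMor ψ' χ' F') (θ' : APMor χ' ω' G') :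
    Two ((φ.comp θ).tensor (φ'.comp θ')) ((φ.tensor φ').comp (θ.tensor θ'))
      (Iso.prod (tComp F.1 G.1 F'.1 G'.1) (tComp F.2 G.2 F'.2 G'.2)).hom := two_iff.2 fun A => by
  induction A using prInd with | h A A' =>
  have h : ((φ.comp θ).tensor (φ'.comp θ')).c (pr A A') =
      tm (θ.c (obj F.1.base A) ≫ map G.2.base (φ.c A))
        (θ'.c (obj F'.1.base A') ≫ map G'.2.base (φ'.c A')) := by
    rw [tensor_c, comp_c, comp_c]
    rfl
  have h' : ((φ.tensor φ').comp (θ.tensor θ')).c (pr A A') =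
      tm (θ.c (obj F.1.base A) ≫ map G.2.base (φ.c A))
        (θ'.c (obj F'.1.base A') ≫ map G'.2.base (φ'.c A')) := comp_c _ _ _
  rw [h, h']
  exact (Category.comp_id _).trans ((Category.id_comp _).symm.trans (congrArg
    (· ≫ tm (θ.c (obj F.1.base A) ≫ map G.2.base (φ.c A))
        (θ'.c (obj F'.1.base A') ≫ map G'.2.base (φ'.c A')))
    (APOb.mp_id (ω.tensor ω') (pr (obj G.1.base (obj F.1.base A))
      (obj G'.1.base (obj F'.1.base A')))).symm))

end APMor

instance : TensorCells (AP.{v, u} k 0 R) where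
  I := ⟨(I, I), APOb.unit R⟩
  tObj X Y := ⟨(tObj X.base.1 Y.base.1, tObj X.base.2 Y.base.2), X.str.tensor Y.str⟩
  tHom F G := ⟨(tHom F.base.1 G.base.1, tHom F.base.2 G.base.2), F.str.tensor G.str⟩
  tId X Y := TotalBicat.isoMk (Iso.prod (tId X.base.1 Y.base.1) (tId X.base.2 Y.base.2))
    (APMor.two_tensorId X.str Y.str)
  tComp F F' G G' := TotalBicat.isoMk (Iso.prod (tComp F.base.1 F'.base.1 G.base.1 G'.base.1)
    (tComp F.base.2 F'.base.2 G.base.2 G'.base.2))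
    (APMor.two_tensorComp F.str F'.str G.str G'.str)
  as X Y Z := ⟨(as X.base.1 Y.base.1 Z.base.1, as X.base.2 Y.base.2 Z.base.2),
    APMor.assoc X.str Y.str Z.str⟩
  lu X := ⟨(lu X.base.1, lu X.base.2), APMor.leftUnit X.str⟩
  ru X := ⟨(ru X.base.1, ru X.base.2), APMor.rightUnit X.str⟩
  br X Y := ⟨(br X.base.1 Y.base.1, br X.base.2 Y.base.2), APMor.braid X.str Y.str⟩

/-! ### `E_n`-algebras in categorified algebras -/

/-- The first component of an invertible 2-cell of a product. -/
def isoFst {B : Type u} [Bicategory.{w, v} B] {B' : Type u'} [Bicategory.{w, v'} B'] {X Y : B × B'}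
    {f g : X ⟶ Y} (e : f ≅ g) : f.1 ≅ g.1 where
  hom := e.hom.1
  inv := e.inv.1
  hom_inv_id := congrArg Prod.fst e.hom_inv_id
  inv_hom_id := congrArg Prod.fst e.inv_hom_id

/-- The second component of an invertible 2-cell of a product. -/
def isoSnd {B : Type u} [Bicategory.{w, v} B] {B' : Type u'} [Bicategory.{w, v'} B'] {X Y : B × B'}
    {f g : X ⟶ Y} (e : f ≅ g) : f.2 ≅ g.2 where
  hom := e.hom.2
  inv := e.inv.2
  hom_inv_id := congrArg Prod.snd e.hom_inv_id
  inv_hom_id := congrArg Prod.snd e.inv_hom_id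

namespace AP

/-- The underlying `R`-linear category. -/
abbrev lin (X : AP.{v, u} k n R) : LinCat.{v, u} R := X.base.1.base

/-- The underlying symmetric monoidal `k`-linear category, as a linear category. -/
abbrev smc (X : AP.{v, u} k n R) : LinCat.{v, u} k := X.base.2.base

variable {X Y Z : AP.{v, u} k n R}

/-- The underlying `R`-linear functor. -/
abbrev linHom (F : X ⟶ Y) : X.lin ⟶ Y.lin := F.base.1.base

/-- The underlying `k`-linear functor. -/
abbrev smcHom (F : X ⟶ Y) : X.smc ⟶ Y.smc := F.base.2.base

/-- The underlying natural transformation of `R`-linear functors. -/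
abbrev lin₂ {F G : X ⟶ Y} (t : F ⟶ G) : linHom F ⟶ linHom G := t.base.1.base

/-- The underlying natural transformation of `k`-linear functors. -/
abbrev smc₂ {F G : X ⟶ Y} (t : F ⟶ G) : smcHom F ⟶ smcHom G := t.base.2.base

/-- The underlying invertible natural transformation of `R`-linear functors. -/
def linIso {F G : X ⟶ Y} (e : F ≅ G) : linHom F ≅ linHom G :=
  TotalBicat.isoBase (isoFst (TotalBicat.isoBase e))

/-- The underlying invertible natural transformation of `k`-linear functors. -/
def smcIso {F G : X ⟶ Y} (e : F ≅ G) : smcHom F ≅ smcHom G :=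
  TotalBicat.isoBase (isoSnd (TotalBicat.isoBase e))

end AP

/-- The `E_n`-algebra in `R`-linear categories underlying an `E_n`-algebra in categorified
algebras. -/
def EnOb.lin {X : AP.{v, u} k 0 R} (x : EnOb n X) : EnOb n X.lin where
  u := AP.linHom x.u
  m h := AP.linHom (x.m h)
  a h := AP.linIso (x.a h)
  l h := AP.linIso (x.l h)
  r h := AP.linIso (x.r h)
  b h h' := AP.linIso (x.b h h')

/-- The `E_n`-algebra in `k`-linear categories underlying an `E_n`-algebra in categorified
algebras. -/
def EnOb.smc {X : AP.{v, u} k 0 R} (x : EnOb n X) : EnOb n X.smc where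
  u := AP.smcHom x.u
  m h := AP.smcHom (x.m h)
  a h := AP.smcIso (x.a h)
  l h := AP.smcIso (x.l h)
  r h := AP.smcIso (x.r h)
  b h h' := AP.smcIso (x.b h h')

namespace EnMor

variable {X Y Z : AP.{v, u} k 0 R} {x : EnOb n X} {y : EnOb n Y} {z : EnOb n Z}

/-- The underlying morphism of `E_n`-algebras in `R`-linear categories. -/
def lin {F : X ⟶ Y} (p : EnMor x y F) : EnMor x.lin y.lin (AP.linHom F) where
  e := AP.linIso p.e
  t h := AP.linIso (p.t h)

/-- The underlying morphism of `E_n`-algebras in `k`-linear categories. -/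
def smc {F : X ⟶ Y} (p : EnMor x y F) : EnMor x.smc y.smc (AP.smcHom F) where
  e := AP.smcIso p.e
  t h := AP.smcIso (p.t h)

theorem lin_id (x : EnOb n X) : (EnMor.id x).lin = EnMor.id x.lin := rfl
theorem smc_id (x : EnOb n X) : (EnMor.id x).smc = EnMor.id x.smc := rfl
theorem lin_comp {F : X ⟶ Y} {G : Y ⟶ Z} (p : EnMor x y F) (q : EnMor y z G) :
    (p.comp q).lin = p.lin.comp q.lin := rfl
theorem smc_comp {F : X ⟶ Y} {G : Y ⟶ Z} (p : EnMor x y F) (q : EnMor y z G) :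
    (p.comp q).smc = p.smc.comp q.smc := rfl

end EnMor

variable (k) in
/-- The bicategory structure on `E_n`-algebras in categorified algebras. The 2-cells of the latter
are pairs of 2-cells of linear categories, and an equation between them holds if and only if it
holds for both components; the coherence laws of an `E_n`-algebra and of its morphisms and 2-cells
are therefore those of the two components. -/
def EnAPDisp (n : ℕ∞) (R : Type) [CommRing R] [Algebra R k] : Disp (AP.{v, u} k 0 R) where
  Ob X := {x : EnOb n X // x.lin.Laws ∧ x.smc.Laws}
  Mor x y F := {p : EnMor x.1 y.1 F // p.lin.Laws ∧ p.smc.Laws}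
  Two p q t := EnMor.Two p.1.lin q.1.lin (AP.lin₂ t) ∧ EnMor.Two p.1.smc q.1.smc (AP.smc₂ t)
  id x := ⟨EnMor.id x.1, EnMor.Laws.id, EnMor.Laws.id⟩
  comp p q := ⟨p.1.comp q.1, p.2.1.comp q.2.1, p.2.2.comp q.2.2⟩
  two_id p := ⟨EnMor.Two.id p.1.lin, EnMor.Two.id p.1.smc⟩
  two_comp hs ht := ⟨hs.1.comp ht.1, hs.2.comp ht.2⟩
  two_inv e he := ⟨EnMor.Two.inv (AP.linIso e) he.1, EnMor.Two.inv (AP.smcIso e) he.2⟩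
  two_whiskerLeft p _ _ _ ht :=
    ⟨EnMor.Two.whiskerLeft p.1.lin ht.1, EnMor.Two.whiskerLeft p.1.smc ht.2⟩
  two_whiskerRight r ht :=
    ⟨EnMor.Two.whiskerRight r.1.lin ht.1, EnMor.Two.whiskerRight r.1.smc ht.2⟩
  two_associator {_ _ _ _ x y z w _ _ _} p q r :=
    ⟨(EnDisp n).two_associator (x := ⟨x.1.lin, x.2.1⟩) (y := ⟨y.1.lin, y.2.1⟩)
        (z := ⟨z.1.lin, z.2.1⟩) (t := ⟨w.1.lin, w.2.1⟩) ⟨p.1.lin, p.2.1⟩ ⟨q.1.lin, q.2.1⟩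
        ⟨r.1.lin, r.2.1⟩,
      (EnDisp n).two_associator (x := ⟨x.1.smc, x.2.2⟩) (y := ⟨y.1.smc, y.2.2⟩)
        (z := ⟨z.1.smc, z.2.2⟩) (t := ⟨w.1.smc, w.2.2⟩) ⟨p.1.smc, p.2.2⟩ ⟨q.1.smc, q.2.2⟩
        ⟨r.1.smc, r.2.2⟩⟩
  two_leftUnitor {_ _ x y _} p :=
    ⟨(EnDisp n).two_leftUnitor (x := ⟨x.1.lin, x.2.1⟩) (y := ⟨y.1.lin, y.2.1⟩) ⟨p.1.lin, p.2.1⟩,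
      (EnDisp n).two_leftUnitor (x := ⟨x.1.smc, x.2.2⟩) (y := ⟨y.1.smc, y.2.2⟩) ⟨p.1.smc, p.2.2⟩⟩
  two_rightUnitor {_ _ x y _} p :=
    ⟨(EnDisp n).two_rightUnitor (x := ⟨x.1.lin, x.2.1⟩) (y := ⟨y.1.lin, y.2.1⟩) ⟨p.1.lin, p.2.1⟩,
      (EnDisp n).two_rightUnitor (x := ⟨x.1.smc, x.2.2⟩) (y := ⟨y.1.smc, y.2.2⟩) ⟨p.1.smc, p.2.2⟩⟩

variable (k) in
/-- The bicategory of `E_n`-algebras in categorified algebras. -/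
abbrev EnAP (n : ℕ∞) (R : Type) [CommRing R] [Algebra R k] := TotalBicat (EnAPDisp.{v, u} k n R)

/-! ### Equivalences of bicategories -/

/-- A pseudofunctor is a biequivalence if it is surjective on 0-cells up to equivalence and an
equivalence on categories of 1-cells. -/
structure IsBiequivalence {B : Type*} [Bicategory B] {B' : Type*} [Bicategory B']
    (F : Pseudofunctor B B') : Prop where
  essSurj : ∀ Y : B', ∃ X : B, Nonempty (Bicategory.Equivalence (F.obj X) Y)
  isEquivalence : ∀ X Y : B, (F.mapFunctor X Y).IsEquivalence

/-! ### The dual numbers and formal power series -/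

/-- The augmentation `ℂ[ε]/ε² → ℂ`, `ε ↦ 0`. -/
instance dualNumberAlgebra : Algebra (DualNumber ℂ) ℂ := (TrivSqZeroExt.fstHom ℂ ℂ ℂ).toRingHom.toAlgebra

/-- The augmentation `ℂ⟦ħ⟧ → ℂ`, `ħ ↦ 0`. -/
instance powerSeriesAlgebra : Algebra (PowerSeries ℂ) ℂ := (PowerSeries.constantCoeff (R := ℂ)).toAlgebra

/-- The 2-category `aP_n-Cat` of almost Poisson `n`-categories: first order deformations of symmetric
monoidal `ℂ`-linear categories as `E_n`-categories. -/
abbrev APCat (n : ℕ∞) := AP.{v, u} ℂ n (DualNumber ℂ)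

/-- The 2-category `BD_n-Cat` of Beilinson–Drinfeld `n`-categories: formal deformations of symmetric
monoidal `ℂ`-linear categories as `E_n`-categories. -/
abbrev BDCat (n : ℕ∞) := AP.{v, u} ℂ n (PowerSeries ℂ)

/-- The 2-category `E_n(aP_0-Cat)` of `E_n`-algebras in `aP_0-Cat`. -/
abbrev EnAPCat (n : ℕ∞) := EnAP.{v, u} ℂ n (DualNumber ℂ)

/-- The 2-category `E_n(BD_0-Cat)` of `E_n`-algebras in `BD_0-Cat`. -/
abbrev EnBDCat (n : ℕ∞) := EnAP.{v, u} ℂ n (PowerSeries ℂ)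

end CatDQ

end

/-! Since 2-cells of triples (C, S, ψ) are pairs of 2-cells, an `E_n`-algebra among such triples
splits into three pieces: an `E_n`-algebra on C among pointed R-linear categories, an `E_n`-algebra
on S among symmetric monoidal k-linear categories, and the compatibility of ψ with both. The first
two pieces carry redundant data. The point of C is isomorphic to the unit of the algebra (`ptIso`),
and the pointed conditions follow from unit laws. On S there are two products: the given one, ·,
with unit 1, and that of the algebra, ∗, with unit 1'. The second is a symmetric monoidal functor
with respect to the first, so the Eckmann–Hilton argument gives an isomorphism c: X · Y ≅ (X ∗ 1') ·
(1' ∗ Y) ≅ (X · 1') ∗ (1' · Y) ≅ X ∗ Y. So the algebra structure on S is no more than S itself. What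
remains is C with its `E_n`-structure, S, and ψ, which is now an `E_n`-functor: a categorified
`E_n`-algebra.

The real work is the coherence of c. It is natural, compatible with units (`c_left`, `c_right`) and
monoidal (`c_mul`). After that a uniqueness principle, `Two.ext_tensor`, does the rest: a monoidal
transformation between functors of two variables is determined by its values at (X, 1) and (1, Y),
because (X, Y) is isomorphic to the product of these. At such pairs the unit laws decide. This
yields associativity (`mcmp_assoc`), compatibility with the braidings (`mcmp_braid`) and
compatibility with 1-cells (`mcmp_mc`).

Conversely, a symmetric monoidal category carries a canonical algebra structure with ∗ equal to ·
(`EnLin.canon`): its product is a symmetric monoidal functor, and its associator, unitors and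
braiding are monoidal transformations. All of this comes down to identities for the middle four
interchange, and it is here that symmetry of the braiding enters.

The comparison `toAP` forgets the point and the second product, and composes ψ with c. It is
bijective on 2-cells and surjective on 1-cells and 0-cells up to equality (`toHom_ofHom`,
`toObj_enAP`), because the forgotten data can be rebuilt by the formulas that coherence forces. For
0-cells the equality rests on c being the identity for the canonical structure (`EnLin.canon_mcmp`).
The argument is uniform in the ring homomorphism from R to k; dual numbers and power series are two
instances. -/

noncomputable section

/-! ### Identities for the interchange and the unit in monoidal categories. -/

section

open CategoryTheory MonoidalCategory

/-- The tensor product of a symmetric monoidal category is a braided functor. -/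
theorem tensorμ_braiding {A : Type u} [Category.{v} A] [MonoidalCategory A] [SymmetricCategory A]
    (X₁ X₂ Y₁ Y₂ : A) : tensorμ X₁ X₂ Y₁ Y₂ ≫ ((β_ X₁ Y₁).hom ⊗ₘ (β_ X₂ Y₂).hom) =
      (β_ (X₁ ⊗ X₂) (Y₁ ⊗ Y₂)).hom ≫ tensorμ Y₁ Y₂ X₁ X₂ := by
  dsimp only [tensorμ]
  simp only [BraidedCategory.braiding_tensor_left_hom, BraidedCategory.braiding_tensor_right_hom]
  symm
  calc
    -- The big braiding crosses `X₁` with `Y₂`, and the interchange after it crosses them back. This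
    -- form isolates that double crossing, which symmetry removes; all else is monoidal coherence.
    _ = 𝟙 _ ⊗≫ X₁ ◁ (β_ X₂ Y₁).hom ▷ Y₂ ⊗≫ ((β_ X₁ Y₁).hom ▷ (X₂ ⊗ Y₂) ≫ (Y₁ ⊗ X₁) ◁ (β_ X₂ Y₂).hom) ⊗≫
          Y₁ ◁ ((β_ X₁ Y₂).hom ≫ (β_ Y₂ X₁).hom) ▷ X₂ ⊗≫ 𝟙 _ := by
        monoidal
    _ = _ := by
        rw [SymmetricCategory.symmetry, MonoidalCategory.tensorHom_def]
        monoidal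

/-- By the hexagons the outer braiding contains a crossing of `Y₁` with `X₂`. By symmetry it cancels
the crossing of `X₂` with `Y₁` inside `tensorμ`; the crossing of `X₁` with `Y₂` that is left is the
one in the interchange on the right. -/
theorem tensorμ_swap {A : Type u} [Category.{v} A] [MonoidalCategory A] [SymmetricCategory A]
    (X₁ X₂ Y₁ Y₂ : A) : tensorμ X₁ X₂ Y₁ Y₂ ≫ (β_ (X₁ ⊗ Y₁) (X₂ ⊗ Y₂)).hom =
      ((β_ X₁ X₂).hom ⊗ₘ (β_ Y₁ Y₂).hom) ≫ tensorμ X₂ X₁ Y₂ Y₁ := by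
  simp [tensorμ, SymmetricCategory.braiding_swap_eq_inv_braiding Y₁ X₂,
    MonoidalCategory.tensorHom_def]

/-- Coherence on the unit object alone. This and the next identity give associativity of the
comparison of 1 with 1 ⊗ 1, wherever a unit comparison is a left unitor or its inverse. -/
theorem leftUnitor_inv_whiskerRight_unit {A : Type u} [Category.{v} A] [MonoidalCategory A] :
    (λ_ (𝟙_ A)).inv ≫ (λ_ (𝟙_ A)).inv ▷ 𝟙_ A ≫ (α_ (𝟙_ A) (𝟙_ A) (𝟙_ A)).hom =
      (λ_ (𝟙_ A)).inv ≫ 𝟙_ A ◁ (λ_ (𝟙_ A)).inv := by monoidal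

theorem leftUnitor_whiskerRight_unit {A : Type u} [Category.{v} A] [MonoidalCategory A] :
    (λ_ (𝟙_ A)).hom ▷ 𝟙_ A ≫ (λ_ (𝟙_ A)).hom =
      (α_ (𝟙_ A) (𝟙_ A) (𝟙_ A)).hom ≫ 𝟙_ A ◁ (λ_ (𝟙_ A)).hom ≫ (λ_ (𝟙_ A)).hom := by monoidal

end

open CategoryTheory Bicategory
open scoped TensorProduct

namespace CatDQ

attribute [-instance] catToReflQuiver

open TensorCells LinCat

section

variable {R : Type} [CommRing R] {n : ℕ∞} {C D E : LinCat.{v, u} R}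

/-! ### Linear `E_n`-categories as monoidal categories -/

namespace EnOb

/-- The monoidal category underlying an `E_n`-category, `n ≥ 1`. -/
@[reducible]
def monoidal {x : EnOb n C} (hx : x.Laws) (h : 1 ≤ n) : MonoidalCategory C where
  tensorObj := x.mul h
  whiskerLeft X _ _ f := x.mm h (𝟙 X) f
  whiskerRight f Y := x.mm h f (𝟙 Y)
  tensorHom f g := x.mm h f g
  tensorUnit := x.one
  associator := x.ac h
  leftUnitor := x.lc h
  rightUnitor := x.rc h
  tensorHom_def f g := by rw [← mm_comp, Category.comp_id, Category.id_comp]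
  id_tensorHom_id := mm_id h
  tensorHom_comp_tensorHom _ _ _ _ := (mm_comp h _ _ _ _).symm
  whiskerLeft_id := mm_id h
  id_whiskerRight := mm_id h
  associator_naturality := ac_nat h
  leftUnitor_naturality := lc_nat h
  rightUnitor_naturality := rc_nat h
  pentagon := hx.pentagon h
  triangle := hx.triangle h

/-- The braided monoidal category underlying an `E_n`-category, `n ≥ 2`. -/
@[reducible]
def braided {x : EnOb n C} (hx : x.Laws) (h : 1 ≤ n) (h' : 2 ≤ n) :
    letI := monoidal hx h
    BraidedCategory C :=
  letI := monoidal hx h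
  { braiding := x.bc h h'
    braiding_naturality_right := fun X _ _ f => bc_nat h h' (𝟙 X) f
    braiding_naturality_left := fun f Z => bc_nat h h' f (𝟙 Z)
    hexagon_forward := hx.hexagon h h'
    hexagon_reverse := hx.hexagon' h h' }

/-- The symmetric monoidal category underlying an `E_∞`-category. -/
@[reducible]
def symmetric {x : EnOb ⊤ C} (hx : x.Laws) :
    letI := monoidal hx le_top
    SymmetricCategory C :=
  letI := monoidal hx le_top
  { toBraidedCategory := braided hx le_top le_top
    symmetry := hx.symmetry le_top le_top le_top }

end EnOb

/-- The lax braided functor underlying a morphism of `E_∞`-categories. -/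
@[reducible]
def EnMor.laxBraided {x : EnOb ⊤ C} {y : EnOb ⊤ D} (hx : x.Laws) (hy : y.Laws) {F : C ⟶ D}
    {p : EnMor x y F} (hp : p.Laws) :
    letI := EnOb.monoidal hx le_top
    letI := EnOb.monoidal hy le_top
    letI := EnOb.symmetric hx
    letI := EnOb.symmetric hy
    F.functor.LaxBraided :=
  letI := EnOb.monoidal hx le_top
  letI := EnOb.monoidal hy le_top
  letI := EnOb.symmetric hx
  letI := EnOb.symmetric hy
  { toLaxMonoidal := ⟨p.ec.hom, fun X Y => (p.mc le_top X Y).hom, fun f _ => p.mc_left le_top f,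
      fun _ f => p.mc_right le_top f, hp.assoc le_top, fun X => (hp.left le_top X).symm,
      fun X => (hp.right le_top X).symm⟩
    braided := hp.braid le_top le_top }

/-! ### The middle four interchange and its coherence. -/

namespace EnOb

/-- The middle four interchange of an `E_∞`-category. -/
def mf {x : EnOb ⊤ C} (hx : x.Laws) (X Y Z W : C) :
    x.mul le_top (x.mul le_top X Y) (x.mul le_top Z W) ≅
      x.mul le_top (x.mul le_top X Z) (x.mul le_top Y W) :=
  letI := monoidal hx le_top
  letI := symmetric hx
  { hom := MonoidalCategory.tensorμ X Y Z W
    inv := MonoidalCategory.tensorδ X Y Z W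
    hom_inv_id := MonoidalCategory.tensorμ_tensorδ X Y Z W
    inv_hom_id := MonoidalCategory.tensorδ_tensorμ X Y Z W }

variable {x : EnOb ⊤ C} (hx : x.Laws)


/-- The operations of `monoidal hx` and `symmetric hx` are by definition the components of `x`, so
this and the following identities are general facts about `tensorμ`, reread in the notation of
`E_n`-categories. -/
theorem mf_nat {X₁ X₂ X₃ X₄ Y₁ Y₂ Y₃ Y₄ : C} (f₁ : X₁ ⟶ Y₁) (f₂ : X₂ ⟶ Y₂) (f₃ : X₃ ⟶ Y₃)
    (f₄ : X₄ ⟶ Y₄) : x.mm le_top (x.mm le_top f₁ f₂) (x.mm le_top f₃ f₄) ≫ (mf hx Y₁ Y₂ Y₃ Y₄).hom =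
      (mf hx X₁ X₂ X₃ X₄).hom ≫ x.mm le_top (x.mm le_top f₁ f₃) (x.mm le_top f₂ f₄) :=
  letI := monoidal hx le_top
  letI := symmetric hx
  MonoidalCategory.tensorμ_natural f₁ f₂ f₃ f₄

/-- Together with `mf_left`, `mf_right` and `mf_bc` this makes the product a symmetric monoidal
functor. The identities `mf_ac`, `mf_lc`, `mf_rc` and `mf_swap` make the associator, the unitors and
the braiding monoidal transformations. -/
theorem mf_assoc (X₁ X₂ Y₁ Y₂ Z₁ Z₂ : C) :
    x.mm le_top (mf hx X₁ X₂ Y₁ Y₂).hom (𝟙 (x.mul le_top Z₁ Z₂)) ≫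
      (mf hx (x.mul le_top X₁ Y₁) (x.mul le_top X₂ Y₂) Z₁ Z₂).hom ≫
        x.mm le_top (x.ac le_top X₁ Y₁ Z₁).hom (x.ac le_top X₂ Y₂ Z₂).hom =
      (x.ac le_top (x.mul le_top X₁ X₂) (x.mul le_top Y₁ Y₂) (x.mul le_top Z₁ Z₂)).hom ≫
        x.mm le_top (𝟙 (x.mul le_top X₁ X₂)) (mf hx Y₁ Y₂ Z₁ Z₂).hom ≫
          (mf hx X₁ X₂ (x.mul le_top Y₁ Z₁) (x.mul le_top Y₂ Z₂)).hom :=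
  letI := monoidal hx le_top
  letI := symmetric hx
  MonoidalCategory.tensor_associativity X₁ X₂ Y₁ Y₂ Z₁ Z₂

theorem mf_left (X₁ X₂ : C) :
    x.mm le_top (x.lc le_top x.one).inv (𝟙 (x.mul le_top X₁ X₂)) ≫
      (mf hx x.one x.one X₁ X₂).hom ≫ x.mm le_top (x.lc le_top X₁).hom (x.lc le_top X₂).hom =
      (x.lc le_top (x.mul le_top X₁ X₂)).hom :=
  letI := monoidal hx le_top
  letI := symmetric hx
  (MonoidalCategory.tensor_left_unitality X₁ X₂).symm

theorem mf_right (X₁ X₂ : C) :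
    x.mm le_top (𝟙 (x.mul le_top X₁ X₂)) (x.lc le_top x.one).inv ≫
      (mf hx X₁ X₂ x.one x.one).hom ≫ x.mm le_top (x.rc le_top X₁).hom (x.rc le_top X₂).hom =
      (x.rc le_top (x.mul le_top X₁ X₂)).hom :=
  letI := monoidal hx le_top
  letI := symmetric hx
  (MonoidalCategory.tensor_right_unitality X₁ X₂).symm

theorem mf_lc (X₁ X₂ : C) :
    (mf hx x.one X₁ x.one X₂).hom ≫ x.mm le_top (x.lc le_top x.one).hom (𝟙 (x.mul le_top X₁ X₂)) ≫
      (x.lc le_top (x.mul le_top X₁ X₂)).hom =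
      x.mm le_top (x.lc le_top X₁).hom (x.lc le_top X₂).hom :=
  letI := monoidal hx le_top
  letI := symmetric hx
  (MonoidalCategory.leftUnitor_monoidal X₁ X₂).symm

theorem mf_rc (X₁ X₂ : C) :
    (mf hx X₁ x.one X₂ x.one).hom ≫ x.mm le_top (𝟙 (x.mul le_top X₁ X₂)) (x.lc le_top x.one).hom ≫
      (x.rc le_top (x.mul le_top X₁ X₂)).hom =
      x.mm le_top (x.rc le_top X₁).hom (x.rc le_top X₂).hom :=
  letI := monoidal hx le_top
  letI := symmetric hx
  (MonoidalCategory.rightUnitor_monoidal X₁ X₂).symm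

theorem mf_bc (X₁ X₂ Y₁ Y₂ : C) :
    (mf hx X₁ X₂ Y₁ Y₂).hom ≫ x.mm le_top (x.bc le_top le_top X₁ Y₁).hom
        (x.bc le_top le_top X₂ Y₂).hom =
      (x.bc le_top le_top (x.mul le_top X₁ X₂) (x.mul le_top Y₁ Y₂)).hom ≫
        (mf hx Y₁ Y₂ X₁ X₂).hom :=
  letI := monoidal hx le_top
  letI := symmetric hx
  tensorμ_braiding X₁ X₂ Y₁ Y₂

theorem mf_swap (X₁ X₂ Y₁ Y₂ : C) :
    (mf hx X₁ X₂ Y₁ Y₂).hom ≫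
        (x.bc le_top le_top (x.mul le_top X₁ Y₁) (x.mul le_top X₂ Y₂)).hom =
      x.mm le_top (x.bc le_top le_top X₁ X₂).hom (x.bc le_top le_top Y₁ Y₂).hom ≫
        (mf hx X₂ X₁ Y₂ Y₁).hom :=
  letI := monoidal hx le_top
  letI := symmetric hx
  tensorμ_swap X₁ X₂ Y₁ Y₂

theorem mf_ac (X₁ X₂ X₃ Y₁ Y₂ Y₃ : C) :
    (mf hx (x.mul le_top X₁ X₂) X₃ (x.mul le_top Y₁ Y₂) Y₃).hom ≫
      x.mm le_top (mf hx X₁ X₂ Y₁ Y₂).hom (𝟙 (x.mul le_top X₃ Y₃)) ≫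
        (x.ac le_top (x.mul le_top X₁ Y₁) (x.mul le_top X₂ Y₂) (x.mul le_top X₃ Y₃)).hom =
      x.mm le_top (x.ac le_top X₁ X₂ X₃).hom (x.ac le_top Y₁ Y₂ Y₃).hom ≫
        (mf hx X₁ (x.mul le_top X₂ X₃) Y₁ (x.mul le_top Y₂ Y₃)).hom ≫
          x.mm le_top (𝟙 (x.mul le_top X₁ Y₁)) (mf hx X₂ X₃ Y₂ Y₃).hom :=
  letI := monoidal hx le_top
  letI := symmetric hx
  MonoidalCategory.associator_monoidal X₁ X₂ X₃ Y₁ Y₂ Y₃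

end EnOb

/-- The interchange is built from associators and one braiding, and a braided monoidal functor
respects both. The identity is used twice: it makes the comparison of products of a functor a
monoidal transformation, and, for the second product regarded as a functor, it becomes
`Interchange.mf_i`. -/
theorem EnMor.mf_mc {x : EnOb ⊤ C} {y : EnOb ⊤ D} (hx : x.Laws) (hy : y.Laws) {F : C ⟶ D}
    {p : EnMor x y F} (hp : p.Laws) (X Y Z W : C) :
    (EnOb.mf hy (obj F X) (obj F Y) (obj F Z) (obj F W)).hom ≫
      y.mm le_top (p.mc le_top X Z).hom (p.mc le_top Y W).hom ≫
        (p.mc le_top (x.mul le_top X Z) (x.mul le_top Y W)).hom =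
      y.mm le_top (p.mc le_top X Y).hom (p.mc le_top Z W).hom ≫
        (p.mc le_top (x.mul le_top X Y) (x.mul le_top Z W)).hom ≫
          LinCat.map F (EnOb.mf hx X Y Z W).hom :=
  letI := EnOb.monoidal hx le_top
  letI := EnOb.monoidal hy le_top
  letI := EnOb.symmetric hx
  letI := EnOb.symmetric hy
  letI := EnMor.laxBraided hx hy hp
  MonoidalCategory.tensorμ_comp_μ_tensorHom_μ_comp_μ F.functor X Y Z W

/-! ### The canonical `E_n`-algebra structure on a symmetric monoidal linear category -/

namespace EnOb

section

variable {x : EnOb n C} (hx : x.Laws) (h : 1 ≤ n)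
include hx

theorem lc_one_eq_rc_one : (x.lc h x.one).hom = (x.rc h x.one).hom :=
  letI := monoidal hx h
  MonoidalCategory.unitors_equal

theorem lc_mul (X Y : C) : (x.ac h x.one X Y).hom ≫ (x.lc h (x.mul h X Y)).hom =
    x.mm h (x.lc h X).hom (𝟙 Y) :=
  letI := monoidal hx h
  (MonoidalCategory.leftUnitor_whiskerRight X Y).symm

theorem rc_mul (X Y : C) : (x.ac h X Y x.one).hom ≫ x.mm h (𝟙 X) (x.rc h Y).hom =
    (x.rc h (x.mul h X Y)).hom :=
  letI := monoidal hx h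
  (MonoidalCategory.rightUnitor_tensor_hom X Y).symm

theorem bc_lc (h' : 2 ≤ n) (X : C) : (x.bc h h' X x.one).hom ≫ (x.lc h X).hom = (x.rc h X).hom :=
  letI := monoidal hx h
  letI := braided hx h h'
  braiding_leftUnitor X

theorem bc_rc (h' : 2 ≤ n) (X : C) : (x.bc h h' x.one X).hom ≫ (x.rc h X).hom = (x.lc h X).hom :=
  letI := monoidal hx h
  letI := braided hx h h'
  braiding_rightUnitor X

theorem one_assoc : (x.lc h x.one).inv ≫ x.mm h (x.lc h x.one).inv (𝟙 x.one) ≫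
    (x.ac h x.one x.one x.one).hom = (x.lc h x.one).inv ≫ x.mm h (𝟙 x.one) (x.lc h x.one).inv :=
  letI := monoidal hx h
  leftUnitor_inv_whiskerRight_unit

theorem one_assoc' : x.mm h (x.lc h x.one).hom (𝟙 x.one) ≫ (x.lc h x.one).hom =
    (x.ac h x.one x.one x.one).hom ≫ x.mm h (𝟙 x.one) (x.lc h x.one).hom ≫ (x.lc h x.one).hom :=
  letI := monoidal hx h
  leftUnitor_whiskerRight_unit

end

theorem a_app (x : EnOb n C) (h : 1 ≤ n) (X Y Z : C) :
    app (x.a h).hom (pr (pr X Y) Z) = (x.ac h X Y Z).hom := rfl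
theorem l_app (x : EnOb n C) (h : 1 ≤ n) (r : LinCat.unit.{v, u} R) (X : C) :
    app (x.l h).hom (pr r X) = (x.lc h X).hom := rfl
theorem r_app (x : EnOb n C) (h : 1 ≤ n) (r : LinCat.unit.{v, u} R) (X : C) :
    app (x.r h).hom (pr X r) = (x.rc h X).hom := rfl
theorem b_app (x : EnOb n C) (h : 1 ≤ n) (h' : 2 ≤ n) (X Y : C) :
    app (x.b h h').hom (pr X Y) = (x.bc h h' X Y).hom := rfl

end EnOb

/-! ### Unit and product of a symmetric monoidal category as symmetric monoidal functors. -/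

namespace EnMor

/-- The unit of a symmetric monoidal category as a symmetric monoidal functor. -/
def unitMor (x : EnOb ⊤ C) : EnMor (EnOb.unit ⊤ R) x x.u where
  e := (λ_ x.u).symm
  t h := LinCat.isoMk (fun _ => x.lc h x.one)
    (nat_tensor (F := tensorHom x.u x.u ≫ x.m h) (G := LinCat.leftUnit _ ≫ x.u)
      (fun _ => (x.lc h x.one).hom) fun {r r' s s'} f g => by
        obtain rfl := EnOb.unit_eq r pt
        obtain rfl := EnOb.unit_eq r' pt
        obtain rfl := EnOb.unit_eq s pt
        obtain rfl := EnOb.unit_eq s' pt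
        -- Morphisms of the unit category are scalars. Both functors act by the product of the two
        -- scalars, so naturality is bilinearity of composition.
        have hf : LinCat.map x.u f = scalar pt pt f • 𝟙 x.one := map_unit _ _
        have hg : LinCat.map x.u g = scalar pt pt g • 𝟙 x.one := map_unit _ _
        have h₁ : x.mm h (LinCat.map x.u f) (LinCat.map x.u g) =
            scalar pt pt f • scalar pt pt g • 𝟙 (x.mul h x.one x.one) :=
          (congrArg₂ (x.mm h) hf hg).trans ((EnOb.smul_mm x h _ _ _).trans (congrArg (_ • ·)
            ((EnOb.mm_smul x h _ _ _).trans (congrArg (_ • ·) (EnOb.mm_id h _ _)))))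
        have h₂ : LinCat.map x.u (scalar pt pt f • g) =
            scalar pt pt f • scalar pt pt g • 𝟙 x.one :=
          (LinCat.map_smul _ _ _).trans (congrArg (_ • ·) hg)
        refine (congrArg (· ≫ (x.lc h x.one).hom) h₁).trans
          (Eq.trans ?_ (congrArg ((x.lc h x.one).hom ≫ ·) h₂).symm)
        change (_ • _ • 𝟙 (x.mul h x.one x.one)) ≫ (x.lc h x.one).hom =
          (x.lc h x.one).hom ≫ (_ • _ • 𝟙 x.one)
        rw [Linear.smul_comp, Linear.comp_smul, Linear.smul_comp, Linear.comp_smul,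
          Category.id_comp, Category.comp_id])

theorem unitMor_mc (x : EnOb ⊤ C) (h : 1 ≤ (⊤ : ℕ∞)) (r s : LinCat.unit.{v, u} R) :
    ((unitMor x).mc h r s).hom = (x.lc h x.one).hom := rfl

/-- The unit category has a single object, so each law is one equation between maps on powers of the
unit object. They follow from `one_assoc'`, from the equality of the two unitors at the unit, and
from the compatibility of the braiding with the unitors. -/
theorem Laws.unitMor {x : EnOb ⊤ C} (hx : x.Laws) : (EnMor.unitMor x).Laws where
  assoc h r s t := by
    obtain rfl := EnOb.unit_eq t pt
    change x.mm h (x.lc h x.one).hom (𝟙 x.one) ≫ (x.lc h x.one).hom ≫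
      LinCat.map x.u (𝟙 pt) = _
    rw [LinCat.map_id]
    refine Eq.trans ?_ (EnOb.one_assoc' hx h)
    exact congrArg (x.mm h (x.lc h x.one).hom (𝟙 x.one) ≫ ·) (Category.comp_id _)
  left h r := by
    obtain rfl := EnOb.unit_eq r pt
    change x.mm h (𝟙 x.one) (𝟙 x.one) ≫ (x.lc h x.one).hom ≫
      LinCat.map x.u (𝟙 pt) = (x.lc h x.one).hom
    rw [LinCat.map_id, EnOb.mm_id]
    exact (Category.id_comp _).trans (Category.comp_id _)
  right h r := by
    obtain rfl := EnOb.unit_eq r pt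
    change x.mm h (𝟙 x.one) (𝟙 x.one) ≫ (x.lc h x.one).hom ≫
      LinCat.map x.u (𝟙 pt) = (x.rc h x.one).hom
    rw [LinCat.map_id, EnOb.mm_id, ← EnOb.lc_one_eq_rc_one hx]
    exact (Category.id_comp _).trans (Category.comp_id _)
  braid h h' r s := by
    obtain rfl := EnOb.unit_eq s pt
    change (x.lc h x.one).hom ≫ LinCat.map x.u (𝟙 pt) =
      (x.bc h h' x.one x.one).hom ≫ (x.lc h x.one).hom
    rw [LinCat.map_id, EnOb.bc_lc hx, ← EnOb.lc_one_eq_rc_one hx]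
    exact Category.comp_id _

/-- The product of a symmetric monoidal category as a symmetric monoidal functor. -/
def mulMor {x : EnOb ⊤ C} (hx : x.Laws) : EnMor (x.tensor x) x (x.m le_top) where
  e := LinCat.isoMk (fun _ => (x.lc le_top x.one).symm)
    (nat_unit (F := x.u) (G := pick (pr x.one x.one) ≫ x.m le_top)
      (fun _ => (x.lc le_top x.one).inv))
  t _ := LinCat.isoMk (fun P => EnOb.mf hx (fst (fst P)) (snd (fst P)) (fst (snd P)) (snd (snd P)))
    (nat_two (F := tensorHom (x.m le_top) (x.m le_top) ≫ x.m le_top)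
      (G := (x.tensor x).m le_top ≫ x.m le_top)
      (fun P => (EnOb.mf hx (fst (fst P)) (snd (fst P)) (fst (snd P)) (snd (snd P))).hom)
      fun f₁ f₂ f₃ f₄ => EnOb.mf_nat hx f₁ f₂ f₃ f₄)

section

variable {x : EnOb ⊤ C} (hx : x.Laws)

theorem mulMor_mc (h : 1 ≤ (⊤ : ℕ∞)) (X Y Z W : C) :
    ((mulMor hx).mc h (pr X Y) (pr Z W)).hom = (EnOb.mf hx X Y Z W).hom := rfl

theorem Laws.mulMor : (EnMor.mulMor hx).Laws where
  assoc _ X Y Z := EnOb.mf_assoc hx (fst X) (snd X) (fst Y) (snd Y) (fst Z) (snd Z)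
  left _ X := EnOb.mf_left hx (fst X) (snd X)
  right _ X := EnOb.mf_right hx (fst X) (snd X)
  braid _ _ X Y := EnOb.mf_bc hx (fst X) (snd X) (fst Y) (snd Y)

/-- An algebra among symmetric monoidal categories needs structural 2-cells that are monoidal. For
the associator, the unit half is `one_assoc` and the product half is `mf_ac`. -/
theorem Two.mul_assoc (h : 1 ≤ (⊤ : ℕ∞)) : Two (((mulMor hx).tensor (EnMor.id x)).comp (mulMor hx))
    ((EnMor.assoc x x x).comp (((EnMor.id x).tensor (mulMor hx)).comp (mulMor hx)))
    (x.a h).hom where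
  unit := by
    rw [comp_ec, comp_ec, comp_ec]
    have h₁ := EnOb.one_assoc hx le_top
    refine (Category.assoc _ _ _).trans (h₁.trans ?_)
    exact ((congrArg (((x.lc le_top x.one).inv ≫ x.mm le_top (𝟙 x.one) (x.lc le_top x.one).inv) ≫ ·)
      (LinCat.map_id (tensorHom (𝟙 C) (x.m le_top) ≫ x.m le_top) (pr x.one (pr x.one x.one)))).trans
      (Category.comp_id _)).symm
  mul h X Y := by
    induction X using prInd with | h X X₃ =>
    induction X using prInd with | h X₁ X₂ =>
    induction Y using prInd with | h Y Y₃ =>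
    induction Y using prInd with | h Y₁ Y₂ =>
    simp only [comp_mc, tensor_mc, id_mc, assoc_mc, tensorHom_obj, id_obj, EnOb.m_obj,
      comp_obj, LinCat.assoc_obj, mulMor_mc, EnOb.tensor_mul, EnOb.a_app, LinCat.map_id,
      Category.comp_id, Category.assoc, EnOb.m_map]
    exact EnOb.mf_ac hx X₁ X₂ X₃ Y₁ Y₂ Y₃

theorem Two.one_mul (h : 1 ≤ (⊤ : ℕ∞)) : Two (((unitMor x).tensor (EnMor.id x)).comp (mulMor hx))
    (EnMor.leftUnit x) (x.l h).hom where
  unit := by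
    rw [comp_ec]
    change ((x.lc h x.one).inv ≫ x.mm h (𝟙 x.one) (𝟙 x.one)) ≫ (x.lc h x.one).hom = 𝟙 x.one
    rw [EnOb.mm_id, Category.comp_id, Iso.inv_hom_id]
  mul h X Y := by
    induction X using prInd with | h r X =>
    induction Y using prInd with | h s Y =>
    simp only [comp_mc, tensor_mc, id_mc, unitMor_mc, leftUnit_mc, tensorHom_obj, id_obj,
      EnOb.m_obj, comp_obj, leftUnit_obj, mulMor_mc, EnOb.tensor_mul, EnOb.l_app, Category.comp_id]
    exact (Category.assoc _ _ _).trans (EnOb.mf_lc hx X Y)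

theorem Two.mul_one (h : 1 ≤ (⊤ : ℕ∞)) : Two (((EnMor.id x).tensor (unitMor x)).comp (mulMor hx))
    (EnMor.rightUnit x) (x.r h).hom where
  unit := by
    rw [comp_ec]
    change ((x.lc h x.one).inv ≫ x.mm h (𝟙 x.one) (𝟙 x.one)) ≫ (x.rc h x.one).hom = 𝟙 x.one
    rw [EnOb.mm_id, Category.comp_id, ← EnOb.lc_one_eq_rc_one hx, Iso.inv_hom_id]
  mul h X Y := by
    induction X using prInd with | h X r =>
    induction Y using prInd with | h Y s =>
    simp only [comp_mc, tensor_mc, id_mc, unitMor_mc, rightUnit_mc, tensorHom_obj, id_obj,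
      EnOb.m_obj, comp_obj, rightUnit_obj, mulMor_mc, EnOb.tensor_mul, EnOb.r_app,
      Category.comp_id]
    exact (Category.assoc _ _ _).trans (EnOb.mf_rc hx X Y)

/-- The product half is `mf_swap`, where the symmetry of the braiding is used. The unit half holds
because the braiding of 1 with itself is absorbed by the unitors, which agree there. -/
theorem Two.mul_comm (h : 1 ≤ (⊤ : ℕ∞)) (h' : 2 ≤ (⊤ : ℕ∞)) : Two (mulMor hx)
    ((EnMor.braid x x).comp (mulMor hx)) (x.b h h').hom where
  unit := by
    rw [comp_ec]
    change (x.lc h x.one).inv ≫ (x.bc h h' x.one x.one).hom =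
      (x.lc h x.one).inv ≫ x.mm h (𝟙 x.one) (𝟙 x.one)
    rw [EnOb.mm_id, Category.comp_id, ← cancel_mono (x.lc h x.one).hom, Category.assoc,
      EnOb.bc_lc hx, EnOb.lc_one_eq_rc_one hx]
  mul h X Y := by
    induction X using prInd with | h X₁ X₂ =>
    induction Y using prInd with | h Y₁ Y₂ =>
    simp only [comp_mc, braid_mc, EnOb.m_obj, comp_obj, LinCat.braid_obj, mulMor_mc,
      EnOb.tensor_mul, EnOb.b_app, LinCat.map_id, Category.comp_id]
    exact EnOb.mf_swap hx X₁ X₂ Y₁ Y₂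

/-- The comparison of products of a symmetric monoidal functor is monoidal. -/
theorem Two.map_mul {y : EnOb ⊤ D} (hy : y.Laws) {F : C ⟶ D} {p : EnMor x y F} (hp : p.Laws)
    (h : 1 ≤ (⊤ : ℕ∞)) :
    Two ((p.tensor p).comp (mulMor hy)) ((mulMor hx).comp p) (p.t h).hom where
  unit := by
    rw [comp_ec, comp_ec]
    change ((y.lc h y.one).inv ≫ y.mm h p.ec.hom p.ec.hom) ≫ (p.mc h x.one x.one).hom =
      p.ec.hom ≫ LinCat.map F (x.lc h x.one).inv
    -- In this factorisation the left unit law of `p` takes care of the second factor and naturality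
    -- of the left unitor of the first.
    have h₁ : y.mm h p.ec.hom p.ec.hom =
        y.mm h (𝟙 y.one) p.ec.hom ≫ y.mm h p.ec.hom (𝟙 (obj F x.one)) := by
      rw [← EnOb.mm_comp, Category.comp_id, Category.id_comp]
    have h₂ : LinCat.map F (x.lc h x.one).hom ≫ LinCat.map F (x.lc h x.one).inv = 𝟙 _ := by
      rw [← LinCat.map_comp, Iso.hom_inv_id, LinCat.map_id]
    have h₃ : y.mm h p.ec.hom (𝟙 (obj F x.one)) ≫ (p.mc h x.one x.one).hom =
        (y.lc h (obj F x.one)).hom ≫ LinCat.map F (x.lc h x.one).inv := by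
      rw [← hp.left h x.one, Category.assoc, Category.assoc, h₂, Category.comp_id]
    rw [h₁, Category.assoc, Category.assoc, h₃, sq (y.lc_nat h _), Iso.inv_hom_id_assoc]
  mul h X Y := by
    induction X using prInd with | h X₁ X₂ =>
    induction Y using prInd with | h Y₁ Y₂ =>
    simp only [comp_mc, tensor_mc, tensorHom_obj, EnOb.m_obj, comp_obj, mulMor_mc, EnOb.tensor_mul]
    exact (Category.assoc _ _ _).trans (mf_mc hx hy hp X₁ X₂ Y₁ Y₂)

end

end EnMor

/-! ### The canonical algebra, and passage to underlying linear structures. -/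

namespace EnLin

/-- The canonical `E_n`-algebra structure on a symmetric monoidal linear category, in the bicategory
of these. -/
def canon (n : ℕ∞) (S : EnLin.{v, u} ⊤ R) : EnOb n S where
  u := ⟨S.str.1.u, ⟨EnMor.unitMor S.str.1, EnMor.Laws.unitMor S.str.2⟩⟩
  m _ := ⟨S.str.1.m le_top, ⟨EnMor.mulMor S.str.2, EnMor.Laws.mulMor S.str.2⟩⟩
  a _ := TotalBicat.isoMk (S.str.1.a le_top) (EnMor.Two.mul_assoc S.str.2 le_top)
  l _ := TotalBicat.isoMk (S.str.1.l le_top) (EnMor.Two.one_mul S.str.2 le_top)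
  r _ := TotalBicat.isoMk (S.str.1.r le_top) (EnMor.Two.mul_one S.str.2 le_top)
  b _ _ := TotalBicat.isoMk (S.str.1.b le_top le_top) (EnMor.Two.mul_comm S.str.2 le_top le_top)

/-- The comparison of products of a symmetric monoidal functor, as a 2-cell of symmetric monoidal
categories. -/
def canonMul {S T : EnLin.{v, u} ⊤ R} (G : S ⟶ T) (h : 1 ≤ n) :
    tHom G G ≫ (canon n T).m h ≅ (canon n S).m h ≫ G :=
  TotalBicat.isoMk (G.str.1.t le_top) (EnMor.Two.map_mul S.str.2 T.str.2 G.str.2 le_top)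

end EnLin

/-- The `E_n`-algebra in linear categories underlying an `E_n`-algebra in symmetric monoidal linear
categories. -/
def EnOb.und {S : EnLin.{v, u} ⊤ R} (z : EnOb n S) : EnOb n S.base where
  u := z.u.base
  m h := (z.m h).base
  a h := TotalBicat.isoBase (z.a h)
  l h := TotalBicat.isoBase (z.l h)
  r h := TotalBicat.isoBase (z.r h)
  b h h' := TotalBicat.isoBase (z.b h h')

/-- The morphism of `E_n`-algebras in linear categories underlying one in symmetric monoidal linear
categories. -/
def EnMor.und {S T : EnLin.{v, u} ⊤ R} {z : EnOb n S} {w : EnOb n T} {G : S ⟶ T}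
    (p : EnMor z w G) : EnMor z.und w.und G.base where
  e := TotalBicat.isoBase p.e
  t h := TotalBicat.isoBase (p.t h)

theorem sq3_both {A : Type u} [Category.{v} A] {a b b' c c' d e : A} {f : a ⟶ b} {g : b ⟶ c}
    {k : c ⟶ d} {f' : a ⟶ b'} {g' : b' ⟶ c'} {k' : c' ⟶ d} (h : f ≫ g ≫ k = f' ≫ g' ≫ k')
    (m : d ⟶ e) : f ≫ g ≫ k ≫ m = f' ≫ g' ≫ k' ≫ m := by
  rw [sq3 h, Category.assoc, Category.assoc]

/-! ### The Eckmann–Hilton comparison -/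

namespace EnOb

/-- The product of isomorphisms. -/
def mmIso (x : EnOb n C) (h : 1 ≤ n) {X X' Y Y' : C} (f : X ≅ X') (g : Y ≅ Y') :
    x.mul h X Y ≅ x.mul h X' Y' where
  hom := x.mm h f.hom g.hom
  inv := x.mm h f.inv g.inv
  hom_inv_id := by rw [← mm_comp, Iso.hom_inv_id, Iso.hom_inv_id, mm_id]
  inv_hom_id := by rw [← mm_comp, Iso.inv_hom_id, Iso.inv_hom_id, mm_id]

@[simp] theorem mmIso_hom (x : EnOb n C) (h : 1 ≤ n) {X X' Y Y' : C} (f : X ≅ X') (g : Y ≅ Y') :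
    (x.mmIso h f g).hom = x.mm h f.hom g.hom := rfl

/-- A second product on a symmetric monoidal category that is a symmetric monoidal functor, with
monoidal unitors. -/
structure Interchange (s : EnOb ⊤ C) (y : EnOb n C) (h : 1 ≤ n) where
  /-- the comparison of units -/
  υ : s.one ≅ y.one
  /-- the product of the second unit with itself -/
  ν : s.mul le_top y.one y.one ≅ y.one
  /-- the second product as a monoidal functor -/
  q : EnMor (s.tensor s) s (y.m h)
  laws : q.Laws
  -- Origin of these conditions: `unit_left` is the left unit law of the monoidal functor that picks
  -- out the second unit. The others say that the unitors of the second product are monoidal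
  -- transformations: `left_unit` and `right_unit` on units, `left_mul` and `right_mul` on products.
  unit_left : s.mm le_top υ.hom (𝟙 y.one) ≫ ν.hom = (s.lc le_top y.one).hom
  left_unit : q.ec.hom ≫ y.mm h υ.hom (𝟙 s.one) ≫ (y.lc h s.one).hom = 𝟙 s.one
  right_unit : q.ec.hom ≫ y.mm h (𝟙 s.one) υ.hom ≫ (y.rc h s.one).hom = 𝟙 s.one
  left_mul : ∀ X Y : C, (q.mc le_top (pr y.one X) (pr y.one Y)).hom ≫
    y.mm h ν.hom (𝟙 (s.mul le_top X Y)) ≫ (y.lc h (s.mul le_top X Y)).hom =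
      s.mm le_top (y.lc h X).hom (y.lc h Y).hom
  right_mul : ∀ X Y : C, (q.mc le_top (pr X y.one) (pr Y y.one)).hom ≫
    y.mm h (𝟙 (s.mul le_top X Y)) ν.hom ≫ (y.rc h (s.mul le_top X Y)).hom =
      s.mm le_top (y.rc h X).hom (y.rc h Y).hom

/-! ### Eckmann–Hilton: the comparison c, its unit laws and its monoidality. -/

namespace Interchange

variable {s : EnOb ⊤ C} {y : EnOb n C} {h : 1 ≤ n} (d : Interchange s y h)

/-- The interchange of the two products. -/
def i (X Y Z W : C) : s.mul le_top (y.mul h X Y) (y.mul h Z W) ≅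
    y.mul h (s.mul le_top X Z) (s.mul le_top Y W) := d.q.mc le_top (pr X Y) (pr Z W)

theorem i_nat {X X' Y Y' Z Z' W W' : C} (f : X ⟶ X') (g : Y ⟶ Y') (f' : Z ⟶ Z') (g' : W ⟶ W') :
    s.mm le_top (y.mm h f g) (y.mm h f' g') ≫ (d.i X' Y' Z' W').hom =
      (d.i X Y Z W).hom ≫ y.mm h (s.mm le_top f f') (s.mm le_top g g') :=
  d.q.mc_nat le_top (tm f g) (tm f' g')

/-- The right unitor of the first product with respect to the second unit. -/
def ρ (X : C) : s.mul le_top X y.one ≅ X := s.mmIso le_top (Iso.refl X) d.υ.symm ≪≫ s.rc le_top X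

/-- The left unitor of the first product with respect to the second unit. -/
def lam (X : C) : s.mul le_top y.one X ≅ X := s.mmIso le_top d.υ.symm (Iso.refl X) ≪≫ s.lc le_top X

theorem ρ_hom (X : C) : (d.ρ X).hom = s.mm le_top (𝟙 X) d.υ.inv ≫ (s.rc le_top X).hom := rfl
theorem lam_hom (X : C) : (d.lam X).hom = s.mm le_top d.υ.inv (𝟙 X) ≫ (s.lc le_top X).hom := rfl

theorem ρ_nat {X Y : C} (f : X ⟶ Y) :
    s.mm le_top f (𝟙 y.one) ≫ (d.ρ Y).hom = (d.ρ X).hom ≫ f := by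
  rw [ρ_hom, ρ_hom, Category.assoc, ← s.rc_nat, ← Category.assoc, ← Category.assoc, ← mm_comp,
    ← mm_comp, Category.comp_id, Category.id_comp, Category.comp_id, Category.id_comp]

theorem lam_nat {X Y : C} (f : X ⟶ Y) :
    s.mm le_top (𝟙 y.one) f ≫ (d.lam Y).hom = (d.lam X).hom ≫ f := by
  rw [lam_hom, lam_hom, Category.assoc, ← s.lc_nat, ← Category.assoc, ← Category.assoc, ← mm_comp,
    ← mm_comp, Category.comp_id, Category.id_comp, Category.comp_id, Category.id_comp]

/-- The comparison of the two products. -/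
def c (X Y : C) : s.mul le_top X Y ≅ y.mul h X Y :=
  -- Write · for the product of `s`, ∗ for that of `y` and 1' for the unit of `y`. The three factors
  -- are X · Y ≅ (X ∗ 1') · (1' ∗ Y) ≅ (X · 1') ∗ (1' · Y) ≅ X ∗ Y.
  (s.mmIso le_top (y.rc h X) (y.lc h Y)).symm ≪≫ d.i X y.one y.one Y ≪≫
    y.mmIso h (d.ρ X) (d.lam Y)

theorem c_hom (X Y : C) : (d.c X Y).hom = s.mm le_top (y.rc h X).inv (y.lc h Y).inv ≫
    (d.i X y.one y.one Y).hom ≫ y.mm h (d.ρ X).hom (d.lam Y).hom := rfl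

/-- Clears the inverse unitors from `c`. Naturality and monoidality of `c` are proved by first
composing with this invertible product of unitors, so that only forward unitors occur. -/
theorem mm_c (X Y : C) : s.mm le_top (y.rc h X).hom (y.lc h Y).hom ≫ (d.c X Y).hom =
    (d.i X y.one y.one Y).hom ≫ y.mm h (d.ρ X).hom (d.lam Y).hom :=
  (s.mmIso le_top (y.rc h X) (y.lc h Y)).hom_inv_id_assoc _

theorem c_nat {X X' Y Y' : C} (f : X ⟶ X') (g : Y ⟶ Y') :
    s.mm le_top f g ≫ (d.c X' Y').hom = (d.c X Y).hom ≫ y.mm h f g := by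
  rw [← cancel_epi (s.mmIso le_top (y.rc h X) (y.lc h Y)).hom, mmIso_hom]
  rw [← Category.assoc, ← mm_comp, ← rc_nat, ← lc_nat, mm_comp, Category.assoc, mm_c,
    ← Category.assoc, i_nat, ← Category.assoc (s.mm _ _ _) (d.c X Y).hom, mm_c, Category.assoc,
    Category.assoc, ← mm_comp, ← mm_comp, ρ_nat, lam_nat]

-- With this, υ is a homomorphism for the multiplications λ on the first unit and ν on the second.
-- It follows from `unit_left` by writing υ · υ as 1 · υ followed by υ · 1.
include d in
theorem unit_one : s.mm le_top d.υ.hom d.υ.hom ≫ d.ν.hom =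
    (s.lc le_top s.one).hom ≫ d.υ.hom := by
  rw [← s.lc_nat, ← d.unit_left, ← Category.assoc, ← mm_comp, Category.id_comp, Category.comp_id]

/-- The comparison of the first unit with its second product with itself. -/
def ec : s.one ≅ y.mul h s.one s.one := d.q.ec

theorem ec_left : d.ec.hom ≫ y.mm h d.υ.hom (𝟙 s.one) ≫ (y.lc h s.one).hom = 𝟙 s.one := d.left_unit

theorem ec_right : d.ec.hom ≫ y.mm h (𝟙 s.one) d.υ.hom ≫ (y.rc h s.one).hom = 𝟙 s.one :=
  d.right_unit

theorem i_ν (X Y : C) : (d.i y.one X y.one Y).hom ≫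
    y.mm h d.ν.hom (𝟙 (s.mul le_top X Y)) ≫ (y.lc h (s.mul le_top X Y)).hom =
      s.mm le_top (y.lc h X).hom (y.lc h Y).hom := d.left_mul X Y

theorem i_ν' (X Y : C) : (d.i X y.one Y y.one).hom ≫
    y.mm h (𝟙 (s.mul le_top X Y)) d.ν.hom ≫ (y.rc h (s.mul le_top X Y)).hom =
      s.mm le_top (y.rc h X).hom (y.rc h Y).hom := d.right_mul X Y

/-- The monoidality of the unitor on units exhibits its inverse at the first unit. In `c_right` and
`c_left` this replaces the inverse unitor by the unit comparison of the functor `q`, to which the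
unit laws of `q` apply. -/
theorem rc_inv : (y.rc h s.one).inv = d.ec.hom ≫ y.mm h (𝟙 s.one) d.υ.hom := by
  rw [← cancel_mono (y.rc h s.one).hom, Iso.inv_hom_id, Category.assoc, d.ec_right]

theorem lc_inv : (y.lc h s.one).inv = d.ec.hom ≫ y.mm h d.υ.hom (𝟙 s.one) := by
  rw [← cancel_mono (y.lc h s.one).hom, Iso.inv_hom_id, Category.assoc, d.ec_left]

theorem i_left (X Y : C) : s.mm le_top d.ec.hom (𝟙 (y.mul h X Y)) ≫ (d.i s.one s.one X Y).hom ≫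
    y.mm h (s.lc le_top X).hom (s.lc le_top Y).hom = (s.lc le_top (y.mul h X Y)).hom :=
  d.laws.left le_top (pr X Y)

theorem i_right (X Y : C) : s.mm le_top (𝟙 (y.mul h X Y)) d.ec.hom ≫ (d.i X Y s.one s.one).hom ≫
    y.mm h (s.rc le_top X).hom (s.rc le_top Y).hom = (s.rc le_top (y.mul h X Y)).hom :=
  d.laws.right le_top (pr X Y)

/-- The two unitors of the first product agree at 1. Exchanging them brings the last factor of `c`
into the form in which the left unit law of `q` ends. -/
theorem ρ_one (hs : s.Laws) : (d.ρ s.one).hom = (s.lc le_top y.one).hom ≫ d.υ.inv := by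
  rw [ρ_hom, ← lc_one_eq_rc_one hs, lc_nat]

theorem lam_one (hs : s.Laws) : (d.lam s.one).hom = (s.rc le_top y.one).hom ≫ d.υ.inv := by
  rw [lam_hom, lc_one_eq_rc_one hs, rc_nat]

theorem υ_lam (X : C) : s.mm le_top d.υ.hom (𝟙 X) ≫ (d.lam X).hom = (s.lc le_top X).hom := by
  rw [lam_hom, ← Category.assoc, ← mm_comp, Iso.hom_inv_id, Category.comp_id, mm_id,
    Category.id_comp]

theorem υ_ρ (X : C) : s.mm le_top (𝟙 X) d.υ.hom ≫ (d.ρ X).hom = (s.rc le_top X).hom := by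
  rw [ρ_hom, ← Category.assoc, ← mm_comp, Iso.hom_inv_id, Category.comp_id, mm_id,
    Category.id_comp]

/-- By `rc_inv` the inverse unitor at 1 becomes the unit comparison of `q` followed by 1 ∗ υ.
Naturality of the interchange moves υ to the right, where it merges with ρ and `lam` into left
unitors. Then the left unit law of `q`, `i_left`, collapses the whole composite to a left unitor. -/
theorem c_left (hs : s.Laws) (X : C) : (d.c s.one X).hom ≫ y.mm h d.υ.hom (𝟙 X) ≫ (y.lc h X).hom =
    (s.lc le_top X).hom := by
  have h₁ : s.mm le_top (y.rc h s.one).inv (y.lc h X).inv =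
      s.mm le_top (𝟙 s.one) (y.lc h X).inv ≫ s.mm le_top d.ec.hom (𝟙 (y.mul h y.one X)) ≫
        s.mm le_top (y.mm h (𝟙 s.one) d.υ.hom) (y.mm h (𝟙 y.one) (𝟙 X)) := by
    rw [← mm_comp, ← mm_comp, rc_inv, mm_id, Category.comp_id, Category.comp_id, Category.id_comp]
  have h₂ : y.mm h (s.mm le_top (𝟙 s.one) (𝟙 y.one)) (s.mm le_top d.υ.hom (𝟙 X)) ≫
      y.mm h (d.ρ s.one).hom (d.lam X).hom ≫ y.mm h d.υ.hom (𝟙 X) =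
        y.mm h (s.lc le_top y.one).hom (s.lc le_top X).hom := by
    rw [← mm_comp, ← mm_comp, mm_id, Category.id_comp, ρ_one d hs, Category.comp_id, υ_lam,
      Category.assoc, Iso.inv_hom_id, Category.comp_id]
  rw [c_hom, h₁]
  simp only [Category.assoc]
  rw [sq (d.i_nat _ _ _ _), sq3 h₂, sq3 (d.i_left _ _), ← s.lc_nat, ← Category.assoc, ← mm_comp,
    Iso.inv_hom_id, Category.comp_id, mm_id, Category.id_comp]

theorem c_right (hs : s.Laws) (X : C) : (d.c X s.one).hom ≫ y.mm h (𝟙 X) d.υ.hom ≫ (y.rc h X).hom =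
    (s.rc le_top X).hom := by
  have h₁ : s.mm le_top (y.rc h X).inv (y.lc h s.one).inv =
      s.mm le_top (y.rc h X).inv (𝟙 s.one) ≫ s.mm le_top (𝟙 (y.mul h X y.one)) d.ec.hom ≫
        s.mm le_top (y.mm h (𝟙 X) (𝟙 y.one)) (y.mm h d.υ.hom (𝟙 s.one)) := by
    rw [← mm_comp, ← mm_comp, lc_inv, mm_id, Category.comp_id, Category.comp_id, Category.id_comp]
  have h₂ : y.mm h (s.mm le_top (𝟙 X) d.υ.hom) (s.mm le_top (𝟙 y.one) (𝟙 s.one)) ≫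
      y.mm h (d.ρ X).hom (d.lam s.one).hom ≫ y.mm h (𝟙 X) d.υ.hom =
        y.mm h (s.rc le_top X).hom (s.rc le_top y.one).hom := by
    rw [← mm_comp, ← mm_comp, mm_id, Category.id_comp, lam_one d hs, Category.comp_id, υ_ρ,
      Category.assoc, Iso.inv_hom_id, Category.comp_id]
  rw [c_hom, h₁]
  simp only [Category.assoc]
  rw [sq (d.i_nat _ _ _ _), sq3 h₂, sq3 (d.i_right _ _), ← s.rc_nat, ← Category.assoc, ← mm_comp,
    Iso.inv_hom_id, Category.comp_id, mm_id, Category.id_comp]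

/-- This is the unit half of the monoidality of `c`. By `c_left`, the left unitor at 1 is `c`
followed by υ ∗ 1 and the left unitor of the second product. It remains to see that these last two
maps are inverse to the unit comparison of `q`, and that is `ec_left`. -/
theorem c_unit (hs : s.Laws) : (s.lc le_top s.one).inv ≫ (d.c s.one s.one).hom = d.ec.hom := by
  rw [Iso.inv_comp_eq, ← d.c_left hs]
  refine (Category.comp_id _).symm.trans ?_
  simp only [Category.assoc]
  congr 1
  rw [← cancel_mono ((y.mmIso h d.υ (Iso.refl s.one)).hom ≫ (y.lc h s.one).hom), mmIso_hom,
    Iso.refl_hom]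
  simp only [Category.assoc]
  rw [d.ec_left, Category.comp_id, Category.id_comp]

include d in
theorem ν_υ : d.ν.hom ≫ d.υ.inv =
    s.mm le_top d.υ.inv d.υ.inv ≫ (s.lc le_top s.one).hom := by
  rw [← cancel_epi (s.mmIso le_top d.υ d.υ).hom, mmIso_hom, ← Category.assoc, d.unit_one,
    Category.assoc, Iso.hom_inv_id, Category.comp_id, ← Category.assoc, ← mm_comp, Iso.hom_inv_id,
    mm_id, Category.id_comp]

/-- The right unitor is monoidal by `mf_rc`; here the first unit is replaced by the second along υ,
and `ν_υ` turns the multiplication ν into the left unitor at 1. -/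
theorem ρ_mul (hs : s.Laws) (X Y : C) : (mf hs X y.one Y y.one).hom ≫
    s.mm le_top (𝟙 _) d.ν.hom ≫ (d.ρ (s.mul le_top X Y)).hom =
      s.mm le_top (d.ρ X).hom (d.ρ Y).hom := by
  have h₁ : s.mm le_top (𝟙 (s.mul le_top X Y)) d.ν.hom ≫ s.mm le_top (𝟙 _) d.υ.inv =
      s.mm le_top (s.mm le_top (𝟙 X) (𝟙 Y)) (s.mm le_top d.υ.inv d.υ.inv) ≫
        s.mm le_top (𝟙 (s.mul le_top X Y)) (s.lc le_top s.one).hom := by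
    rw [← mm_comp, d.ν_υ, ← mm_comp, mm_id]
  rw [ρ_hom, sq h₁, ← sq (mf_nat hs _ _ _ _), mf_rc, ← mm_comp, ← ρ_hom, ← ρ_hom]

theorem lam_mul (hs : s.Laws) (X Y : C) : (mf hs y.one X y.one Y).hom ≫
    s.mm le_top d.ν.hom (𝟙 _) ≫ (d.lam (s.mul le_top X Y)).hom =
      s.mm le_top (d.lam X).hom (d.lam Y).hom := by
  have h₁ : s.mm le_top d.ν.hom (𝟙 (s.mul le_top X Y)) ≫ s.mm le_top d.υ.inv (𝟙 _) =
      s.mm le_top (s.mm le_top d.υ.inv d.υ.inv) (s.mm le_top (𝟙 X) (𝟙 Y)) ≫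
        s.mm le_top (s.lc le_top s.one).hom (𝟙 (s.mul le_top X Y)) := by
    rw [← mm_comp, d.ν_υ, ← mm_comp, mm_id]
  rw [lam_hom, sq h₁, ← sq (mf_nat hs _ _ _ _), mf_lc, ← mm_comp, ← lam_hom, ← lam_hom]

/-- The second product is a symmetric monoidal functor on the tensor square, hence respects the
interchange by `mf_mc`. The interchange of the tensor square is componentwise, which gives the last
factor on the right. -/
theorem mf_i (hs : s.Laws) (A B A' B' : C) {X Y Z W : C} :
    (mf hs (y.mul h A A') (y.mul h B B') (y.mul h X Z) (y.mul h Y W)).hom ≫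
      s.mm le_top (d.i A A' X Z).hom (d.i B B' Y W).hom ≫
        (d.i (s.mul le_top A X) (s.mul le_top A' Z) (s.mul le_top B Y) (s.mul le_top B' W)).hom =
      s.mm le_top (d.i A A' B B').hom (d.i X Z Y W).hom ≫
        (d.i (s.mul le_top A B) (s.mul le_top A' B') (s.mul le_top X Y) (s.mul le_top Z W)).hom ≫
          y.mm h (mf hs A B X Y).hom (mf hs A' B' Z W).hom :=
  EnMor.mf_mc (hs.tensor hs) hs d.laws (pr A A') (pr B B') (pr X Z) (pr Y W)

/-- Each of the three factors of `c` is monoidal: the unitors of the second product by `i_ν'` and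
`i_ν`, the interchange by `mf_i`, and ρ and `lam` by `ρ_mul` and `lam_mul`. This is the property
that lets the remaining coherence be checked at units only. -/
theorem c_mul (hs : s.Laws) (A B A' B' : C) :
    (mf hs A B A' B').hom ≫ (d.c (s.mul le_top A A') (s.mul le_top B B')).hom =
      s.mm le_top (d.c A B).hom (d.c A' B').hom ≫ (d.i A B A' B').hom := by
  rw [← cancel_epi (s.mmIso le_top (s.mmIso le_top (y.rc h A) (y.lc h B))
    (s.mmIso le_top (y.rc h A') (y.lc h B'))).hom, mmIso_hom, mmIso_hom, mmIso_hom,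
    sq (mf_nat hs _ _ _ _), ← d.i_ν', ← d.i_ν, ← Category.assoc (s.mm _ _ _) (s.mm _ _ _),
    ← mm_comp, d.mm_c, d.mm_c, mm_comp, mm_comp, mm_comp, Category.assoc, Category.assoc,
    Category.assoc, d.mm_c, sq (d.i_nat _ _ _ _), d.i_nat, ← d.ρ_mul hs, ← d.lam_mul hs,
    mm_comp, mm_comp]
  -- Once all unitors are on the outside, the interchange identity remains for the eight objects A,
  -- 1', 1', B and A', 1', 1', B'.
  exact sq3_both (d.mf_i hs A y.one y.one B (X := A') (Y := y.one) (Z := y.one) (W := B')) _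

end Interchange

end EnOb

/-! ### Monoidal transformations of functors on a tensor product -/

/-- The image of an isomorphism under a linear functor. -/
def LinCat.mapIso (F : C ⟶ D) {X Y : C} (e : X ≅ Y) : obj F X ≅ obj F Y where
  hom := LinCat.map F e.hom
  inv := LinCat.map F e.inv
  hom_inv_id := by rw [← LinCat.map_comp, Iso.hom_inv_id, LinCat.map_id]
  inv_hom_id := by rw [← LinCat.map_comp, Iso.inv_hom_id, LinCat.map_id]

@[simp] theorem LinCat.mapIso_hom (F : C ⟶ D) {X Y : C} (e : X ≅ Y) :
    (LinCat.mapIso F e).hom = LinCat.map F e.hom := rfl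

/-- Naturality along an isomorphism expresses one component by the other. With this, agreement at an
object isomorphic to a product is as good as agreement at the product. -/
theorem LinCat.app_eq_of_iso {F G : C ⟶ D} {s t : F ⟶ G} {X Y : C} (e : X ≅ Y)
    (h : app s X = app t X) : app s Y = app t Y := by
  have h₁ : LinCat.map F e.inv ≫ LinCat.map F e.hom = 𝟙 _ := by
    rw [← LinCat.map_comp, Iso.inv_hom_id, LinCat.map_id]
  rw [← Category.id_comp (app s Y), ← Category.id_comp (app t Y), ← h₁, Category.assoc,
    Category.assoc, naturality, naturality, h]

namespace EnMor

theorem Two.app_mul_eq {x : EnOb n C} {y : EnOb n D} {F G : C ⟶ D} {p : EnMor x y F}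
    {q : EnMor x y G} {s t : F ⟶ G} (hs : Two p q s) (ht : Two p q t) (h : 1 ≤ n) {X Y : C}
    (hX : app s X = app t X) (hY : app s Y = app t Y) :
    app s (x.mul h X Y) = app t (x.mul h X Y) := by
  rw [← cancel_epi (p.mc h X Y).hom, hs.mul, ht.mul, hX, hY]

/-- Monoidal transformations of functors of two variables agree if they agree on pairs of which one
entry is the unit. -/
theorem Two.ext_tensor {x : EnOb n C} {y : EnOb n D} {z : EnOb n E} {F G : LinCat.tensor C D ⟶ E}
    {p : EnMor (x.tensor y) z F} {q : EnMor (x.tensor y) z G} {s t : F ⟶ G} (hs : Two p q s)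
    (ht : Two p q t) (h : 1 ≤ n) {A : C} {B : D} (e : A ≅ x.one) (e' : B ≅ y.one)
    (h₁ : ∀ X, app s (pr X B) = app t (pr X B)) (h₂ : ∀ Y, app s (pr A Y) = app t (pr A Y)) :
    s = t := by
  ext P
  induction P using prInd with | h X Y =>
  -- The componentwise product of (X, 1) and (1, Y) is (X ⊗ 1, 1 ⊗ Y), which the unitors identify
  -- with (X, Y). Allowing `A` and `B` to be only isomorphic to the units makes it possible to test
  -- at the unit of the other product.
  exact app_eq_of_iso (tmIso (x.rc h X) (y.lc h Y)) (Two.app_mul_eq hs ht h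
    (app_eq_of_iso (tmIso (Iso.refl X) e') (h₁ X)) (app_eq_of_iso (tmIso e (Iso.refl Y)) (h₂ Y)))

theorem Two.tensor {C' D' : LinCat.{v, u} R} {x : EnOb n C} {x' : EnOb n C'} {y : EnOb n D}
    {y' : EnOb n D'} {F F' : C ⟶ C'} {G G' : D ⟶ D'} {p : EnMor x x' F} {p' : EnMor x x' F'}
    {q : EnMor y y' G} {q' : EnMor y y' G'} {s : F ≅ F'} {t : G ≅ G'} (hs : Two p p' s.hom)
    (ht : Two q q' t.hom) : Two (p.tensor q) (p'.tensor q') (tensorIso s t).hom where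
  unit := congrArg₂ tm hs.unit ht.unit
  mul h X Y := congrArg₂ tm (hs.mul h (fst X) (fst Y)) (ht.mul h (snd X) (snd Y))

end EnMor

/-! ### `E_n`-algebras in symmetric monoidal linear categories -/

namespace EnOb

variable {S T : EnLin.{v, u} ⊤ R} (z : EnOb n S)

/-- The interchange of the two products of an `E_n`-algebra in symmetric monoidal linear
categories. -/
def inter (h : 1 ≤ n) : Interchange S.str.1 z.und h where
  υ := z.u.str.1.ec
  ν := z.u.str.1.mc le_top pt pt
  q := (z.m h).str.1
  laws := (z.m h).str.2
  unit_left := by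
    have h₁ := z.u.str.2.left le_top pt
    have h₂ : LinCat.map z.u.base ((EnOb.unit ⊤ R).lc le_top pt).hom = 𝟙 z.und.one :=
      LinCat.map_id z.u.base pt
    exact (congrArg (S.str.1.mm le_top z.u.str.1.ec.hom (𝟙 z.und.one) ≫ ·)
      ((congrArg ((z.u.str.1.mc le_top pt pt).hom ≫ ·) h₂).trans (Category.comp_id _))).symm.trans h₁
  left_unit := by
    -- The unitors of `z` are 2-cells of symmetric monoidal categories, hence monoidal
    -- transformations. The unit half of this is used here and the product half in `left_mul`;
    -- likewise on the right.
    have h₁ := (z.l h).hom.prop.unit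
    exact (Category.assoc _ _ _).symm.trans ((congrArg (· ≫ _)
      (EnMor.comp_ec (z.u.str.1.tensor (EnMor.id S.str.1)) (z.m h).str.1).symm).trans h₁)
  right_unit := by
    have h₁ := (z.r h).hom.prop.unit
    exact (Category.assoc _ _ _).symm.trans ((congrArg (· ≫ _)
      (EnMor.comp_ec ((EnMor.id S.str.1).tensor z.u.str.1) (z.m h).str.1).symm).trans h₁)
  left_mul X Y := by
    have h₁ := (z.l h).hom.prop.mul le_top (pr pt X) (pr pt Y)
    have h₂ := EnMor.comp_mc (z.u.str.1.tensor (EnMor.id S.str.1)) (z.m h).str.1 le_top (pr pt X)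
      (pr pt Y)
    rw [EnMor.tensor_mc, EnMor.id_mc] at h₂
    exact (Category.assoc _ _ _).symm.trans ((congrArg (· ≫ _) h₂.symm).trans
      (h₁.trans (Category.comp_id _)))
  right_mul X Y := by
    have h₁ := (z.r h).hom.prop.mul le_top (pr X pt) (pr Y pt)
    have h₂ := EnMor.comp_mc ((EnMor.id S.str.1).tensor z.u.str.1) (z.m h).str.1 le_top (pr X pt)
      (pr Y pt)
    rw [EnMor.tensor_mc, EnMor.id_mc] at h₂
    exact (Category.assoc _ _ _).symm.trans ((congrArg (· ≫ _) h₂.symm).trans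
      (h₁.trans (Category.comp_id _)))

/-- The comparison of units. -/
def ucmp : S.str.1.one ≅ z.und.one := z.u.str.1.ec

/-- The comparison of products. -/
def mcmp (h : 1 ≤ n) (X Y : S.base) : S.str.1.mul le_top X Y ≅ z.und.mul h X Y := (z.inter h).c X Y

theorem mcmp_nat (h : 1 ≤ n) {X X' Y Y' : S.base} (f : X ⟶ X') (g : Y ⟶ Y') :
    S.str.1.mm le_top f g ≫ (z.mcmp h X' Y').hom = (z.mcmp h X Y).hom ≫ z.und.mm h f g :=
  (z.inter h).c_nat f g

/-- `c_left` is stated at the first unit; naturality of the comparison carries it to the second. In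
this form it is a unit law of a monoidal functor. -/
theorem mcmp_left (h : 1 ≤ n) (X : S.base) : S.str.1.mm le_top z.ucmp.hom (𝟙 X) ≫
    (z.mcmp h z.und.one X).hom ≫ (z.und.lc h X).hom = (S.str.1.lc le_top X).hom := by
  rw [sq (z.mcmp_nat h _ _)]
  exact (z.inter h).c_left S.str.2 X

theorem mcmp_right (h : 1 ≤ n) (X : S.base) : S.str.1.mm le_top (𝟙 X) z.ucmp.hom ≫
    (z.mcmp h X z.und.one).hom ≫ (z.und.rc h X).hom = (S.str.1.rc le_top X).hom := by
  rw [sq (z.mcmp_nat h _ _)]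
  exact (z.inter h).c_right S.str.2 X

/-- The comparison of products as a transformation. -/
def mcell (h : 1 ≤ n) : S.str.1.m le_top ≅ z.und.m h :=
  LinCat.isoMk (fun P => z.mcmp h (fst P) (snd P))
    (nat_tensor (F := S.str.1.m le_top) (G := z.und.m h) (fun P => (z.mcmp h (fst P) (snd P)).hom)
      fun f g => z.mcmp_nat h f g)

/-- Makes the comparison a 2-cell of symmetric monoidal categories. It may then be whiskered and
composed with the structural 2-cells of `z`, and the composites are again subject to
`Two.ext_tensor`. -/
theorem mcell_two (h : 1 ≤ n) :
    EnMor.Two (EnMor.mulMor S.str.2) (z.m h).str.1 (z.mcell h).hom where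
  unit := (z.inter h).c_unit S.str.2
  mul _ X Y := (z.inter h).c_mul S.str.2 (fst X) (snd X) (fst Y) (snd Y)

/-! ### The comparison of products respects associators and braidings. -/

variable {z} (hz : z.und.Laws)
include hz

/-- With the unit in the last place, right unitors can be composed on both sides. By `rc_mul` for
either product and `mcmp_right`, both sides then reduce to naturality statements. The next lemma
does the same with the unit in the first place and left unitors. -/
theorem mcmp_assoc_right (h : 1 ≤ n) (X Y : S.base) :
    S.str.1.mm le_top (z.mcmp h X Y).hom (𝟙 z.und.one) ≫
      (z.mcmp h (z.und.mul h X Y) z.und.one).hom ≫ (z.und.ac h X Y z.und.one).hom =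
        (S.str.1.ac le_top X Y z.und.one).hom ≫
          S.str.1.mm le_top (𝟙 X) (z.mcmp h Y z.und.one).hom ≫
            (z.mcmp h X (z.und.mul h Y z.und.one)).hom := by
  have h₁ : S.str.1.mm le_top (𝟙 X) (S.str.1.mm le_top (𝟙 Y) z.ucmp.hom) ≫
      S.str.1.mm le_top (𝟙 X) (z.mcmp h Y z.und.one).hom ≫
        S.str.1.mm le_top (𝟙 X) (z.und.rc h Y).hom =
      S.str.1.mm le_top (𝟙 X) (S.str.1.rc le_top Y).hom := by
    rw [← mm_right, ← mm_right, mcmp_right]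
  rw [← cancel_epi (S.str.1.mmIso le_top (Iso.refl (S.str.1.mul le_top X Y)) z.ucmp).hom,
    ← cancel_mono (z.und.mmIso h (Iso.refl X) (z.und.rc h Y)).hom, mmIso_hom, mmIso_hom,
    Iso.refl_hom, Iso.refl_hom]
  simp only [Category.assoc]
  rw [← mcmp_nat, rc_mul hz, ← Category.assoc, ← mm_comp, Category.id_comp, Category.comp_id,
    ← Category.comp_id (z.mcmp h X Y).hom, ← Category.id_comp z.ucmp.hom, mm_comp, Category.assoc,
    Category.comp_id, mcmp_right, rc_nat, ← mm_id le_top, sq (ac_nat le_top _ _ _),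
    Category.id_comp, sq3 h₁, ← Category.assoc, rc_mul S.str.2]

theorem mcmp_assoc_left (h : 1 ≤ n) (Y Z : S.base) :
    S.str.1.mm le_top (z.mcmp h z.und.one Y).hom (𝟙 Z) ≫
      (z.mcmp h (z.und.mul h z.und.one Y) Z).hom ≫ (z.und.ac h z.und.one Y Z).hom =
        (S.str.1.ac le_top z.und.one Y Z).hom ≫
          S.str.1.mm le_top (𝟙 z.und.one) (z.mcmp h Y Z).hom ≫
            (z.mcmp h z.und.one (z.und.mul h Y Z)).hom := by
  have h₁ : S.str.1.mm le_top (S.str.1.mm le_top z.ucmp.hom (𝟙 Y)) (𝟙 Z) ≫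
      S.str.1.mm le_top (z.mcmp h z.und.one Y).hom (𝟙 Z) ≫
        S.str.1.mm le_top (z.und.lc h Y).hom (𝟙 Z) =
      S.str.1.mm le_top (S.str.1.lc le_top Y).hom (𝟙 Z) := by
    rw [← mm_left, ← mm_left, mcmp_left]
  rw [← cancel_epi (S.str.1.mmIso le_top (S.str.1.mmIso le_top z.ucmp (Iso.refl Y))
      (Iso.refl Z)).hom, ← cancel_mono (z.und.lc h (z.und.mul h Y Z)).hom, mmIso_hom, mmIso_hom,
    Iso.refl_hom, Iso.refl_hom]
  simp only [Category.assoc]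
  have h₂ : S.str.1.mm le_top z.ucmp.hom (𝟙 (S.str.1.mul le_top Y Z)) ≫
      S.str.1.mm le_top (𝟙 z.und.one) (z.mcmp h Y Z).hom =
      S.str.1.mm le_top (𝟙 S.str.1.one) (z.mcmp h Y Z).hom ≫
        S.str.1.mm le_top z.ucmp.hom (𝟙 (z.und.mul h Y Z)) := by
    rw [← mm_comp, ← mm_comp, Category.id_comp, Category.comp_id, Category.id_comp,
      Category.comp_id]
  rw [lc_mul hz, ← mcmp_nat, sq3 h₁, sq (ac_nat le_top _ _ _), mm_id, sq h₂, mcmp_left, lc_nat,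
    ← Category.assoc, lc_mul S.str.2]

/-- Each side is the component of a monoidal transformation, composed of whiskered copies of the
comparison and an associator of one of the two products. As functors of the pair (X, Y) and of Z
they have two variables, so it suffices to compare them at units. -/
theorem mcmp_assoc (h : 1 ≤ n) (X Y Z : S.base) :
    S.str.1.mm le_top (z.mcmp h X Y).hom (𝟙 Z) ≫ (z.mcmp h (z.und.mul h X Y) Z).hom ≫
      (z.und.ac h X Y Z).hom = (S.str.1.ac le_top X Y Z).hom ≫
        S.str.1.mm le_top (𝟙 X) (z.mcmp h Y Z).hom ≫ (z.mcmp h X (z.und.mul h Y Z)).hom := by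
  have hs := ((EnMor.Two.whiskerRight (EnMor.mulMor S.str.2) (EnMor.Two.tensor (z.mcell_two h)
    (t := Iso.refl (𝟙 S.base)) (EnMor.Two.id (EnMor.id S.str.1)))).comp
      (EnMor.Two.whiskerLeft ((z.m h).str.1.tensor (EnMor.id S.str.1)) (z.mcell_two h))).comp
        (z.a h).hom.prop
  have ht := ((EnMor.Two.mul_assoc S.str.2 le_top).comp
    (EnMor.Two.whiskerLeft (EnMor.assoc S.str.1 S.str.1 S.str.1)
      (EnMor.Two.whiskerRight (EnMor.mulMor S.str.2) (EnMor.Two.tensor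
        (s := Iso.refl (𝟙 S.base)) (EnMor.Two.id (EnMor.id S.str.1)) (z.mcell_two h))))).comp
      (EnMor.Two.whiskerLeft (EnMor.assoc S.str.1 S.str.1 S.str.1)
        (EnMor.Two.whiskerLeft ((EnMor.id S.str.1).tensor (z.m h).str.1) (z.mcell_two h)))
  -- The unit of the first variable is the pair of units, so what has to be checked is Z = 1' with
  -- (X, Y) arbitrary, and X = Y = 1' with Z arbitrary.
  have h₁ := EnMor.Two.ext_tensor hs ht le_top (A := pr z.und.one z.und.one) (B := z.und.one)
    (tmIso z.ucmp.symm z.ucmp.symm) z.ucmp.symm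
    (fun P => (Category.assoc _ _ _).trans ((mcmp_assoc_right hz h (fst P) (snd P)).trans
      (Category.assoc _ _ _).symm))
    (fun Z => (Category.assoc _ _ _).trans ((mcmp_assoc_left hz h z.und.one Z).trans
      (Category.assoc _ _ _).symm))
  exact (Category.assoc _ _ _).symm.trans ((congrArg (app · (pr (pr X Y) Z)) h₁).trans
    (Category.assoc _ _ _))

/-- Both composites are monoidal transformations from the first product to the opposite of the
second. At a unit each braiding turns one unitor into the other, and `mcmp_left` and `mcmp_right`
compare the unitors. -/
theorem mcmp_braid (h : 1 ≤ n) (h' : 2 ≤ n) (X Y : S.base) :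
    (z.mcmp h X Y).hom ≫ (z.und.bc h h' X Y).hom =
      (S.str.1.bc le_top le_top X Y).hom ≫ (z.mcmp h Y X).hom := by
  have hs := (z.mcell_two h).comp (z.b h h').hom.prop
  have ht := (EnMor.Two.mul_comm S.str.2 le_top le_top).comp
    (EnMor.Two.whiskerLeft (EnMor.braid S.str.1 S.str.1) (z.mcell_two h))
  have h₁ := EnMor.Two.ext_tensor hs ht le_top (A := z.und.one) (B := z.und.one) z.ucmp.symm
    z.ucmp.symm (fun X => ?_) (fun X => ?_)
  · exact congrArg (app · (pr X Y)) h₁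
  · change (z.mcmp h X z.und.one).hom ≫ (z.und.bc h h' X z.und.one).hom =
      (S.str.1.bc le_top le_top X z.und.one).hom ≫ (z.mcmp h z.und.one X).hom
    rw [← cancel_epi (S.str.1.mmIso le_top (Iso.refl X) z.ucmp).hom,
      ← cancel_mono (z.und.lc h X).hom, mmIso_hom, Iso.refl_hom]
    simp only [Category.assoc]
    rw [bc_lc hz, mcmp_right, sq (bc_nat le_top le_top _ _), mcmp_left, bc_lc S.str.2]
  · change (z.mcmp h z.und.one X).hom ≫ (z.und.bc h h' z.und.one X).hom =
      (S.str.1.bc le_top le_top z.und.one X).hom ≫ (z.mcmp h X z.und.one).hom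
    rw [← cancel_epi (S.str.1.mmIso le_top z.ucmp (Iso.refl X)).hom,
      ← cancel_mono (z.und.rc h X).hom, mmIso_hom, Iso.refl_hom]
    simp only [Category.assoc]
    rw [bc_rc hz, mcmp_left, sq (bc_nat le_top le_top _ _), mcmp_right, bc_rc S.str.2]

end EnOb

/-- The comparison of an `E_n`-algebra in symmetric monoidal linear categories with the canonical
one. -/
def EnOb.cmp {S : EnLin.{v, u} ⊤ R} (z : EnOb n S) : EnMor z.und (S.str.1.res n) (𝟙 S.base) where
  e := z.u.str.1.e
  t h := LinCat.isoMk (fun P => z.mcmp h (fst P) (snd P))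
    (nat_tensor (F := tensorHom (𝟙 S.base) (𝟙 S.base) ≫ S.str.1.m le_top) (G := z.und.m h)
      (fun P => (z.mcmp h (fst P) (snd P)).hom) fun f g => z.mcmp_nat h f g)

/-! ### Compatibility of the comparison with morphisms of algebras. -/

section

variable {S T : EnLin.{v, u} ⊤ R} {z : EnOb n S} {w : EnOb n T}

theorem EnOb.cmp_laws (hz : z.und.Laws) : z.cmp.Laws where
  assoc h X Y Z := mcmp_assoc hz h X Y Z
  left h X := z.mcmp_left h X
  right h X := z.mcmp_right h X
  braid h h' X Y := mcmp_braid hz h h' X Y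

/-- The 2-cell `p.e` is monoidal, and this is its unit half. It determines the unit comparison of
`p` from the symmetric monoidal functor `G`. -/
theorem EnMor.ucmp_ec {G : S ⟶ T} (p : EnMor z w G) :
    w.ucmp.hom ≫ p.und.ec.hom = G.str.1.ec.hom ≫ LinCat.map G.base z.ucmp.hom :=
  p.e.hom.prop.unit.trans (EnMor.comp_ec z.u.str.1 G.str.1)

/-- Composing with right unitors turns both sides into unit laws: that of `p` for the second
product, that of `G` for the first, and `mcmp_right` in source and target. The units are matched by
`ucmp_ec`. -/
theorem EnMor.mcmp_mc_right {G : S ⟶ T} (p : EnMor z w G) (hp : p.und.Laws) (h : 1 ≤ n)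
    (X : S.base) :
    (w.mcmp h (obj G.base X) (obj G.base z.und.one)).hom ≫ (p.und.mc h X z.und.one).hom =
      (G.str.1.mc le_top X z.und.one).hom ≫ LinCat.map G.base (z.mcmp h X z.und.one).hom := by
  have h₁ : LinCat.map G.base (S.str.1.mm le_top (𝟙 X) z.ucmp.hom) ≫
      LinCat.map G.base (z.mcmp h X z.und.one).hom ≫ LinCat.map G.base (z.und.rc h X).hom =
        LinCat.map G.base (S.str.1.rc le_top X).hom := by
    rw [← LinCat.map_comp, ← LinCat.map_comp, z.mcmp_right]
  rw [← cancel_epi (T.str.1.mmIso le_top (Iso.refl (obj G.base X)) (w.ucmp ≪≫ p.und.ec)).hom,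
    ← cancel_mono (LinCat.mapIso G.base (z.und.rc h X)).hom, LinCat.mapIso_hom, EnOb.mmIso_hom,
    Iso.refl_hom, Iso.trans_hom, EnOb.mm_right]
  simp only [Category.assoc]
  rw [sq (w.mcmp_nat h _ _), hp.right, w.mcmp_right, ← Category.assoc, ← EnOb.mm_right, p.ucmp_ec,
    EnOb.mm_right, Category.assoc, sq (G.str.1.mc_right le_top _), h₁]
  exact (G.str.2.right le_top X).symm

theorem EnMor.mcmp_mc_left {G : S ⟶ T} (p : EnMor z w G) (hp : p.und.Laws) (h : 1 ≤ n)
    (X : S.base) :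
    (w.mcmp h (obj G.base z.und.one) (obj G.base X)).hom ≫ (p.und.mc h z.und.one X).hom =
      (G.str.1.mc le_top z.und.one X).hom ≫ LinCat.map G.base (z.mcmp h z.und.one X).hom := by
  have h₁ : LinCat.map G.base (S.str.1.mm le_top z.ucmp.hom (𝟙 X)) ≫
      LinCat.map G.base (z.mcmp h z.und.one X).hom ≫ LinCat.map G.base (z.und.lc h X).hom =
        LinCat.map G.base (S.str.1.lc le_top X).hom := by
    rw [← LinCat.map_comp, ← LinCat.map_comp, z.mcmp_left]
  rw [← cancel_epi (T.str.1.mmIso le_top (w.ucmp ≪≫ p.und.ec) (Iso.refl (obj G.base X))).hom,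
    ← cancel_mono (LinCat.mapIso G.base (z.und.lc h X)).hom, LinCat.mapIso_hom, EnOb.mmIso_hom,
    Iso.refl_hom, Iso.trans_hom, EnOb.mm_left]
  simp only [Category.assoc]
  rw [sq (w.mcmp_nat h _ _), hp.left, w.mcmp_left, ← Category.assoc, ← EnOb.mm_left, p.ucmp_ec,
    EnOb.mm_left, Category.assoc, sq (G.str.1.mc_left le_top _), h₁]
  exact (G.str.2.left le_top X).symm

/-- Eckmann–Hilton for 1-cells: the comparison of second products is determined by that of `G`. Both
sides are monoidal transformations of two variables and agree at units by the two preceding lemmas.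
-/
theorem EnMor.mcmp_mc {G : S ⟶ T} (p : EnMor z w G) (hp : p.und.Laws) (h : 1 ≤ n) (X Y : S.base) :
    (w.mcmp h (obj G.base X) (obj G.base Y)).hom ≫ (p.und.mc h X Y).hom =
      (G.str.1.mc le_top X Y).hom ≫ LinCat.map G.base (z.mcmp h X Y).hom := by
  have hs := (EnMor.Two.whiskerLeft (G.str.1.tensor G.str.1) (w.mcell_two h)).comp
    (p.t h).hom.prop
  have ht := (EnMor.Two.map_mul S.str.2 T.str.2 G.str.2 le_top).comp
    (EnMor.Two.whiskerRight G.str.1 (z.mcell_two h))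
  have h₁ := EnMor.Two.ext_tensor hs ht le_top (A := z.und.one) (B := z.und.one) z.ucmp.symm
    z.ucmp.symm (fun X => p.mcmp_mc_right hp h X) (fun X => p.mcmp_mc_left hp h X)
  exact congrArg (app · (pr X Y)) h₁

end

end

section

variable {k R : Type} [CommRing k] [CommRing R] [Algebra R k] {n : ℕ∞}

/-! ### The `E_n`-equivalence of an `E_n`-algebra in categorified algebras -/

/-- The 2-cells of an algebra give maps from ψ(A ∗ B) to ψA ∗ ψB, whereas the comparisons of a
monoidal functor point the other way. This and the next two lemmas carry the laws over to the
inverses. -/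
theorem inv_comp_inv {A : Type u} [Category.{v} A] {a b c d e f : A} (p : a ≅ b) (q : b ≅ c)
    {g : c ⟶ f} {g' : a ⟶ d} (r : d ≅ e) (s : e ≅ f)
    (h : p.hom ≫ q.hom ≫ g = g' ≫ r.hom ≫ s.hom) :
    q.inv ≫ p.inv ≫ g' = g ≫ s.inv ≫ r.inv := by
  rw [Iso.inv_comp_eq, Iso.inv_comp_eq, sq3_both h, Iso.hom_inv_id_assoc, Iso.hom_inv_id,
    Category.comp_id]

theorem inv_comp_eq' {A : Type u} [Category.{v} A] {a b c d : A} (p : a ≅ b) (q : b ≅ c)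
    {g : c ⟶ d} {g' : a ⟶ d} (h : p.hom ≫ q.hom ≫ g = g') : q.inv ≫ p.inv ≫ g' = g := by
  rw [Iso.inv_comp_eq, Iso.inv_comp_eq, h]

theorem inv_comp_comm {A : Type u} [Category.{v} A] {a b c d : A} (p : a ≅ b) (q : d ≅ c)
    {g : b ⟶ c} {g' : a ⟶ d} (h : p.hom ≫ g = g' ≫ q.hom) : p.inv ≫ g' = g ≫ q.inv := by
  rw [Iso.inv_comp_eq, ← Category.assoc, Iso.eq_comp_inv, h]

namespace EnOb

variable {X : AP.{v, u} k 0 R} (x : EnOb n X)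

/-- The `E_n`-algebra in symmetric monoidal `k`-linear categories underlying an `E_n`-algebra in
categorified algebras. -/
def sm : EnOb n X.base.2 where
  u := x.u.base.2
  m h := (x.m h).base.2
  a h := isoSnd (TotalBicat.isoBase (x.a h))
  l h := isoSnd (TotalBicat.isoBase (x.l h))
  r h := isoSnd (TotalBicat.isoBase (x.r h))
  b h h' := isoSnd (TotalBicat.isoBase (x.b h h'))

/-- The compatibility of the equivalence with units. -/
def eu : X.str.o x.lin.one ≅ x.smc.one := x.u.str.ci pt

/-- The compatibility of the equivalence with products. -/
def em (h : 1 ≤ n) (A B : X.lin) :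
    X.str.o (x.lin.mul h A B) ≅ x.smc.mul h (X.str.o A) (X.str.o B) := (x.m h).str.ci (pr A B)

theorem em_nat (h : 1 ≤ n) {A A' B B' : X.lin} (f : A ⟶ A') (g : B ⟶ B') :
    X.str.mp (x.lin.mm h f g) ≫ (x.em h A' B').hom =
      (x.em h A B).hom ≫ x.smc.mm h (X.str.mp f) (X.str.mp g) :=
  (x.m h).str.c_nat (tm f g)

/-- The associator of `x` is a 2-cell of triples, that is, its two components are compatible with ψ.
Evaluated at ((A, B), C) this compatibility is the associativity law for ψ; the laws for unitors and
braiding arise in the same way. -/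
theorem em_assoc (h : 1 ≤ n) (A B C : X.lin) :
    (x.em h (x.lin.mul h A B) C).hom ≫ x.smc.mm h (x.em h A B).hom (𝟙 (X.str.o C)) ≫
      (x.smc.ac h (X.str.o A) (X.str.o B) (X.str.o C)).hom =
    X.str.mp (x.lin.ac h A B C).hom ≫ (x.em h A (x.lin.mul h B C)).hom ≫
      x.smc.mm h (𝟙 (X.str.o A)) (x.em h B C).hom := by
  have h₁ := APMor.two_iff.1 (x.a h).hom.prop (pr (pr A B) C)
  have h₂ := (APMor.comp_c ((x.m h).str.tensor (APMor.id X.str)) (x.m h).str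
    (pr (pr A B) C)).trans (congrArg ((x.em h (x.lin.mul h A B) C).hom ≫ LinCat.map (x.smc.m h) ·)
      (congrArg (tm (x.em h A B).hom) (APMor.id_c X.str C)))
  have h₃ := APMor.comp_c (APMor.assoc X.str X.str X.str)
    (((APMor.id X.str).tensor (x.m h).str).comp (x.m h).str) (pr (pr A B) C)
  have h₄ := (APMor.comp_c ((APMor.id X.str).tensor (x.m h).str) (x.m h).str
    (pr A (pr B C))).trans (congrArg ((x.em h A (x.lin.mul h B C)).hom ≫ LinCat.map (x.smc.m h) ·)
      (congrArg (tm · (x.em h B C).hom) (APMor.id_c X.str A)))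
  -- The associator of the tensor product of triples has identity compatibility cells, so this
  -- factor drops out.
  have h₅ : LinCat.map (tensorHom (𝟙 X.smc) (x.smc.m h) ≫ x.smc.m h)
    ((APMor.assoc X.str X.str X.str).c (pr (pr A B) C)) = 𝟙 _ := LinCat.map_id _ _
  exact (Category.assoc _ _ _).symm.trans ((congrArg (· ≫ _) h₂.symm).trans (h₁.trans
    (congrArg (_ ≫ ·) (h₃.trans ((congrArg (_ ≫ ·) h₅).trans ((Category.comp_id _).trans h₄))))))

theorem em_left (h : 1 ≤ n) (A : X.lin) :
    (x.em h x.lin.one A).hom ≫ x.smc.mm h x.eu.hom (𝟙 (X.str.o A)) ≫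
      (x.smc.lc h (X.str.o A)).hom = X.str.mp (x.lin.lc h A).hom := by
  have h₁ := APMor.two_iff.1 (x.l h).hom.prop (pr pt A)
  have h₂ := (APMor.comp_c (x.u.str.tensor (APMor.id X.str)) (x.m h).str (pr pt A)).trans
    (congrArg ((x.em h x.lin.one A).hom ≫ LinCat.map (x.smc.m h) ·)
      (congrArg (tm x.eu.hom) (APMor.id_c X.str A)))
  exact (Category.assoc _ _ _).symm.trans ((congrArg (· ≫ _) h₂.symm).trans (h₁.trans
    (Category.comp_id _)))

theorem em_right (h : 1 ≤ n) (A : X.lin) :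
    (x.em h A x.lin.one).hom ≫ x.smc.mm h (𝟙 (X.str.o A)) x.eu.hom ≫
      (x.smc.rc h (X.str.o A)).hom = X.str.mp (x.lin.rc h A).hom := by
  have h₁ := APMor.two_iff.1 (x.r h).hom.prop (pr A pt)
  have h₂ := (APMor.comp_c ((APMor.id X.str).tensor x.u.str) (x.m h).str (pr A pt)).trans
    (congrArg ((x.em h A x.lin.one).hom ≫ LinCat.map (x.smc.m h) ·)
      (congrArg (tm · x.eu.hom) (APMor.id_c X.str A)))
  exact (Category.assoc _ _ _).symm.trans ((congrArg (· ≫ _) h₂.symm).trans (h₁.trans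
    (Category.comp_id _)))

theorem em_braid (h : 1 ≤ n) (h' : 2 ≤ n) (A B : X.lin) :
    (x.em h A B).hom ≫ (x.smc.bc h h' (X.str.o A) (X.str.o B)).hom =
      X.str.mp (x.lin.bc h h' A B).hom ≫ (x.em h B A).hom := by
  have h₁ := APMor.two_iff.1 (x.b h h').hom.prop (pr A B)
  have h₂ := APMor.comp_c (APMor.braid X.str X.str) (x.m h).str (pr A B)
  have h₃ : LinCat.map (x.smc.m h) ((APMor.braid X.str X.str).c (pr A B)) = 𝟙 _ :=
    LinCat.map_id _ _
  exact h₁.trans (congrArg (_ ≫ ·) (h₂.trans ((congrArg (_ ≫ ·) h₃).trans (Category.comp_id _))))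

/-- The equivalence as a morphism of `E_n`-algebras in linear categories. -/
def eqv : EnMor (x.lin.baseChange k) x.smc X.str.hom.base where
  e := LinCat.isoMk (fun _ => x.eu.symm)
    (nat_unit (F := x.smc.u) (G := pick (bo x.lin.one) ≫ X.str.hom.base) (fun _ => x.eu.inv))
  t h := LinCat.isoMk (fun P => (x.em h (un (fst P)) (un (snd P))).symm)
    (nat_bc₂ (F := tensorHom X.str.hom.base X.str.hom.base ≫ x.smc.m h)
      (G := (merge k X.lin X.lin ≫ bcHom k (x.lin.m h)) ≫ X.str.hom.base)
      (fun P => (x.em h (un (fst P)) (un (snd P))).inv) fun {A A' B B'} f g => by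
        have h₁ := inv_comp_comm (x.em h A B) (x.em h A' B') (x.em_nat h f g).symm
        exact h₁.symm.trans (congrArg ((x.em h A B).inv ≫ LinCat.map X.str.hom.base ·)
          (EnOb.bc_mul_map k x.lin h f g)).symm)

/-- The laws of `em` with all comparisons inverted. -/
theorem eqv_laws : x.eqv.Laws where
  assoc h A B C := inv_comp_inv (x.em h (x.lin.mul h (un A) (un B)) (un C))
    (x.smc.mmIso h (x.em h (un A) (un B)) (Iso.refl _)) (x.em h (un A) (x.lin.mul h (un B) (un C)))
    (x.smc.mmIso h (Iso.refl _) (x.em h (un B) (un C))) (x.em_assoc h (un A) (un B) (un C))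
  left h A := inv_comp_eq' (x.em h x.lin.one (un A)) (x.smc.mmIso h x.eu (Iso.refl _))
    (x.em_left h (un A))
  right h A := inv_comp_eq' (x.em h (un A) x.lin.one) (x.smc.mmIso h (Iso.refl _) x.eu)
    (x.em_right h (un A))
  braid h h' A B := inv_comp_comm (x.em h (un A) (un B)) (x.em h (un B) (un A))
    (x.em_braid h h' (un A) (un B))

end EnOb

/-! ### The comparison of `E_n`-algebras in categorified algebras with categorified
`E_n`-algebras -/

namespace EnOb

variable {X : AP.{v, u} k 0 R} (x : EnOb n X)

/-- The equivalence as a morphism to the canonical `E_n`-algebra of a symmetric monoidal category. -/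
def pmor : EnMor (x.lin.baseChange k) (X.base.2.str.1.res n) X.str.hom.base :=
  x.eqv.comp x.sm.cmp

theorem pmor_ec : x.pmor.ec.hom = x.sm.ucmp.hom ≫ x.eu.inv := EnMor.comp_ec x.eqv x.sm.cmp
theorem pmor_mc (h : 1 ≤ n) (A B : X.lin) : (x.pmor.mc h (bo A) (bo B)).hom =
    (x.sm.mcmp h (X.str.o A) (X.str.o B)).hom ≫ (x.em h A B).inv :=
  EnMor.comp_mc x.eqv x.sm.cmp h (bo A) (bo B)

theorem pmor_laws (hx : x.smc.Laws) : x.pmor.Laws :=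
  EnMor.Laws.comp x.eqv_laws (cmp_laws (z := x.sm) hx)

end EnOb

/-! ### Compatibility of the comparison with morphisms of algebras in triples. -/

namespace EnMor

variable {X Y : AP.{v, u} k 0 R} {x : EnOb n X} {y : EnOb n Y} {F : X ⟶ Y} (p : EnMor x y F)

/-- The underlying morphism of `E_n`-algebras in symmetric monoidal categories. -/
def sm : EnMor x.sm y.sm F.base.2 where
  e := isoSnd (TotalBicat.isoBase p.e)
  t h := isoSnd (TotalBicat.isoBase (p.t h))

theorem eu_ec : y.eu.hom ≫ p.smc.ec.hom =
    Y.str.mp p.lin.ec.hom ≫ F.str.c x.lin.one ≫ LinCat.map F.base.2.base x.eu.hom :=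
  (APMor.two_iff.1 p.e.hom.prop pt).trans (congrArg (_ ≫ ·) (APMor.comp_c x.u.str F.str pt))

/-- Because `p.t` is a 2-cell of triples, its R-linear and k-linear components correspond under ψ;
this is that correspondence at (A, B). The unit version `eu_ec` comes from `p.e`. -/
theorem em_mc (h : 1 ≤ n) (A B : X.lin) :
    (y.em h (obj F.base.1.base A) (obj F.base.1.base B)).hom ≫
      y.smc.mm h (F.str.c A) (F.str.c B) ≫ (p.smc.mc h (X.str.o A) (X.str.o B)).hom =
    Y.str.mp (p.lin.mc h A B).hom ≫ F.str.c (x.lin.mul h A B) ≫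
      LinCat.map F.base.2.base (x.em h A B).hom := by
  have h₁ := APMor.two_iff.1 (p.t h).hom.prop (pr A B)
  have h₂ := APMor.comp_c (F.str.tensor F.str) (y.m h).str (pr A B)
  have h₃ := APMor.comp_c (x.m h).str F.str (pr A B)
  exact (Category.assoc _ _ _).symm.trans ((congrArg (· ≫ _) h₂.symm).trans (h₁.trans
    (congrArg (_ ≫ ·) h₃)))

theorem comp_inv_comp_eq {A : Type u} [Category.{v} A] {a b c d d' b' : A} {f : a ⟶ b} (i : b' ≅ b)
    {e : b' ⟶ c} {g : c ⟶ d} (j : d ≅ d') {m : b ⟶ d'} {r : a ⟶ d'}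
    (h : i.hom ≫ m = e ≫ g ≫ j.hom) (h' : f ≫ m = r) :
    ((f ≫ i.inv) ≫ e) ≫ g = r ≫ j.inv := by
  rw [← h', Iso.eq_comp_inv, Category.assoc, Category.assoc, Category.assoc, ← h,
    Iso.inv_hom_id_assoc]

/-- The compatibility transformation is a morphism of `E_n`-algebras. -/
theorem two_iso (hp : p.smc.Laws) :
    Two ((p.lin.baseChange k).comp y.pmor) (x.pmor.comp (F.base.2.str.1.res n))
      F.str.iso.hom.base where
  unit := by
    have h₁ := comp_ec (p.lin.baseChange k) y.pmor
    have h₂ := comp_ec x.pmor (F.base.2.str.1.res n)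
    have h₃ : (y.pmor.ec.hom ≫ Y.str.mp p.lin.ec.hom) ≫ F.str.c x.lin.one =
        F.base.2.str.1.ec.hom ≫ LinCat.map F.base.2.base x.pmor.ec.hom := by
      rw [y.pmor_ec, x.pmor_ec]
      refine (comp_inv_comp_eq y.eu (LinCat.mapIso F.base.2.base x.eu) p.eu_ec
        (ucmp_ec p.sm)).trans ((Category.assoc _ _ _).trans (congrArg (_ ≫ ·) ?_))
      exact (LinCat.map_comp _ _ _).symm
    exact (congrArg (· ≫ F.str.c x.lin.one) h₁).trans (h₃.trans h₂.symm)
  mul h A B := by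
    induction A using boInd with | h A =>
    induction B using boInd with | h B =>
    have h₁ := comp_mc (p.lin.baseChange k) y.pmor h (bo A) (bo B)
    have h₂ := comp_mc x.pmor (F.base.2.str.1.res n) h (bo A) (bo B)
    have h₃ : ((y.pmor.mc h (bo (obj F.base.1.base A)) (bo (obj F.base.1.base B))).hom ≫
        Y.str.mp (p.lin.mc h A B).hom) ≫ F.str.c (x.lin.mul h A B) =
        Y.base.2.str.1.mm le_top (F.str.c A) (F.str.c B) ≫
          (F.base.2.str.1.mc le_top (X.str.o A) (X.str.o B)).hom ≫
            LinCat.map F.base.2.base (x.pmor.mc h (bo A) (bo B)).hom := by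
      rw [y.pmor_mc, x.pmor_mc]
      -- Here the second product in S is exchanged for the first: naturality of the comparison moves
      -- the cells of F across it, and `mcmp_mc` replaces the comparison of second products of `p`
      -- by that of the symmetric monoidal functor.
      have h₄ : (y.sm.mcmp h (Y.str.o (obj F.base.1.base A)) (Y.str.o (obj F.base.1.base B))).hom ≫
          y.smc.mm h (F.str.c A) (F.str.c B) ≫ (p.smc.mc h (X.str.o A) (X.str.o B)).hom =
          Y.base.2.str.1.mm le_top (F.str.c A) (F.str.c B) ≫
            (F.base.2.str.1.mc le_top (X.str.o A) (X.str.o B)).hom ≫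
              LinCat.map F.base.2.base (x.sm.mcmp h (X.str.o A) (X.str.o B)).hom :=
        (sq (y.sm.mcmp_nat h (F.str.c A) (F.str.c B)) _).symm.trans
          (congrArg (_ ≫ ·) (mcmp_mc p.sm hp h (X.str.o A) (X.str.o B)))
      refine (comp_inv_comp_eq (y.em h (obj F.base.1.base A) (obj F.base.1.base B))
        (LinCat.mapIso F.base.2.base (x.em h A B)) (p.em_mc h A B) h₄).trans
        ((Category.assoc _ _ _).trans (congrArg (_ ≫ ·) ((Category.assoc _ _ _).trans
          (congrArg (_ ≫ ·) ?_))))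
      exact (LinCat.map_comp _ _ _).symm
    exact (congrArg (· ≫ F.str.c (x.lin.mul h A B)) h₁).trans (h₃.trans (congrArg (_ ≫ ·) h₂.symm))

end EnMor

/-- The underlying invertible transformation of linear functors of a compatibility transformation. -/
def APMor.lin {X Y : EnLin.{v, u} n R × EnLin.{v, u} ⊤ k} {ψ : APOb X} {χ : APOb Y} {F : X ⟶ Y}
    (φ : APMor ψ χ F) :
    LinCat.bcHom k F.1.base ≫ χ.hom.base ≅ ψ.hom.base ≫ F.2.base :=
  TotalBicat.isoBase φ.iso

/-! ### The comparison pseudofunctor. -/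

namespace EnAP

/-- The comparison on 0-cells. -/
def toObj (X : EnAP.{v, u} k n R) : AP.{v, u} k n R :=
  -- The point of the R-linear category and the second product on S are forgotten; the latter
  -- survives only through the Eckmann–Hilton comparison contained in `pmor`.
  ⟨(⟨X.base.lin, ⟨X.str.1.lin, X.str.2.1⟩⟩, X.base.base.2),
    ⟨⟨X.base.str.hom.base, ⟨X.str.1.pmor, X.str.1.pmor_laws X.str.2.2⟩⟩,
      X.base.str.isEquivalence⟩⟩

variable {X Y Z : EnAP.{v, u} k n R}

/-- The comparison on 1-cells. -/
def toHom (F : X ⟶ Y) : toObj X ⟶ toObj Y :=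
  ⟨(⟨F.base.base.1.base, ⟨F.str.1.lin, F.str.2.1⟩⟩, F.base.base.2),
    ⟨TotalBicat.isoMk F.base.str.lin (F.str.1.two_iso F.str.2.2)⟩⟩

/-- The comparison on 2-cells. -/
def toHom₂ {F G : X ⟶ Y} (t : F ⟶ G) : toHom F ⟶ toHom G :=
  ⟨(⟨t.base.base.1.base, t.prop.1⟩, t.base.base.2),
    APMor.two_iff.2 fun A => APMor.two_iff.1 t.base.prop A⟩

theorem hom₂_ext {X Y : AP.{v, u} k n R} {F G : X ⟶ Y} {s t : F ⟶ G} (h : ∀ A, app (AP.lin₂ s) A = app (AP.lin₂ t) A)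
    (h' : ∀ A, app (AP.smc₂ s) A = app (AP.smc₂ t) A) : s = t :=
  TotalBicat.hom₂_ext (Prod.ext (TotalBicat.hom₂_ext (LinCat.hom₂_ext h))
    (TotalBicat.hom₂_ext (LinCat.hom₂_ext h')))

/-- The comparison preserves identities. -/
def toId (X : EnAP.{v, u} k n R) : toHom (𝟙 X) ≅ 𝟙 (toObj X) :=
  TotalBicat.isoMk (Iso.refl (𝟙 (toObj X).base)) (APMor.two_iff.2 fun A => by
    have h₁ : (toHom (𝟙 X)).str.c A = 𝟙 _ := APMor.id_c X.base.str A
    have h₂ : (APMor.id (toObj X).str).c A = 𝟙 _ := APMor.id_c (toObj X).str A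
    exact (Category.comp_id _).trans (h₁.trans (h₂.symm.trans ((Category.id_comp _).symm.trans
      (congrArg (· ≫ (APMor.id (toObj X).str).c A) ((toObj X).str.mp_id A).symm)))))

/-- The comparison preserves composition. -/
def toComp (F : X ⟶ Y) (G : Y ⟶ Z) : toHom (F ≫ G) ≅ toHom F ≫ toHom G :=
  TotalBicat.isoMk (Iso.refl ((toHom F).base ≫ (toHom G).base)) (APMor.two_iff.2 fun A => by
    have h₁ : (toHom (F ≫ G)).str.c A = _ := APMor.comp_c F.base.str G.base.str A
    have h₂ : ((toHom F).str.comp (toHom G).str).c A = _ := APMor.comp_c (toHom F).str (toHom G).str A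
    exact (Category.comp_id _).trans (h₁.trans (h₂.symm.trans ((Category.id_comp _).symm.trans
      (congrArg (· ≫ ((toHom F).str.comp (toHom G).str).c A) ((toObj Z).str.mp_id _).symm)))))

section

variable {A : Type u} [Category.{v} A] {a b : A}

theorem comp_id_eq (f : a ⟶ b) {i : a ⟶ a} {j : b ⟶ b} (hi : i = 𝟙 a) (hj : j = 𝟙 b) :
    f = i ≫ f ≫ j := by
  rw [hi, hj, Category.id_comp, Category.comp_id]

theorem comp_id_eq₃ {f g i : a ⟶ a} (hf : f = 𝟙 a) (hg : g = 𝟙 a) (hi : i = 𝟙 a) :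
    𝟙 a = f ≫ g ≫ i := by
  rw [hf, hg, hi, Category.comp_id, Category.comp_id]

theorem comp_id_eq₅ {f g i j l : a ⟶ a} (hf : f = 𝟙 a) (hg : g = 𝟙 a) (hi : i = 𝟙 a) (hj : j = 𝟙 a)
    (hl : l = 𝟙 a) : 𝟙 a = f ≫ g ≫ i ≫ j ≫ l := by
  simp only [hf, hg, hi, hj, hl, Category.comp_id]

end

variable (k n R) in
/-- The comparison of `E_n`-algebras in categorified algebras with categorified `E_n`-algebras. -/
def toAP : Pseudofunctor (EnAP.{v, u} k n R) (AP.{v, u} k n R) where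
  obj := toObj
  map := toHom
  map₂ := toHom₂
  mapId := toId
  mapComp := toComp
  map₂_id _ := rfl
  map₂_comp _ _ := rfl
  -- All coherence cells of the comparison, and all associators and unitors involved, have identity
  -- components. Componentwise each axiom only inserts or removes identities, possibly under a
  -- linear functor.
  map₂_whisker_left _ _ _ _ := hom₂_ext (fun _ => comp_id_eq _ rfl rfl)
    (fun _ => comp_id_eq _ rfl rfl)
  map₂_whisker_right _ _ := hom₂_ext (fun _ => comp_id_eq _ rfl rfl)
    (fun _ => comp_id_eq _ rfl rfl)
  map₂_associator _ _ H := hom₂_ext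
    (fun _ => comp_id_eq₅ rfl (LinCat.map_id (AP.linHom H.base) _) rfl rfl rfl)
    (fun _ => comp_id_eq₅ rfl (LinCat.map_id (AP.smcHom H.base) _) rfl rfl rfl)
  map₂_left_unitor F := hom₂_ext
    (fun _ => comp_id_eq₃ rfl (LinCat.map_id (AP.linHom F.base) _) rfl)
    (fun _ => comp_id_eq₃ rfl (LinCat.map_id (AP.smcHom F.base) _) rfl)
  map₂_right_unitor _ := hom₂_ext (fun _ => comp_id_eq₃ rfl rfl rfl)
    (fun _ => comp_id_eq₃ rfl rfl rfl)

end EnAP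

/-! ### The comparison is an equivalence on categories of 1-cells -/

section

variable {S T : EnLin.{v, u} ⊤ R} {z : EnOb n S} {w : EnOb n T}

/-- Monoidal transformations are compatible with `E_n`-structures in symmetric monoidal
categories. -/
theorem EnMor.two_und {G G' : S ⟶ T} (p : EnMor z w G) (p' : EnMor z w G') (hp : p.und.Laws)
    (hp' : p'.und.Laws) (t : G ⟶ G') : EnMor.Two p.und p'.und t.base where
  unit := by
    rw [← cancel_epi w.ucmp.hom, sq p.ucmp_ec, p'.ucmp_ec, naturality, ← Category.assoc]
    exact congrArg (· ≫ LinCat.map G'.base z.ucmp.hom) t.prop.unit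
  mul h X Y := by
    rw [← cancel_epi (w.mcmp h (obj G.base X) (obj G.base Y)).hom, sq (p.mcmp_mc hp h X Y),
      ← sq (w.mcmp_nat h _ _), p'.mcmp_mc hp', naturality, ← Category.assoc, ← Category.assoc]
    exact congrArg (· ≫ LinCat.map G'.base (z.mcmp h X Y).hom) (t.prop.mul le_top X Y)

end

namespace EnAP

variable {X Y : EnAP.{v, u} k n R}

/-- The comparison of the distinguished object with the unit of an `E_n`-algebra in categorified
algebras. -/
def ptIso (X : EnAP.{v, u} k n R) : X.base.base.1.str.1.one ≅ X.str.1.lin.one :=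
  X.str.1.u.base.1.str.1.ec

theorem ptIso_ec (F : X ⟶ Y) : (ptIso Y).hom ≫ F.str.1.lin.ec.hom =
    F.base.base.1.str.1.ec.hom ≫ LinCat.map (AP.linHom F.base) (ptIso X).hom :=
  F.str.1.e.hom.base.1.prop.unit.trans
    (EnMor.comp_ec X.str.1.u.base.1.str.1 F.base.base.1.str.1)

/-- The point is identified with the unit of the algebra by `ptIso`, compatibly with 1-cells by
`ptIso_ec`. Along this identification the unit half of monoidality is the pointed condition. -/
theorem pointed_of_two {F G : X ⟶ Y} (t : AP.linHom F.base ⟶ AP.linHom G.base)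
    (h : EnMor.Two F.str.1.lin G.str.1.lin t) :
    EnMor.Two F.base.base.1.str.1 G.base.base.1.str.1 t where
  unit := by
    rw [← cancel_mono (LinCat.mapIso (AP.linHom G.base) (ptIso X)).hom, LinCat.mapIso_hom]
    refine (Category.assoc _ _ _).trans ((congrArg (_ ≫ ·) (naturality t (ptIso X).hom).symm).trans
      ((Category.assoc _ _ _).symm.trans ((congrArg (· ≫ _) (ptIso_ec F).symm).trans
      ((Category.assoc _ _ _).trans ((congrArg (_ ≫ ·) h.unit).trans (ptIso_ec G))))))
  mul h := (not_one_le_zero h).elim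

/-- A 2-cell from a 2-cell between the comparisons. -/
def ofHom₂ {F G : X ⟶ Y} (t : toHom F ⟶ toHom G) : F ⟶ G :=
  ⟨⟨(⟨t.base.1.base, pointed_of_two t.base.1.base t.base.1.prop⟩, t.base.2),
    APMor.two_iff.2 fun A => APMor.two_iff.1 t.prop A⟩,
    -- Compatibility with the second product on S is no condition: by Eckmann–Hilton it follows from
    -- compatibility with the first.
    ⟨t.base.1.prop, EnMor.two_und F.str.1.sm G.str.1.sm F.str.2.2 G.str.2.2 t.base.2⟩⟩

theorem toHom₂_ofHom₂ {F G : X ⟶ Y} (t : toHom F ⟶ toHom G) : toHom₂ (ofHom₂ t) = t := rfl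

theorem toHom₂_injective {F G : X ⟶ Y} {s t : F ⟶ G} (h : toHom₂ s = toHom₂ t) : s = t :=
  TotalBicat.hom₂_ext (hom₂_ext (fun A => congrArg (fun r : toHom F ⟶ toHom G => app (AP.lin₂ r) A) h)
    (fun A => congrArg (fun r : toHom F ⟶ toHom G => app (AP.smc₂ r) A) h))

end EnAP

/-! ### The comparison is essentially surjective on 1-cells -/

section

variable {C D E : LinCat.{v, u} R}

theorem LinCat.map_injective (G : C ⟶ D) [G.functor.Faithful] {X Y : C} {f g : X ⟶ Y}
    (h : LinCat.map G f = LinCat.map G g) : f = g := G.functor.map_injective h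

/-- If a faithful functor and its precomposition with a functor are functors of `E_n`-categories,
then so is the latter. -/
theorem EnMor.Laws.of_comp {x : EnOb n C} {y : EnOb n D} {z : EnOb n E} {F : C ⟶ D} {G : D ⟶ E}
    [G.functor.Faithful] {p : EnMor x y F} {q : EnMor y z G} (hpq : (p.comp q).Laws)
    (hq : q.Laws) : p.Laws where
  assoc h X Y Z := by
    have h₀ := hpq.assoc h X Y Z
    have h₁ := hq.assoc h (obj F X) (obj F Y) (obj F Z)
    simp only [comp_obj, LinCat.comp_map, comp_mc, Category.assoc, EnOb.mm_left,
      EnOb.mm_right] at h₀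
    -- After naturality both sides begin with the same comparisons of `q`. These are invertible;
    -- cancelling them leaves the image under `G` of the law for `p`, and `G` is faithful.
    rw [sq (mc_left q h _), sq (mc_right q h _), ← sq3_both h₁] at h₀
    apply LinCat.map_injective G
    simp only [LinCat.map_comp]
    exact (cancel_epi (q.mc h (y.mul h (obj F X) (obj F Y)) (obj F Z)).hom).1
      ((cancel_epi (z.mmIso h (q.mc h (obj F X) (obj F Y)) (Iso.refl _)).hom).1 h₀)
  left h X := by
    have h₀ := hpq.left h X
    have h₁ := hq.left h (obj F X)
    simp only [comp_obj, LinCat.comp_map, comp_mc, comp_ec, Category.assoc, EnOb.mm_left] at h₀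
    rw [sq (mc_left q h _), ← h₁] at h₀
    apply LinCat.map_injective G
    simp only [LinCat.map_comp]
    exact (cancel_epi (q.mc h y.one (obj F X)).hom).1
      ((cancel_epi (z.mmIso h q.ec (Iso.refl _)).hom).1 h₀)
  right h X := by
    have h₀ := hpq.right h X
    have h₁ := hq.right h (obj F X)
    simp only [comp_obj, LinCat.comp_map, comp_mc, comp_ec, Category.assoc, EnOb.mm_right] at h₀
    rw [sq (mc_right q h _), ← h₁] at h₀
    apply LinCat.map_injective G
    simp only [LinCat.map_comp]
    exact (cancel_epi (q.mc h (obj F X) y.one).hom).1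
      ((cancel_epi (z.mmIso h (Iso.refl _) q.ec).hom).1 h₀)
  braid h h' X Y := by
    have h₀ := hpq.braid h h' X Y
    have h₁ := hq.braid h h' (obj F X) (obj F Y)
    simp only [comp_obj, LinCat.comp_map, comp_mc, Category.assoc] at h₀
    rw [← sq h₁] at h₀
    apply LinCat.map_injective G
    simp only [LinCat.map_comp]
    exact (cancel_epi (q.mc h (obj F X) (obj F Y)).hom).1 h₀

/-- Factor e ⊗ e as 1 ⊗ e followed by e ⊗ 1; the hypothesis evaluates the second factor and
naturality of the left unitor the first. So a left unit for a multiplication is automatically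
multiplicative. -/
theorem EnOb.mm_comp_eq (x : EnOb n C) (h : 1 ≤ n) {A : C} (e : x.one ⟶ A) (m : x.mul h A A ⟶ A)
    (hm : x.mm h e (𝟙 A) ≫ m = (x.lc h A).hom) : x.mm h e e ≫ m = (x.lc h x.one).hom ≫ e := by
  rw [← x.lc_nat, ← hm, ← Category.assoc, ← EnOb.mm_comp, Category.id_comp, Category.comp_id]

/-- If both e and its composite with t are multiplicative and e is invertible, then t is
multiplicative, since e ⊗ e may be cancelled. For transformations out of the unit category this
leaves only the unit condition. -/
theorem EnOb.comp_eq_mm_comp (x : EnOb n C) (h : 1 ≤ n) {A A' : C} (e : x.one ≅ A)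
    {m : x.mul h A A ⟶ A} {m' : x.mul h A' A' ⟶ A'} (t : A ⟶ A')
    (hm : x.mm h e.hom e.hom ≫ m = (x.lc h x.one).hom ≫ e.hom)
    (hm' : x.mm h (e.hom ≫ t) (e.hom ≫ t) ≫ m' = (x.lc h x.one).hom ≫ e.hom ≫ t) :
    m ≫ t = x.mm h t t ≫ m' := by
  rw [← cancel_epi (x.mmIso h e e).hom, EnOb.mmIso_hom, ← Category.assoc, hm, ← Category.assoc,
    ← EnOb.mm_comp, hm', Category.assoc]

theorem EnMor.ec_mc_unit {x : EnOb n C} {F : LinCat.unit.{v, u} R ⟶ C}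
    {p : EnMor (EnOb.unit n R) x F} (hp : p.Laws) (h : 1 ≤ n) :
    x.mm h p.ec.hom p.ec.hom ≫ (p.mc h pt pt).hom = (x.lc h x.one).hom ≫ p.ec.hom := by
  exact x.mm_comp_eq h p.ec.hom _ ((congrArg (_ ≫ ·) ((Category.comp_id _).symm.trans
    (congrArg (_ ≫ ·) (LinCat.map_id F pt).symm))).trans (hp.left h pt))

/-- A transformation of monoidal functors out of the unit is monoidal if it is compatible with
units. -/
theorem EnMor.two_of_unit {x : EnOb n C} {F G : LinCat.unit.{v, u} R ⟶ C}
    {p : EnMor (EnOb.unit n R) x F} {q : EnMor (EnOb.unit n R) x G} (hp : p.Laws) (hq : q.Laws)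
    {t : F ⟶ G} (ht : p.ec.hom ≫ app t pt = q.ec.hom) : Two p q t where
  unit := ht
  mul h r s := by
    obtain rfl := EnOb.unit_eq r pt
    obtain rfl := EnOb.unit_eq s pt
    have h₁ := ec_mc_unit hq h
    rw [← ht] at h₁
    exact x.comp_eq_mm_comp h p.ec (app t pt) (ec_mc_unit hp h) h₁

/-- Gives the pointed condition for the comparison of products of `p`. The distinguished objects A
and B are only isomorphic to units, and `m` and `m'` are inverse left unitors up to these
isomorphisms. After composition with the image of the left unitor at A, the claim becomes the left
unit law of `p`. -/
theorem EnMor.ec_comp_map_mul {x : EnOb n C} {y : EnOb n D} {F : C ⟶ D} {p : EnMor x y F}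
    (hp : p.Laws) (h : 1 ≤ n) {A : C} {B : D} (i : A ≅ x.one) (j : B ⟶ y.one) (g : B ⟶ obj F A)
    (hg : g ≫ LinCat.map F i.hom = j ≫ p.ec.hom) (m : A ⟶ x.mul h A A)
    (hm : m ≫ x.mm h i.hom (𝟙 A) ≫ (x.lc h A).hom = 𝟙 A) (m' : B ⟶ y.mul h B B)
    (hm' : m' ≫ y.mm h j (𝟙 B) ≫ (y.lc h B).hom = 𝟙 B) :
    (m' ≫ y.mm h g g) ≫ (p.mc h A A).hom = g ≫ LinCat.map F m := by
  rw [← cancel_mono (LinCat.mapIso F (x.mmIso h i (Iso.refl A) ≪≫ x.lc h A)).hom,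
    LinCat.mapIso_hom, Category.assoc g, ← LinCat.map_comp]
  have h₁ : m ≫ (x.mmIso h i (Iso.refl A) ≪≫ x.lc h A).hom = 𝟙 A := hm
  have h₂ : (x.mmIso h i (Iso.refl A) ≪≫ x.lc h A).hom = x.mm h i.hom (𝟙 A) ≫ (x.lc h A).hom := rfl
  have h₃ : y.mm h g g ≫ y.mm h (LinCat.map F i.hom) (𝟙 (obj F A)) =
      y.mm h j (𝟙 B) ≫ y.mm h (𝟙 y.one) g ≫ y.mm h p.ec.hom (𝟙 (obj F A)) := by
    rw [← EnOb.mm_comp, ← EnOb.mm_comp, ← EnOb.mm_comp, hg, Category.id_comp, Category.id_comp]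
  rw [h₁, h₂, LinCat.map_id, Category.comp_id, LinCat.map_comp, Category.assoc, Category.assoc,
    ← sq (p.mc_left h i.hom), sq h₃, Category.assoc, hp.left h A, y.lc_nat, sq3 hm',
    Category.id_comp]

section

variable {A : Type u} [Category.{v} A]

theorem comp_eq_comp_inv {a b c d : A} {f : a ⟶ b} {g : b ⟶ c} (i : c ≅ d) {w : a ⟶ d}
    (h : f ≫ g ≫ i.hom = w) : f ≫ g = w ≫ i.inv := by
  rw [← h, Category.assoc, Category.assoc, Iso.hom_inv_id, Category.comp_id]

theorem comp_conj_eq {a b c d d' g g' s : A} {p : a ⟶ b} {i : b ⟶ c} {e : c ⟶ d} {j : d ⟶ d'}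
    {f' : d' ⟶ g'} {f : d ⟶ g} {j' : g ⟶ g'} {w : a ⟶ s} {r : s ⟶ g} {r' : s ⟶ g'}
    (h₁ : (p ≫ i) ≫ e ≫ f = w ≫ r) (h₂ : j ≫ f' = f ≫ j') (h₃ : r ≫ j' = r') :
    p ≫ (i ≫ e ≫ j) ≫ f' = w ≫ r' := by
  simp only [Category.assoc] at h₁ ⊢
  rw [h₂, ← h₃, ← Category.assoc w, ← h₁]
  simp only [Category.assoc]

theorem comp_comp_inv_comp {a a' b b' b'' d e e' e'' : A} (c : a ≅ a') (κ : b ≅ a') {m : b ⟶ d}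
    {f : d ⟶ e} {s : a ⟶ b'} {r : b' ⟶ e'} (c' : e' ≅ e'') (κ' : e ≅ e'') (q : b' ≅ b'')
    {t : a' ⟶ b''} (h₁ : ((c.hom ≫ κ.inv) ≫ m) ≫ f = s ≫ r ≫ c'.hom ≫ κ'.inv)
    (h₂ : s ≫ q.hom = c.hom ≫ t) :
    (κ.hom ≫ t) ≫ q.inv ≫ r ≫ c'.hom = m ≫ f ≫ κ'.hom := by
  have h₃ : t ≫ q.inv = c.inv ≫ s := by rw [Iso.comp_inv_eq, Category.assoc, h₂, Iso.inv_hom_id_assoc]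
  rw [← cancel_mono κ'.inv, ← cancel_epi κ.inv, ← cancel_epi c.hom]
  simp only [Category.assoc, Iso.hom_inv_id, Category.comp_id, Iso.inv_hom_id_assoc] at h₁ ⊢
  rw [h₁, ← Category.assoc t, h₃, Category.assoc, Iso.hom_inv_id_assoc]

end

theorem EnMor.Laws.of_eq {x : EnOb n C} {y : EnOb n D} {F : C ⟶ D} {p q : EnMor x y F}
    (hq : q.Laws) (h₀ : p.ec.hom = q.ec.hom) (h₁ : ∀ h X Y, (p.mc h X Y).hom = (q.mc h X Y).hom) :
    p.Laws where
  assoc h X Y Z := by simpa only [h₁] using hq.assoc h X Y Z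
  left h X := by simpa only [h₁, h₀] using hq.left h X
  right h X := by simpa only [h₁, h₀] using hq.right h X
  braid h h' X Y := by simpa only [h₁] using hq.braid h h' X Y

/-- The comparison of products as a 2-cell of symmetric monoidal categories. -/
def EnOb.mcell₂ {S : EnLin.{v, u} ⊤ R} (z : EnOb n S) (h : 1 ≤ n) : (EnLin.canon n S).m h ≅ z.m h :=
  TotalBicat.isoMk (z.mcell h) (z.mcell_two h)

end

/-! ### Rebuilding a 1-cell of algebras from a 1-cell between comparisons. -/

namespace EnAP

variable {X Y : EnAP.{v, u} k n R}

/-- The tensor product of the distinguished object with itself. -/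
theorem ptIso_mul (X : EnAP.{v, u} k n R) (h : 1 ≤ n) :
    (X.str.1.m h).base.1.str.1.ec.hom ≫
      X.str.1.lin.mm h (ptIso X).hom (𝟙 X.base.base.1.str.1.one) ≫
        (X.str.1.lin.lc h X.base.base.1.str.1.one).hom = 𝟙 X.base.base.1.str.1.one := by
  have h₁ := (X.str.1.l h).hom.base.1.prop.unit
  exact (Category.assoc _ _ _).symm.trans ((congrArg (· ≫ _) (EnMor.comp_ec
    (X.str.1.u.base.1.str.1.tensor (EnMor.id X.base.base.1.str.1))
      (X.str.1.m h).base.1.str.1).symm).trans h₁)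

/-- The unit 1-cell of the algebra is a 1-cell of triples. Its unit condition relates the comparison
of 1 with ψ of the point to the one with ψ of the algebra unit. -/
theorem pc_ptIso (X : EnAP.{v, u} k n R) :
    X.base.str.pc.hom ≫ X.base.str.mp (ptIso X).hom = (toObj X).str.pc.hom := by
  have h₁ := X.str.1.u.str.c_unit
  have h₂ : (toObj X).str.pc.hom = X.str.1.sm.ucmp.hom ≫ X.str.1.eu.inv := X.str.1.pmor_ec
  refine (comp_eq_comp_inv X.str.1.eu ?_).trans h₂.symm
  exact h₁.trans ((congrArg (X.str.1.sm.ucmp.hom ≫ ·) (LinCat.map_id X.str.1.smc.u pt)).trans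
    (Category.comp_id _))

variable (Φ : toObj X ⟶ toObj Y)

/-- The underlying `R`-linear functor of a 1-cell between comparisons. -/
abbrev linF : X.base.lin ⟶ Y.base.lin := Φ.base.1.base

/-- A 1-cell between comparisons as a functor of pointed categories. -/
def ofLin : X.base.base.1 ⟶ Y.base.base.1 :=
  EnLin.pointed (linF Φ)
    -- The only possible pointing: the condition `ptIso_ec` on 1-cells of algebras forces the unit
    -- comparison of Φ to be conjugated by `ptIso`.
    (ptIso Y ≪≫ Φ.base.1.str.1.ec ≪≫ LinCat.mapIso (linF Φ) (ptIso X).symm)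

theorem ofLin_ec : (ofLin Φ).str.1.ec.hom ≫ LinCat.map (linF Φ) (ptIso X).hom =
    (ptIso Y).hom ≫ Φ.base.1.str.1.ec.hom :=
  (Category.assoc _ _ _).trans (congrArg (_ ≫ ·) ((Category.assoc _ _ _).trans
    ((congrArg (_ ≫ ·) (LinCat.mapIso (linF Φ) (ptIso X)).inv_hom_id).trans (Category.comp_id _))))

/-- A 1-cell between comparisons as a 1-cell of categorified algebras. -/
def ofBase : X.base ⟶ Y.base :=
  ⟨(ofLin Φ, Φ.base.2), APMor.mk₀ X.base.str Y.base.str (F := (ofLin Φ, Φ.base.2)) Φ.str.lin (by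
    have h₁ : Y.base.str.mp (ofLin Φ).str.1.ec.hom = Y.base.str.mp (ptIso Y).hom ≫
        Y.base.str.mp Φ.base.1.str.1.ec.hom ≫
          Y.base.str.mp (LinCat.map (linF Φ) (ptIso X).inv) :=
      (APOb.mp_comp _ _ _).trans (congrArg (_ ≫ ·) (APOb.mp_comp _ _ _))
    have h₂ : ((Y.base.str.pc.hom ≫ Y.base.str.mp (ptIso Y).hom) ≫
        Y.base.str.mp Φ.base.1.str.1.ec.hom ≫ Φ.str.c X.str.1.lin.one) =
        Φ.base.2.str.1.ec.hom ≫ LinCat.map Φ.base.2.base (toObj X).str.pc.hom :=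
      (congrArg (· ≫ _) (pc_ptIso Y)).trans Φ.str.c_unit
    have h₃ : (toObj X).str.pc.hom ≫ X.base.str.mp (ptIso X).inv = X.base.str.pc.hom :=
      (congrArg (· ≫ _) (pc_ptIso X).symm).trans ((Category.assoc _ _ _).trans
        ((congrArg (_ ≫ ·) ((APOb.mp_comp _ _ _).symm.trans ((congrArg X.base.str.mp
          (ptIso X).hom_inv_id).trans (APOb.mp_id _ _)))).trans (Category.comp_id _)))
    -- The unit condition of Φ holds at the unit of the algebra. Naturality of the compatibility
    -- cell along the inverse of `ptIso` brings it to the distinguished point.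
    exact (congrArg (fun f => Y.base.str.pc.hom ≫ f ≫ Φ.str.c X.base.base.1.str.1.one) h₁).trans
      (comp_conj_eq h₂ (Φ.str.c_nat (ptIso X).inv) ((LinCat.map_comp _ _ _).symm.trans
        (congrArg (LinCat.map Φ.base.2.base) h₃))))⟩

/-- The compatibility of a 1-cell between comparisons with units. -/
def unitLin : Y.str.1.u.base.1 ≅ X.str.1.u.base.1 ≫ ofLin Φ :=
  EnLin.isoPt Φ.base.1.str.1.e ((ofLin_ec Φ).symm.trans
    (EnMor.comp_ec X.str.1.u.base.1.str.1 (ofLin Φ).str.1).symm)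

/-- The compatibility of a 1-cell between comparisons with units. -/
def unitSm : Y.str.1.u.base.2 ≅ X.str.1.u.base.2 ≫ Φ.base.2 :=
  -- The component is forced by `EnMor.ucmp_ec`. Monoidality costs nothing beyond the unit
  -- condition, because the source is the unit category.
  TotalBicat.isoMk (LinCat.isoMk (fun _ => Y.str.1.sm.ucmp.symm ≪≫ Φ.base.2.str.1.ec ≪≫
      LinCat.mapIso Φ.base.2.base X.str.1.sm.ucmp)
    (nat_unit (F := Y.str.1.smc.u) (G := X.str.1.smc.u ≫ Φ.base.2.base) (fun _ =>
      Y.str.1.sm.ucmp.inv ≫ Φ.base.2.str.1.ec.hom ≫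
        LinCat.map Φ.base.2.base X.str.1.sm.ucmp.hom)))
    (EnMor.two_of_unit Y.str.1.u.base.2.str.2
      (X.str.1.u.base.2 ≫ Φ.base.2).str.2 ((Y.str.1.sm.ucmp.hom_inv_id_assoc _).trans
        (EnMor.comp_ec X.str.1.u.base.2.str.1 Φ.base.2.str.1).symm))

/-- The compatibility of a 1-cell between comparisons with units. -/
def unitIso : Y.str.1.u ≅ X.str.1.u ≫ ofBase Φ :=
  TotalBicat.isoMk (Iso.prod (unitLin Φ) (unitSm Φ)) (APMor.two_iff.2 fun A => by
    obtain rfl := EnOb.unit_eq A pt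
    have h₁ : ((Y.str.1.sm.ucmp.hom ≫ Y.str.1.eu.inv) ≫ Y.base.str.mp Φ.base.1.str.1.ec.hom) ≫
        Φ.str.c X.str.1.lin.one = Φ.base.2.str.1.ec.hom ≫
          LinCat.map Φ.base.2.base X.str.1.sm.ucmp.hom ≫
            LinCat.map Φ.base.2.base X.str.1.eu.inv := by
      have h₂ := (congrArg (· ≫ Y.base.str.mp Φ.base.1.str.1.ec.hom ≫ Φ.str.c X.str.1.lin.one)
        Y.str.1.pmor_ec.symm).trans (Φ.str.c_unit.trans (congrArg (_ ≫ ·)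
          ((congrArg (LinCat.map Φ.base.2.base) X.str.1.pmor_ec).trans (LinCat.map_comp _ _ _))))
      exact (Category.assoc _ _ _).trans h₂
    exact (congrArg (· ≫ _) (Category.comp_id _).symm).trans ((comp_comp_inv_comp Y.str.1.sm.ucmp
      Y.str.1.eu (LinCat.mapIso Φ.base.2.base X.str.1.sm.ucmp)
      (LinCat.mapIso Φ.base.2.base X.str.1.eu) Y.str.1.sm.ucmp
      ((h₁.trans (Category.id_comp _).symm)) ((Category.id_comp _).trans
        (Category.comp_id _).symm)).trans
      (congrArg (_ ≫ ·) (APMor.comp_c X.str.1.u.str (ofBase Φ).str pt).symm)))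

/-- The compatibility of a 1-cell between comparisons with products. -/
def mulLin (h : 1 ≤ n) : tHom (ofLin Φ) (ofLin Φ) ≫ (Y.str.1.m h).base.1 ≅
    (X.str.1.m h).base.1 ≫ ofLin Φ :=
  EnLin.isoPt (Φ.base.1.str.1.t h) (by
    have h₁ := EnMor.comp_ec ((ofLin Φ).str.1.tensor (ofLin Φ).str.1) (Y.str.1.m h).base.1.str.1
    have h₂ := EnMor.comp_ec (X.str.1.m h).base.1.str.1 (ofLin Φ).str.1
    exact (congrArg (· ≫ _) h₁).trans ((EnMor.ec_comp_map_mul Φ.base.1.str.2 h (ptIso X)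
      (ptIso Y).hom _ (ofLin_ec Φ) _ (ptIso_mul X h) _ (ptIso_mul Y h)).trans h₂.symm))

/-- The compatibility of a 1-cell between comparisons with products. -/
def mulSm (h : 1 ≤ n) : tHom Φ.base.2 Φ.base.2 ≫ (Y.str.1.m h).base.2 ≅
    (X.str.1.m h).base.2 ≫ Φ.base.2 :=
  -- By `EnMor.mcmp_mc` there is no choice: the comparison for second products is that for first
  -- products, conjugated by the Eckmann–Hilton cells. Being composed of 2-cells of symmetric
  -- monoidal categories, it is again one.
  whiskerLeftIso (tHom Φ.base.2 Φ.base.2) (Y.str.1.sm.mcell₂ h).symm ≪≫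
    EnLin.canonMul Φ.base.2 h ≪≫ whiskerRightIso (X.str.1.sm.mcell₂ h) Φ.base.2

/-- The compatibility of a 1-cell between comparisons with products. -/
def mulIso (h : 1 ≤ n) : tHom (ofBase Φ) (ofBase Φ) ≫ Y.str.1.m h ≅ X.str.1.m h ≫ ofBase Φ :=
  TotalBicat.isoMk (Iso.prod (mulLin Φ h) (mulSm Φ h)) (APMor.two_iff.2 fun A => by
    induction A using prInd with | h A B =>
    have h₁ := Φ.str.iso.hom.prop.mul h (bo A) (bo B)
    have h₂ := EnMor.comp_mc (Φ.base.1.str.1.baseChange k) Y.str.1.pmor h (bo A) (bo B)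
    have h₃ := EnMor.comp_mc X.str.1.pmor (Φ.base.2.str.1.res n) h (bo A) (bo B)
    have h₄ : (((Y.str.1.sm.mcmp h _ _).hom ≫ (Y.str.1.em h _ _).inv) ≫
        Y.base.str.mp (Φ.base.1.str.1.mc h A B).hom) ≫ Φ.str.c (X.str.1.lin.mul h A B) =
        Y.base.base.2.str.1.mm le_top (Φ.str.c A) (Φ.str.c B) ≫
          (Φ.base.2.str.1.mc le_top (X.base.str.o A) (X.base.str.o B)).hom ≫
          LinCat.map Φ.base.2.base (X.str.1.sm.mcmp h (X.base.str.o A) (X.base.str.o B)).hom ≫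
            LinCat.map Φ.base.2.base (X.str.1.em h A B).inv :=
      (congrArg (fun f => (f ≫ Y.base.str.mp (Φ.base.1.str.1.mc h A B).hom) ≫
        Φ.str.c (X.str.1.lin.mul h A B)) (Y.str.1.pmor_mc h _ _).symm).trans
        ((congrArg (· ≫ Φ.str.c (X.str.1.lin.mul h A B)) h₂.symm).trans (h₁.trans
          (congrArg (_ ≫ ·) (h₃.trans (congrArg (_ ≫ ·) ((congrArg (LinCat.map Φ.base.2.base)
            (X.str.1.pmor_mc h A B)).trans (LinCat.map_comp _ _ _)))))))
    -- So far the product condition of Φ is expressed through the composites of the Eckmann–Hilton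
    -- comparison with the inverse of `em`. Separating the two factors, with naturality of the
    -- comparison, turns it into the condition for the pair of `mulLin` and `mulSm`.
    have h₅ := comp_comp_inv_comp (Y.str.1.sm.mcmp h _ _) (Y.str.1.em h _ _)
      (LinCat.mapIso Φ.base.2.base (X.str.1.sm.mcmp h (X.base.str.o A) (X.base.str.o B)))
      (LinCat.mapIso Φ.base.2.base (X.str.1.em h A B)) (Y.str.1.sm.mcmp h _ _) h₄
      (Y.str.1.sm.mcmp_nat h _ _)
    have h₆ := APMor.comp_c ((ofBase Φ).str.tensor (ofBase Φ).str) (Y.str.1.m h).str (pr A B)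
    have h₇ := APMor.comp_c (X.str.1.m h).str (ofBase Φ).str (pr A B)
    exact (congrArg (· ≫ _) h₆).trans (h₅.trans (congrArg (_ ≫ ·) h₇.symm)))

/-- A 1-cell between comparisons as a morphism of `E_n`-algebras. -/
def ofMor : EnMor X.str.1 Y.str.1 (ofBase Φ) where
  e := unitIso Φ
  t h := mulIso Φ h

/-- Followed by the comparison `EnOb.cmp` of Y, this morphism has the same components as the
comparison of X followed by the symmetric monoidal functor of Φ, which satisfies the laws. The
comparison of Y has the identity as underlying functor, hence is faithful, and `EnMor.Laws.of_comp`
applies. -/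
theorem ofMor_smc_laws : (ofMor Φ).smc.Laws := by
  have : Functor.Faithful (𝟙 Y.base.smc : Y.base.smc ⟶ Y.base.smc).functor :=
    inferInstanceAs (Functor.Faithful (𝟭 Y.base.smc))
  have h₁ : (X.str.1.sm.cmp.comp (Φ.base.2.str.1.res n)).Laws :=
    (EnOb.cmp_laws (z := X.str.1.sm) X.str.2.2).comp (Φ.base.2.str.2.res n)
  refine EnMor.Laws.of_comp (q := Y.str.1.sm.cmp) (EnMor.Laws.of_eq
    (q := (X.str.1.sm.cmp.comp (Φ.base.2.str.1.res n) : EnMor X.str.1.sm.und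
      (Y.base.base.2.str.1.res n) (𝟙 X.base.smc ≫ Φ.base.2.base))) h₁ ?_ ?_)
    (EnOb.cmp_laws (z := Y.str.1.sm) Y.str.2.2)
  · exact (EnMor.comp_ec (ofMor Φ).smc Y.str.1.sm.cmp).trans
      ((Y.str.1.sm.ucmp.hom_inv_id_assoc _).trans
        (EnMor.comp_ec X.str.1.sm.cmp (Φ.base.2.str.1.res n)).symm)
  · exact fun h A B => (EnMor.comp_mc (ofMor Φ).smc Y.str.1.sm.cmp h A B).trans
      (((Y.str.1.sm.mcmp h _ _).hom_inv_id_assoc _).trans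
        (EnMor.comp_mc X.str.1.sm.cmp (Φ.base.2.str.1.res n) h A B).symm)

/-- A 1-cell from a 1-cell between the comparisons. -/
def ofHom : X ⟶ Y := ⟨ofBase Φ, ⟨ofMor Φ, Φ.base.1.str.2, ofMor_smc_laws Φ⟩⟩

/-- True by definition, since everything that was constructed in the lift is exactly what the
comparison forgets. -/
theorem toHom_ofHom : toHom (ofHom Φ) = Φ := rfl

end EnAP

/-! ### The comparison is essentially surjective on 0-cells -/

section

variable {C D : LinCat.{v, u} R}

/-- A morphism of the unit category is a scalar times the identity, and base change carries the
scalar along R → k. Naturality of the unit 1-cell built below is thereby linearity. -/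
theorem LinCat.map_bc_unit {A : LinCat.{v, u} k} (G : bc k (LinCat.unit.{v, u} R) ⟶ A)
    (f : (pt : LinCat.unit.{v, u} R) ⟶ pt) :
    LinCat.map G (bm f) = algebraMap R k (scalar pt pt f) • 𝟙 (obj G (bo pt)) := by
  have h₁ : f = scalar pt pt f • 𝟙 (pt : LinCat.unit.{v, u} R) :=
    congrArg ULift.up (mul_one f.down).symm
  have h₂ : (bm f : (bo pt : bc k (LinCat.unit.{v, u} R)) ⟶ bo pt) =
      algebraMap R k (scalar pt pt f) • 𝟙 (bo pt) :=
    (congrArg bm h₁).trans (bm_smul _ _)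
  rw [h₂, LinCat.map_smul, LinCat.map_id]

/-- A morphism of `E_n`-categories is determined by its components. -/
theorem EnMor.eq_of_components {x : EnOb n C} {y : EnOb n D} {F : C ⟶ D} {p q : EnMor x y F}
    (h₀ : p.ec.hom = q.ec.hom) (h₁ : ∀ h X Y, (p.mc h X Y).hom = (q.mc h X Y).hom) : p = q := by
  have h₂ : p.e = q.e := Iso.ext (LinCat.hom₂_ext fun r => by
    obtain rfl := EnOb.unit_eq r pt
    exact h₀)
  have h₃ : p.t = q.t := funext fun h => Iso.ext (LinCat.hom₂_ext fun P => by
    induction P using prInd with | h X Y =>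
    exact h₁ h X Y)
  cases p
  cases q
  cases h₂
  cases h₃
  rfl

/-- The comparison of products is trivial for the canonical `E_n`-algebra structure. -/
theorem EnLin.canon_mcmp (S : EnLin.{v, u} ⊤ R) (h : 1 ≤ n) (X Y : S.base) :
    ((canon n S).mcmp h X Y).hom = 𝟙 (S.str.1.mul le_top X Y) := by
  -- The comparison and the identity are both monoidal transformations from the product to itself.
  -- At pairs containing the unit the unit laws of the comparison cancel to the identity.
  have h₁ := EnMor.Two.ext_tensor ((canon n S).mcell_two h) (EnMor.Two.id (EnMor.mulMor S.str.2))
    le_top (A := S.str.1.one) (B := S.str.1.one) (Iso.refl _) (Iso.refl _)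
    (fun X => by
      have h₂ := (canon n S).mcmp_right h X
      exact (cancel_mono (S.str.1.rc le_top X).hom).1 (((Category.id_comp _).symm.trans
        (congrArg (· ≫ _) (S.str.1.mm_id le_top _ _).symm)).trans (h₂.trans
          (Category.id_comp _).symm)))
    (fun X => by
      have h₂ := (canon n S).mcmp_left h X
      exact (cancel_mono (S.str.1.lc le_top X).hom).1 (((Category.id_comp _).symm.trans
        (congrArg (· ≫ _) (S.str.1.mm_id le_top _ _).symm)).trans (h₂.trans
          (Category.id_comp _).symm)))
  exact congrArg (app · (pr X Y)) h₁

theorem comp_inv_comp_inv {A : Type u} [Category.{v} A] {a b c d e : A} (l : a ≅ b) (q : c ≅ d)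
    (l' : d ≅ e) {f : a ⟶ c} {g : b ⟶ e} (h : f ≫ q.hom ≫ l'.hom = l.hom ≫ g) :
    g ≫ l'.inv ≫ q.inv = l.inv ≫ f := by
  rw [Iso.eq_inv_comp, ← Category.assoc, ← h]
  simp only [Category.assoc, Iso.hom_inv_id_assoc, Iso.hom_inv_id, Category.comp_id]

/-- The pointed category underlying an `E_n`-category. -/
def EnOb.ptd (x : EnOb n C) : EnOb 0 C where
  u := x.u
  m h := (not_one_le_zero h).elim
  a h := (not_one_le_zero h).elim
  l h := (not_one_le_zero h).elim
  r h := (not_one_le_zero h).elim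
  b h := (not_one_le_zero h).elim

theorem EnOb.Laws.zero (x : EnOb 0 C) : x.Laws where
  pentagon h := (not_one_le_zero h).elim
  triangle h := (not_one_le_zero h).elim
  hexagon h := (not_one_le_zero h).elim
  hexagon' h := (not_one_le_zero h).elim
  symmetry h := (not_one_le_zero h).elim

/-- The pointed category underlying an `E_n`-category. -/
def EnLin.ptd (X : EnLin.{v, u} n R) : EnLin.{v, u} 0 R := ⟨X.base, ⟨X.str.1.ptd, EnOb.Laws.zero _⟩⟩

end

/-! ### The algebra in triples carried by a categorified `E_n`-algebra. -/

namespace AP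

variable (Y : AP.{v, u} k n R)

/-- The underlying `E_n`-algebra in linear categories. -/
abbrev ca : EnOb n Y.lin := Y.base.1.str.1

/-- The underlying symmetric monoidal category. -/
abbrev cs : EnOb ⊤ Y.smc := Y.base.2.str.1

/-- The compatibility of the equivalence with products. -/
def qm (h : 1 ≤ n) (A B : Y.lin) :
    Y.cs.mul le_top (Y.str.o A) (Y.str.o B) ≅ Y.str.o (Y.ca.mul h A B) :=
  Y.str.hom.str.1.mc h (bo A) (bo B)

/-- The compatibility of the equivalence with units. -/
def qe : Y.cs.one ≅ Y.str.o Y.ca.one := Y.str.hom.str.1.ec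

theorem qm_nat (h : 1 ≤ n) {A A' B B' : Y.lin} (f : A ⟶ A') (g : B ⟶ B') :
    Y.cs.mm le_top (Y.str.mp f) (Y.str.mp g) ≫ (Y.qm h A' B').hom =
      (Y.qm h A B).hom ≫ Y.str.mp (Y.ca.mm h f g) :=
  (Y.str.hom.str.1.mc_nat h (bm f) (bm g)).trans (congrArg ((Y.qm h A B).hom ≫
    LinCat.map Y.str.hom.base ·) (EnOb.bc_mul_map k Y.ca h f g))

theorem qm_assoc (h : 1 ≤ n) (A B C : Y.lin) :
    Y.cs.mm le_top (Y.qm h A B).hom (𝟙 (Y.str.o C)) ≫ (Y.qm h (Y.ca.mul h A B) C).hom ≫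
      Y.str.mp (Y.ca.ac h A B C).hom =
    (Y.cs.ac le_top (Y.str.o A) (Y.str.o B) (Y.str.o C)).hom ≫
      Y.cs.mm le_top (𝟙 (Y.str.o A)) (Y.qm h B C).hom ≫ (Y.qm h A (Y.ca.mul h B C)).hom :=
  Y.str.hom.str.2.assoc h (bo A) (bo B) (bo C)

theorem qm_left (h : 1 ≤ n) (A : Y.lin) :
    Y.cs.mm le_top Y.qe.hom (𝟙 (Y.str.o A)) ≫ (Y.qm h Y.ca.one A).hom ≫
      Y.str.mp (Y.ca.lc h A).hom = (Y.cs.lc le_top (Y.str.o A)).hom :=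
  Y.str.hom.str.2.left h (bo A)

theorem qm_right (h : 1 ≤ n) (A : Y.lin) :
    Y.cs.mm le_top (𝟙 (Y.str.o A)) Y.qe.hom ≫ (Y.qm h A Y.ca.one).hom ≫
      Y.str.mp (Y.ca.rc h A).hom = (Y.cs.rc le_top (Y.str.o A)).hom :=
  Y.str.hom.str.2.right h (bo A)

theorem qm_braid (h : 1 ≤ n) (h' : 2 ≤ n) (A B : Y.lin) :
    (Y.qm h A B).hom ≫ Y.str.mp (Y.ca.bc h h' A B).hom =
      (Y.cs.bc le_top le_top (Y.str.o A) (Y.str.o B)).hom ≫ (Y.qm h B A).hom :=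
  Y.str.hom.str.2.braid h h' (bo A) (bo B)

/-- The compatibility of the equivalence with the product of the unit with itself. -/
theorem qe_qm (h : 1 ≤ n) : Y.qe.hom ≫ Y.str.mp (Y.ca.lc h Y.ca.one).inv ≫
    (Y.qm h Y.ca.one Y.ca.one).inv =
      (Y.cs.lc le_top Y.cs.one).inv ≫ Y.cs.mm le_top Y.qe.hom Y.qe.hom := by
  have h₁ := Y.cs.mm_comp_eq le_top Y.qe.hom
    ((Y.qm h Y.ca.one Y.ca.one).hom ≫ Y.str.mp (Y.ca.lc h Y.ca.one).hom) (Y.qm_left h Y.ca.one)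
  exact comp_inv_comp_inv (Y.cs.lc le_top Y.cs.one) (Y.qm h Y.ca.one Y.ca.one)
    (LinCat.mapIso Y.str.hom.base (bmIso (Y.ca.lc h Y.ca.one))) h₁

/-- The categorified `E_0`-algebra underlying a categorified `E_n`-algebra. -/
def ptd : AP.{v, u} k 0 R :=
  ⟨(Y.base.1.ptd, Y.base.2), ⟨EnLin.pointed Y.str.hom.base Y.qe, Y.str.isEquivalence⟩⟩

/-- The unit of a categorified `E_n`-algebra. -/
def unitHom : I ⟶ Y.ptd :=
  ⟨(EnLin.pointed (X := I) (Y := Y.base.1.ptd) Y.ca.u (Iso.refl _), (EnLin.canon n Y.base.2).u),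
    APMor.mk₀ (APOb.unit R) Y.ptd.str (F := (EnLin.pointed (X := I) (Y := Y.base.1.ptd) Y.ca.u
      (Iso.refl _), (EnLin.canon n Y.base.2).u))
      (LinCat.isoMk (fun _ => Y.qe.symm) (nat_bc (F := LinCat.bcHom k Y.ca.u ≫ Y.str.hom.base)
        (G := bcUnit k ≫ Y.cs.u) (fun _ => Y.qe.inv) fun {r s} f => by
          obtain rfl := EnOb.unit_eq r pt
          obtain rfl := EnOb.unit_eq s pt
          rw [LinCat.map_bc_unit, LinCat.map_bc_unit]
          exact ((Linear.smul_comp _ _ _ _ _ _).trans (congrArg (_ • ·) ((Category.id_comp _).trans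
            (Category.comp_id _).symm))).trans (Linear.comp_smul _ _ _ _ _ _).symm))
      (by
        exact ((congrArg (Y.qe.hom ≫ · ≫ Y.qe.inv) (Y.str.mp_id _)).trans ((congrArg (_ ≫ ·)
          (Category.id_comp _)).trans Y.qe.hom_inv_id)).trans ((Category.id_comp _).trans
            (LinCat.map_id Y.cs.u pt)).symm)⟩

/-- The product of a categorified `E_n`-algebra. -/
def mulHom (h : 1 ≤ n) : tObj Y.ptd Y.ptd ⟶ Y.ptd :=
  ⟨(EnLin.pointed (X := tObj Y.base.1.ptd Y.base.1.ptd) (Y := Y.base.1.ptd) (Y.ca.m h)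
      (Y.ca.lc h Y.ca.one).symm, (EnLin.canon n Y.base.2).m h),
    APMor.mk₀ (Y.ptd.str.tensor Y.ptd.str) Y.ptd.str
      (F := (EnLin.pointed (X := tObj Y.base.1.ptd Y.base.1.ptd) (Y := Y.base.1.ptd) (Y.ca.m h)
        (Y.ca.lc h Y.ca.one).symm, (EnLin.canon n Y.base.2).m h))
      (LinCat.isoMk (fun P => (Y.qm h (fst (un P)) (snd (un P))).symm)
        (nat_bcT (F := LinCat.bcHom k (Y.ca.m h) ≫ Y.str.hom.base)
          (G := (split k _ _ ≫ tensorHom Y.str.hom.base Y.str.hom.base) ≫ Y.cs.m le_top)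
          (fun P => (Y.qm h (fst (un P)) (snd (un P))).inv) fun f g =>
            (inv_comp_comm (Y.qm h _ _) (Y.qm h _ _) (Y.qm_nat h f g).symm).symm))
      (Y.qe_qm h)⟩

theorem mulHom_c (h : 1 ≤ n) (A B : Y.lin) :
    (Y.mulHom h).str.c (pr A B) = (Y.qm h A B).inv := rfl

/-- Here and in `tensor_mulHom_c` the compatibility cells of the two sides of the associator are
computed. The identity 1-cell and the associator 1-cell contribute only identities. -/
theorem mulHom_tensor_c (h : 1 ≤ n) (A B C : Y.lin) :
    (((Y.mulHom h).str.tensor (APMor.id Y.ptd.str)).comp (Y.mulHom h).str).c (pr (pr A B) C) =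
      (Y.qm h (Y.ca.mul h A B) C).inv ≫ Y.cs.mm le_top (Y.qm h A B).inv (𝟙 (Y.str.o C)) :=
  (APMor.comp_c ((Y.mulHom h).str.tensor (APMor.id Y.ptd.str)) (Y.mulHom h).str
    (pr (pr A B) C)).trans (congrArg ((Y.qm h (Y.ca.mul h A B) C).inv ≫
      LinCat.map (Y.cs.m le_top) ·) (congrArg (tm (Y.qm h A B).inv) (APMor.id_c Y.ptd.str C)))

theorem tensor_mulHom_c (h : 1 ≤ n) (A B C : Y.lin) :
    ((APMor.assoc Y.ptd.str Y.ptd.str Y.ptd.str).comp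
      (((APMor.id Y.ptd.str).tensor (Y.mulHom h).str).comp (Y.mulHom h).str)).c (pr (pr A B) C) =
      (Y.qm h A (Y.ca.mul h B C)).inv ≫ Y.cs.mm le_top (𝟙 (Y.str.o A)) (Y.qm h B C).inv := by
  have h₃ := APMor.comp_c (APMor.assoc Y.ptd.str Y.ptd.str Y.ptd.str)
    (((APMor.id Y.ptd.str).tensor (Y.mulHom h).str).comp (Y.mulHom h).str) (pr (pr A B) C)
  have h₄ := APMor.comp_c ((APMor.id Y.ptd.str).tensor (Y.mulHom h).str) (Y.mulHom h).str
    (pr A (pr B C))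
  have h₆ : ((APMor.id Y.ptd.str).tensor (Y.mulHom h).str).c (pr A (pr B C)) =
      tm (𝟙 (Y.str.o A)) (Y.qm h B C).inv :=
    (APMor.tensor_c (APMor.id Y.ptd.str) (Y.mulHom h).str A (pr B C)).trans
      (congrArg₂ tm (APMor.id_c Y.ptd.str A) (Y.mulHom_c h B C))
  have h₅ : LinCat.map (tensorHom (𝟙 Y.smc) (Y.cs.m le_top) ≫ Y.cs.m le_top)
    ((APMor.assoc Y.ptd.str Y.ptd.str Y.ptd.str).c (pr (pr A B) C)) = 𝟙 _ := LinCat.map_id _ _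
  exact h₃.trans ((congrArg (_ ≫ ·) h₅).trans ((Category.comp_id _).trans
    (h₄.trans (congrArg ((Y.qm h A (Y.ca.mul h B C)).inv ≫ LinCat.map (Y.cs.m le_top) ·) h₆))))

/-- The associator of a categorified `E_n`-algebra. -/
def assocIso (h : 1 ≤ n) : tHom (Y.mulHom h) (𝟙 Y.ptd) ≫ Y.mulHom h ≅
    as Y.ptd Y.ptd Y.ptd ≫ tHom (𝟙 Y.ptd) (Y.mulHom h) ≫ Y.mulHom h :=
  TotalBicat.isoMk (Iso.prod (EnLin.isoPt (Y.ca.a h) (by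
    -- The multiplication is pointed by the inverse left unitor at 1, so the associator is a pointed
    -- 2-cell precisely by associativity of that map.
    have h₁ := EnOb.one_assoc Y.base.1.str.2 h
    have h₂ := EnMor.comp_ec (EnMor.tensor (Y.mulHom h).base.1.str.1 (EnMor.id Y.ca.ptd))
      (Y.mulHom h).base.1.str.1
    have h₃ := EnMor.comp_ec (EnMor.tensor (EnMor.id Y.ca.ptd) (Y.mulHom h).base.1.str.1)
      (Y.mulHom h).base.1.str.1
    have h₄ := EnMor.comp_ec (EnMor.assoc Y.ca.ptd Y.ca.ptd Y.ca.ptd)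
      ((EnMor.tensor (EnMor.id Y.ca.ptd) (Y.mulHom h).base.1.str.1).comp
        (Y.mulHom h).base.1.str.1)
    exact (congrArg (· ≫ _) h₂).trans ((Category.assoc _ _ _).trans (h₁.trans (h₃.symm.trans
      ((Category.comp_id _).symm.trans ((congrArg (_ ≫ ·) (LinCat.map_id
        (tensorHom (𝟙 Y.lin) (Y.ca.m h) ≫ Y.ca.m h) _).symm).trans h₄.symm)))))))
      ((EnLin.canon n Y.base.2).a h)) (APMor.two_iff.2 fun P => by
    induction P using prInd with | h P C =>
    induction P using prInd with | h A B =>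
    -- Compatibility with ψ is the associativity law of the monoidal functor ψ, with its comparisons
    -- inverted.
    have h₁ := inv_comp_inv (Y.cs.mmIso le_top (Y.qm h A B) (Iso.refl _))
      (Y.qm h (Y.ca.mul h A B) C) (Y.cs.mmIso le_top (Iso.refl _) (Y.qm h B C))
      (Y.qm h A (Y.ca.mul h B C)) (Y.qm_assoc h A B C)
    exact (congrArg (· ≫ (Y.cs.ac le_top (Y.str.o A) (Y.str.o B) (Y.str.o C)).hom)
      (Y.mulHom_tensor_c h A B C)).trans ((Category.assoc _ _ _).trans (h₁.trans
        (congrArg (Y.str.mp (Y.ca.ac h A B C).hom ≫ ·) (Y.tensor_mulHom_c h A B C)).symm)))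

/-- The left unitor of a categorified `E_n`-algebra. -/
def leftIso (h : 1 ≤ n) : tHom Y.unitHom (𝟙 Y.ptd) ≫ Y.mulHom h ≅ lu Y.ptd :=
  TotalBicat.isoMk (Iso.prod (EnLin.isoPt (Y.ca.l h) (by
    have h₂ := EnMor.comp_ec (EnMor.tensor Y.unitHom.base.1.str.1 (EnMor.id Y.ca.ptd))
      (Y.mulHom h).base.1.str.1
    exact (congrArg (· ≫ _) (h₂.trans ((congrArg (_ ≫ ·) (Y.ca.mm_id h _ _)).trans
      (Category.comp_id _)))).trans (Y.ca.lc h Y.ca.one).inv_hom_id))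
      ((EnLin.canon n Y.base.2).l h)) (APMor.two_iff.2 fun P => by
    induction P using prInd with | h r A =>
    obtain rfl := EnOb.unit_eq r pt
    have h₁ := inv_comp_eq' (Y.cs.mmIso le_top Y.qe (Iso.refl _)) (Y.qm h Y.ca.one A)
      (Y.qm_left h A)
    have h₂ := (APMor.comp_c (Y.unitHom.str.tensor (APMor.id Y.ptd.str)) (Y.mulHom h).str
      (pr pt A)).trans (congrArg ((Y.qm h Y.ca.one A).inv ≫ LinCat.map (Y.cs.m le_top) ·)
        (congrArg (tm Y.qe.inv) (APMor.id_c Y.ptd.str A)))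
    exact (congrArg (· ≫ _) h₂).trans ((Category.assoc _ _ _).trans (h₁.trans
      (Category.comp_id _).symm)))

/-- The right unitor of a categorified `E_n`-algebra. -/
def rightIso (h : 1 ≤ n) : tHom (𝟙 Y.ptd) Y.unitHom ≫ Y.mulHom h ≅ ru Y.ptd :=
  TotalBicat.isoMk (Iso.prod (EnLin.isoPt (Y.ca.r h) (by
    have h₂ := EnMor.comp_ec (EnMor.tensor (EnMor.id Y.ca.ptd) Y.unitHom.base.1.str.1)
      (Y.mulHom h).base.1.str.1
    exact (congrArg (· ≫ _) (h₂.trans ((congrArg (_ ≫ ·) (Y.ca.mm_id h _ _)).trans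
      (Category.comp_id _)))).trans ((congrArg (_ ≫ ·)
        (EnOb.lc_one_eq_rc_one Y.base.1.str.2 h).symm).trans (Y.ca.lc h Y.ca.one).inv_hom_id)))
      ((EnLin.canon n Y.base.2).r h)) (APMor.two_iff.2 fun P => by
    induction P using prInd with | h A r =>
    obtain rfl := EnOb.unit_eq r pt
    have h₁ := inv_comp_eq' (Y.cs.mmIso le_top (Iso.refl _) Y.qe) (Y.qm h A Y.ca.one)
      (Y.qm_right h A)
    have h₂ := (APMor.comp_c ((APMor.id Y.ptd.str).tensor Y.unitHom.str) (Y.mulHom h).str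
      (pr A pt)).trans (congrArg ((Y.qm h A Y.ca.one).inv ≫ LinCat.map (Y.cs.m le_top) ·)
        (congrArg (tm · Y.qe.inv) (APMor.id_c Y.ptd.str A)))
    exact (congrArg (· ≫ _) h₂).trans ((Category.assoc _ _ _).trans (h₁.trans
      (Category.comp_id _).symm)))

/-- The braiding of a categorified `E_n`-algebra. -/
def braidIso (h : 1 ≤ n) (h' : 2 ≤ n) : Y.mulHom h ≅ br Y.ptd Y.ptd ≫ Y.mulHom h :=
  TotalBicat.isoMk (Iso.prod (EnLin.isoPt (Y.ca.b h h') (by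
    have h₁ : (Y.ca.lc h Y.ca.one).inv ≫ (Y.ca.bc h h' Y.ca.one Y.ca.one).hom =
        (Y.ca.lc h Y.ca.one).inv := by
      rw [← cancel_mono (Y.ca.lc h Y.ca.one).hom, Category.assoc, EnOb.bc_lc Y.base.1.str.2,
        EnOb.lc_one_eq_rc_one Y.base.1.str.2]
    have h₂ := EnMor.comp_ec (EnMor.braid Y.ca.ptd Y.ca.ptd) (Y.mulHom h).base.1.str.1
    exact h₁.trans (((Category.comp_id _).symm.trans (congrArg (_ ≫ ·)
      (LinCat.map_id (Y.ca.m h) _).symm)).trans h₂.symm)))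
      ((EnLin.canon n Y.base.2).b h h')) (APMor.two_iff.2 fun P => by
    induction P using prInd with | h A B =>
    have h₁ := inv_comp_comm (Y.qm h A B) (Y.qm h B A) (Y.qm_braid h h' A B)
    have h₂ := APMor.comp_c (APMor.braid Y.ptd.str Y.ptd.str) (Y.mulHom h).str (pr A B)
    have h₃ : LinCat.map (Y.cs.m le_top) ((APMor.braid Y.ptd.str Y.ptd.str).c (pr A B)) = 𝟙 _ :=
      LinCat.map_id _ _
    exact h₁.trans (congrArg (_ ≫ ·) (h₂.trans ((congrArg (_ ≫ ·) h₃).trans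
      (Category.comp_id _))).symm))

/-- A categorified `E_n`-algebra as an `E_n`-algebra in categorified `E_0`-algebras. -/
def alg : EnOb n Y.ptd where
  u := Y.unitHom
  m := Y.mulHom
  a := Y.assocIso
  l := Y.leftIso
  r := Y.rightIso
  b := Y.braidIso

/-- A categorified `E_n`-algebra as a 0-cell of `E_n`-algebras in categorified `E_0`-algebras. -/
def enAP : EnAP.{v, u} k n R := ⟨Y.ptd, ⟨Y.alg, Y.base.1.str.2, Y.base.2.str.2.res n⟩⟩

/-- In passing to the algebra the comparisons of ψ are inverted, and `pmor` inverts them back and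
inserts the Eckmann–Hilton comparison. For the canonical structure the latter is the identity. -/
theorem alg_pmor : Y.alg.pmor = Y.str.hom.str.1 := EnMor.eq_of_components
  (Y.alg.pmor_ec.trans (Category.id_comp _))
  (fun h A B => (Y.alg.pmor_mc h (un A) (un B)).trans ((congrArg (· ≫ _)
    (EnLin.canon_mcmp Y.base.2 h (Y.str.o (un A)) (Y.str.o (un B)))).trans (Category.id_comp _)))

/-- The category, S and the functor ψ agree by definition; only the monoidal structure of ψ needs an
argument, and it is `alg_pmor`. -/
theorem toObj_enAP : EnAP.toObj Y.enAP = Y := by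
  -- The laws are a proof about the structure to be replaced. Generalising over both lets the
  -- equality be substituted.
  have h₁ : ∀ (p : EnMor (Y.ca.baseChange k) (Y.cs.res n) Y.str.hom.base) (hp : p.Laws),
      p = Y.str.hom.str.1 → (⟨Y.base, ⟨⟨Y.str.hom.base, ⟨p, hp⟩⟩, Y.str.isEquivalence⟩⟩ :
        AP.{v, u} k n R) = Y := by
    rintro p hp rfl
    rfl
  exact h₁ _ _ Y.alg_pmor

end AP

/-! ### The biequivalence. -/

namespace EnAP

theorem nonempty_equivalence_of_eq {B : Type*} [Bicategory B] {X Y : B} (h : X = Y) :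
    Nonempty (Bicategory.Equivalence X Y) := by
  subst h
  exact ⟨Bicategory.Equivalence.id X⟩

theorem toAP_map_faithful (X Y : EnAP.{v, u} k n R) :
    ((toAP.{v, u} k R n).mapFunctor X Y).Faithful := ⟨fun h => toHom₂_injective h⟩

theorem toAP_map_full (X Y : EnAP.{v, u} k n R) :
    ((toAP.{v, u} k R n).mapFunctor X Y).Full := ⟨fun t => ⟨ofHom₂ t, toHom₂_ofHom₂ t⟩⟩

theorem toAP_map_essSurj (X Y : EnAP.{v, u} k n R) :
    ((toAP.{v, u} k R n).mapFunctor X Y).EssSurj :=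
  ⟨fun Φ => ⟨ofHom Φ, ⟨eqToIso (toHom_ofHom Φ)⟩⟩⟩

variable (k R n) in
/-- The comparison of `E_n`-algebras in categorified `E_0`-algebras with categorified `E_n`-algebras
is a biequivalence. -/
theorem isBiequivalence_toAP : IsBiequivalence (toAP.{v, u} k R n) where
  essSurj Y := ⟨Y.enAP, nonempty_equivalence_of_eq Y.toObj_enAP⟩
  isEquivalence X Y :=
    { faithful := toAP_map_faithful X Y
      full := toAP_map_full X Y
      essSurj := toAP_map_essSurj X Y }

end EnAP

end

end CatDQ

end

theorem theorem4p3 (n : ℕ∞) (hn : n = 0 ∨ n = 1 ∨ n = 2 ∨ n = ⊤) :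
    (∃ F : CategoryTheory.Pseudofunctor (CatDQ.EnAPCat.{v, u} n) (CatDQ.APCat.{v, u} n),
      CatDQ.IsBiequivalence F) ∧
    (∃ F : CategoryTheory.Pseudofunctor (CatDQ.EnBDCat.{v, u} n) (CatDQ.BDCat.{v, u} n),
      CatDQ.IsBiequivalence F) :=
  ⟨⟨_, CatDQ.EnAP.isBiequivalence_toAP ℂ (DualNumber ℂ) n⟩,
    ⟨_, CatDQ.EnAP.isBiequivalence_toAP ℂ (PowerSeries ℂ) n⟩⟩
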